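/- For a smooth Riemannian metric $g$ on a Lie group $G$ with identity $e$ and Levi-Civita connection $\nabla$, let $S_e\subseteq T_eG$ be the subspace of all values $X|_e$ of smooth vector fields $X$ on $G$ that are Killing fields for $g$ (that is, $\mathcal L_X g=0$) and parallel at $e$ (that is, $(\nabla_Y X)|_e=0$ for every vector field $Y$). The index of symmetry is $i(G,g)=\dim S_e$. A Lie group is called solvable if its Lie algebra is solvable. (1) Every solvable three-dimensional real Lie algebra $\mathfrak g$ carries a left-invariant metric with positive index of symmetry: there is a simply connected Lie group with Lie algebra isomorphic to $\mathfrak g$, and there is an inner product $Q$ on $\mathfrak g$ such that for every Lie group $G$ and every Lie algebra isomorphism $\varphi:\mathrm{Lie}(G)\to\mathfrak g$ there is a left-invariant Riemannian metric $g$ on $G$ which equals $\varphi^*Q$ at $e$ and satisfies $i(G,g)>0$. (2) For every three-dimensional Lie group $G$ whose Lie algebra is solvable and every left-invariant Riemannian metric $g$ on $G$, $i(G,g)\neq 2$. -/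

import Mathlib

open scoped Manifold ContDiff

namespace IndexOfSymmetry

open Bundle VectorField

section Metric

variable {E : Type*} [NormedAddCommGroup E] [NormedSpace ℝ E]
  {H : Type*} [TopologicalSpace H] (I : ModelWithCorners ℝ E H)
  (M : Type*) [TopologicalSpace M] [ChartedSpace H M] [IsManifold I ∞ M]

/-- Smooth Riemannian metrics on the manifold `M`. -/
abbrev RiemMetric : Type _ :=
  ContMDiffRiemannianMetric I ∞ E (fun p : M ↦ TangentSpace I p)

end Metric

section Killing

variable {E : Type*} [NormedAddCommGroup E] [NormedSpace ℝ E]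
  {H : Type*} [TopologicalSpace H] {I : ModelWithCorners ℝ E H}
  {M : Type*} [TopologicalSpace M] [ChartedSpace H M] [IsManifold I ∞ M]

/-- A vector field `X` on `M` is smooth. -/
def IsSmoothField (X : Π p : M, TangentSpace I p) : Prop :=
  ContMDiff I I.tangent ∞ (fun p ↦ (X p : TangentBundle I M))

/-- A Killing field of `g` is a smooth vector field `X` with `𝓛_X g = 0`, that is,
`X (g (Y, Z)) = g ([X, Y], Z) + g (Y, [X, Z])` for all smooth vector fields `Y`, `Z`. -/
structure IsKilling (g : RiemMetric I M) (X : Π p : M, TangentSpace I p) : Prop where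
  smooth : IsSmoothField X
  lie_metric : ∀ Y Z : Π p : M, TangentSpace I p, IsSmoothField Y → IsSmoothField Z →
    ∀ p : M, mvfderiv I (fun q ↦ g.inner q (Y q) (Z q)) p (X p) =
      g.inner p (mlieBracket I X Y p) (Z p) + g.inner p (Y p) (mlieBracket I X Z p)

theorem IsSmoothField.mdifferentiableAt {X : Π p : M, TangentSpace I p} (hX : IsSmoothField X)
    (p : M) : MDiffAt (T% X) p :=
  ContMDiff.mdifferentiableAt hX (by simp)

variable [FiniteDimensional ℝ E]

theorem IsKilling.add {g : RiemMetric I M} {X X' : Π p : M, TangentSpace I p}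
    (hX : IsKilling g X) (hX' : IsKilling g X') : IsKilling g (X + X') where
  smooth := ContMDiff.add_section hX.smooth hX'.smooth
  lie_metric Y Z hY hZ p := by
    rw [mlieBracket_add_left (hX.smooth.mdifferentiableAt p) (hX'.smooth.mdifferentiableAt p),
      mlieBracket_add_left (hX.smooth.mdifferentiableAt p) (hX'.smooth.mdifferentiableAt p)]
    have h1 := hX.lie_metric Y Z hY hZ p
    have h2 := hX'.lie_metric Y Z hY hZ p
    simp only [Pi.add_apply, map_add, add_apply] at *
    linarith

theorem IsKilling.smul {g : RiemMetric I M} {X : Π p : M, TangentSpace I p}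
    (c : ℝ) (hX : IsKilling g X) : IsKilling g (c • X) where
  smooth := ContMDiff.const_smul_section hX.smooth
  lie_metric Y Z hY hZ p := by
    rw [mlieBracket_const_smul_left (hX.smooth.mdifferentiableAt p),
      mlieBracket_const_smul_left (hX.smooth.mdifferentiableAt p)]
    have h1 := hX.lie_metric Y Z hY hZ p
    simp only [Pi.smul_apply, map_smul, smul_apply, smul_eq_mul] at *
    linear_combination c * h1


/-- `cov` is the Levi-Civita connection of `g`: it is torsion free and compatible with `g`. -/
structure IsLeviCivita (g : RiemMetric I M)
    (cov : CovariantDerivative I E (TangentSpace I : M → Type _)) : Prop where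
  torsion_free : cov.torsion = 0
  metric : ∀ (p : M) (X Y Z : Π q : M, TangentSpace I q),
    MDiffAt (T% X) p → MDiffAt (T% Y) p → MDiffAt (T% Z) p →
    mvfderiv I (fun q ↦ g.inner q (Y q) (Z q)) p (X p) =
      g.inner p (cov Y p (X p)) (Z p) + g.inner p (Y p) (cov Z p (X p))

/-- The Levi-Civita connection is unique (on differentiable vector fields). -/
theorem IsLeviCivita.unique {g : RiemMetric I M}
    {cov cov' : CovariantDerivative I E (TangentSpace I : M → Type _)}
    (h : IsLeviCivita g cov) (h' : IsLeviCivita g cov')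
    {X : Π p : M, TangentSpace I p} {p : M} (hX : MDiffAt (T% X) p) :
    cov X p = cov' X p := by
  have ht : ∀ {Y Z : Π q : M, TangentSpace I q}, MDiffAt (T% Y) p → MDiffAt (T% Z) p →
      cov Z p (Y p) - cov Y p (Z p) = mlieBracket I Y Z p :=
    fun hY hZ ↦ cov.torsion_eq_zero_iff.1 h.torsion_free hY hZ
  have ht' : ∀ {Y Z : Π q : M, TangentSpace I q}, MDiffAt (T% Y) p → MDiffAt (T% Z) p →
      cov' Z p (Y p) - cov' Y p (Z p) = mlieBracket I Y Z p :=
    fun hY hZ ↦ cov'.torsion_eq_zero_iff.1 h'.torsion_free hY hZ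
  -- `D Y Z` is the difference of the two connections, `D Y Z = ∇_Z Y - ∇'_Z Y`
  let D : (Π q : M, TangentSpace I q) → (Π q : M, TangentSpace I q) → TangentSpace I p :=
    fun Y Z ↦ cov Y p (Z p) - cov' Y p (Z p)
  have hs : ∀ Y Z : Π q : M, TangentSpace I q, MDiffAt (T% Y) p → MDiffAt (T% Z) p →
      D Y Z = D Z Y := by
    intro Y Z hY hZ
    have h1 := ht hZ hY
    have h2 := ht' hZ hY
    have h3 := h1.trans h2.symm
    simp only [D]
    rw [sub_eq_sub_iff_add_eq_add] at h3 ⊢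
    rw [h3]
    abel
  have ha : ∀ Y Z W : Π q : M, TangentSpace I q, MDiffAt (T% Y) p → MDiffAt (T% Z) p →
      MDiffAt (T% W) p → g.inner p (D Y W) (Z p) + g.inner p (Y p) (D Z W) = 0 := by
    intro Y Z W hY hZ hW
    have h1 := h.metric p W Y Z hW hY hZ
    have h2 := h'.metric p W Y Z hW hY hZ
    simp only [D, map_sub, sub_apply]
    linarith
  have hz : ∀ Y Z W : Π q : M, TangentSpace I q, MDiffAt (T% Y) p → MDiffAt (T% Z) p →
      MDiffAt (T% W) p → g.inner p (D Y Z) (W p) = 0 := by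
    intro Y Z W hY hZ hW
    have e1 := ha Y W Z hY hW hZ
    have e2 := ha W Z Y hW hZ hY
    have e3 := ha Z Y W hZ hY hW
    rw [g.symm p (Y p), hs W Z hW hZ] at e1
    rw [g.symm p (W p), hs W Y hW hY, hs Z Y hZ hY] at e2
    rw [g.symm p (Z p)] at e3
    linarith
  ext v
  have hv : MDiffAt (T% (FiberBundle.extend E v : Π q : M, TangentSpace I q)) p :=
    FiberBundle.mdifferentiableAt_extend ..
  by_contra hne
  have hD : D X (FiberBundle.extend E v) ≠ 0 := by
    intro h0
    apply hne
    have : cov X p v - cov' X p v = 0 := by simpa [D] using h0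
    exact sub_eq_zero.1 this
  have hpos := g.pos p _ hD
  have hw : MDiffAt (T% (FiberBundle.extend E (D X (FiberBundle.extend E v)) :
      Π q : M, TangentSpace I q)) p :=
    FiberBundle.mdifferentiableAt_extend ..
  have := hz X _ _ hX hv hw
  simp only [FiberBundle.extend_apply_self] at this
  linarith

/-- The smooth vector field `X` is parallel at `p`: `∇_Y X` vanishes at `p` for every vector
field `Y`, where `∇` is the Levi-Civita connection of `g`. -/
def IsParallelAt (g : RiemMetric I M) (X : Π q : M, TangentSpace I q) (p : M) : Prop :=
  ∃ cov : CovariantDerivative I E (TangentSpace I : M → Type _), IsLeviCivita g cov ∧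
    ∀ Y : Π q : M, TangentSpace I q, cov X p (Y p) = 0

/-- The values at `p` of the Killing fields of `g` that are parallel at `p`. -/
def symmetrySet (g : RiemMetric I M) (p : M) : Set (TangentSpace I p) :=
  {x | ∃ X : Π q : M, TangentSpace I q, IsKilling g X ∧ IsParallelAt g X p ∧ X p = x}

theorem symmetrySet_add {g : RiemMetric I M} {p : M} {x y : TangentSpace I p}
    (hx : x ∈ symmetrySet g p) (hy : y ∈ symmetrySet g p) : x + y ∈ symmetrySet g p := by
  obtain ⟨X, hX, ⟨cov, hcov, hcX⟩, rfl⟩ := hx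
  obtain ⟨X', hX', ⟨cov', hcov', hcX'⟩, rfl⟩ := hy
  have h1 := hX.smooth.mdifferentiableAt p
  have h2 := hX'.smooth.mdifferentiableAt p
  refine ⟨X + X', hX.add hX', ⟨cov, hcov, fun Y ↦ ?_⟩, rfl⟩
  rw [cov.isCovariantDerivativeOn.add (s := Set.univ) h1 h2, hcov.unique hcov' h2, add_apply,
    hcX, hcX', add_zero]

theorem symmetrySet_smul {g : RiemMetric I M} {p : M} {x : TangentSpace I p} (c : ℝ)
    (hx : x ∈ symmetrySet g p) : c • x ∈ symmetrySet g p := by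
  obtain ⟨X, hX, ⟨cov, hcov, hcX⟩, rfl⟩ := hx
  have h1 := hX.smooth.mdifferentiableAt p
  refine ⟨c • X, hX.smul c, ⟨cov, hcov, fun Y ↦ ?_⟩, rfl⟩
  rw [cov.isCovariantDerivativeOn.smul_const (s := Set.univ) c h1, smul_apply, hcX, smul_zero]

/-- The subspace `S_p` of the values at `p` of the Killing fields that are parallel at `p`. (The
set of these values is itself closed under addition and scalar multiplication, see
`symmetrySet_add` and `symmetrySet_smul`.) -/
noncomputable def symmetrySubspace (g : RiemMetric I M) (p : M) : Submodule ℝ (TangentSpace I p) :=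
  Submodule.span ℝ (symmetrySet g p)

end Killing
section LieGroup

variable {E : Type*} [NormedAddCommGroup E] [NormedSpace ℝ E]
  {H : Type*} [TopologicalSpace H] {I : ModelWithCorners ℝ E H}
  {G : Type*} [TopologicalSpace G] [ChartedSpace H G] [Group G] [LieGroup I ∞ G]

/-- A smooth Lie group has the regularity under which `GroupLieAlgebra I G` is a Lie algebra. -/
instance instLieGroupMinSmoothness : LieGroup I (minSmoothness ℝ 3) G :=
  LieGroup.of_le (n := ∞) (by simpa using ENat.LEInfty.out)

/-- The Riemannian metric `g` on the Lie group `G` is left invariant: all left translations are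
isometries. -/
def IsLeftInvariant (g : RiemMetric I G) : Prop :=
  ∀ (a p : G) (u v : TangentSpace I p),
    g.inner (a * p) (mfderiv I I (fun q ↦ a * q) p u) (mfderiv I I (fun q ↦ a * q) p v) =
      g.inner p u v

/-- The index of symmetry of a metric on the Lie group `G`: the dimension of `S_e`, where `e` is
the identity. -/
noncomputable def indexOfSymmetry [FiniteDimensional ℝ E] (g : RiemMetric I G) : ℕ :=
  Module.finrank ℝ (symmetrySubspace g (1 : G))

end LieGroup

end IndexOfSymmetry

namespace IndexOfSymmetry

open Bundle VectorField

section InvariantFields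

variable {E : Type*} [NormedAddCommGroup E] [NormedSpace ℝ E]
  {H : Type*} [TopologicalSpace H] {I : ModelWithCorners ℝ E H}
  {G : Type*} [TopologicalSpace G] [ChartedSpace H G] [Group G]

/-- The right-invariant vector field with value `v` at the identity. -/
noncomputable def rightInvariantField (v : GroupLieAlgebra I G) (g : G) : TangentSpace I g :=
  mfderiv I I (fun x : G ↦ x * g) 1 v

/-- The adjoint action of `g⁻¹` on the Lie algebra. -/
noncomputable def adjointInv (g : G) (v : GroupLieAlgebra I G) : GroupLieAlgebra I G :=
  mfderiv I I (fun x : G ↦ g⁻¹ * x * g) 1 v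

/-- The left trivialization of the tangent bundle. -/
noncomputable def leftTrivialization (g : G) : TangentSpace I g →L[ℝ] GroupLieAlgebra I G :=
  mfderiv I I (fun x : G ↦ g⁻¹ * x) g

theorem mfderiv_apply_of_eq_id {f : G → G} (hf : f = id) (p : G) (v : TangentSpace I p) :
    (show E from mfderiv I I f p v) = v := by
  subst hf
  rw [mfderiv_id]
  rfl

variable [LieGroup I ∞ G]

theorem mdifferentiableAt_mul_left' (a g : G) :
    MDifferentiableAt I I (fun x : G ↦ a * x) g :=
  (contMDiff_mul_left (n := ∞)).contMDiffAt.mdifferentiableAt (by simp)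

theorem mdifferentiableAt_mul_right' (a g : G) :
    MDifferentiableAt I I (fun x : G ↦ x * a) g :=
  (contMDiff_mul_right (n := ∞)).contMDiffAt.mdifferentiableAt (by simp)

theorem mfderiv_mul_apply (a b : G) (u : TangentSpace I a) (v : TangentSpace I b) :
    mfderiv (I.prod I) I (fun p : G × G ↦ p.1 * p.2) (a, b) (u, v) =
      mfderiv I I (fun x ↦ x * b) a u + mfderiv I I (fun x ↦ a * x) b v := by
  exact mfderiv_prod_eq_add_apply (p := (a, b)) ((contMDiff_mul I ∞).mdifferentiableAt (by simp))

theorem contMDiff_tangentMap_mul {M : Type*} {E' : Type*} [NormedAddCommGroup E'] [NormedSpace ℝ E']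
    {H' : Type*} [TopologicalSpace H'] {J : ModelWithCorners ℝ E' H'} [TopologicalSpace M]
    [ChartedSpace H' M] {p : M} {U V : M → TangentBundle I G}
    (hU : ContMDiffAt J I.tangent ∞ U p) (hV : ContMDiffAt J I.tangent ∞ V p) :
    ContMDiffAt J I.tangent ∞ (fun m ↦ TotalSpace.mk' E ((U m).1 * (V m).1)
      (mfderiv I I (fun x ↦ x * (V m).1) (U m).1 (U m).2 +
        mfderiv I I (fun x ↦ (U m).1 * x) (V m).1 (V m).2 : TangentSpace I ((U m).1 * (V m).1))) p := by
  have S₂ : ContMDiff (I.tangent.prod I.tangent) (I.prod I).tangent ∞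
    (equivTangentBundleProd I G I G).symm := contMDiff_equivTangentBundleProd_symm
  have S₃ : ContMDiff (I.prod I).tangent I.tangent ∞
      (tangentMap (I.prod I) I (fun (p : G × G) ↦ p.1 * p.2)) :=
    (contMDiff_mul I ∞).contMDiff_tangentMap (m := ∞) (by simp)
  have S := (S₃.comp S₂).contMDiffAt.comp p (hU.prodMk hV)
  convert! S using 1
  funext m
  simp only [Function.comp_apply, tangentMap]
  exact congrArg (TotalSpace.mk' E ((U m).1 * (V m).1)) (mfderiv_mul_apply _ _ _ _).symm

theorem isSmoothField_mulInvariantVectorField (v : GroupLieAlgebra I G) :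
    IsSmoothField (mulInvariantVectorField v) := by
  intro p
  have h := contMDiff_tangentMap_mul (I := I) (U := fun g ↦ TotalSpace.mk' E g 0)
    (V := fun _ ↦ TotalSpace.mk' E (1 : G) v)
    (contMDiff_zeroSection ℝ (TangentSpace I : G → Type _)).contMDiffAt
    (contMDiffAt_const (x := p) (n := ∞))
  convert! h using 2 with g
  simp
  rfl

theorem isSmoothField_rightInvariantField (v : GroupLieAlgebra I G) :
    IsSmoothField (rightInvariantField v) := by
  intro p
  have h := contMDiff_tangentMap_mul (I := I) (V := fun g ↦ TotalSpace.mk' E g 0)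
    (U := fun _ ↦ TotalSpace.mk' E (1 : G) v)
    (contMDiffAt_const (x := p) (n := ∞))
    (contMDiff_zeroSection ℝ (TangentSpace I : G → Type _)).contMDiffAt
  convert! h using 2 with g
  simp
  rfl

theorem contMDiffAt_leftTrivialization {X : Π g : G, TangentSpace I g} {p : G}
    (hX : ContMDiffAt I I.tangent ∞ (fun g ↦ (X g : TangentBundle I G)) p) :
    ContMDiffAt I 𝓘(ℝ, E) ∞ (M' := E) (fun g ↦ leftTrivialization g (X g)) p := by
  have h := contMDiff_tangentMap_mul (I := I) (U := fun g ↦ TotalSpace.mk' E g⁻¹ 0)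
    (V := fun g ↦ TotalSpace.mk' E g (X g))
    ((contMDiff_zeroSection ℝ (TangentSpace I : G → Type _)).contMDiffAt.comp p
      ((contMDiff_inv I ∞).contMDiffAt (x := p))) hX
  have h' : ContMDiffAt I I.tangent ∞
      (fun g ↦ TotalSpace.mk' (E := (TangentSpace I : G → Type _)) E (1 : G)
        (leftTrivialization g (X g))) p := by
    convert! h using 2 with g
    simp
    rfl
  have h2 := (contMDiffAt_totalSpace.1 h').2
  refine h2.congr_of_eventuallyEq (Filter.Eventually.of_forall fun g ↦ ?_)
  exact ((tangentBundleCore I G).coordChange_self (achart _ 1) 1 (mem_achart_source H 1) _).symm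

theorem leftTrivialization_mulInvariantVectorField (v : GroupLieAlgebra I G) (g : G) :
    leftTrivialization g (mulInvariantVectorField v g) = v := by
  have h : mfderiv I I ((fun x : G ↦ g⁻¹ * x) ∘ (fun x ↦ g * x)) 1 = ContinuousLinearMap.id ℝ _ := by
    have : (fun x ↦ g⁻¹ * x) ∘ (fun x ↦ g * x) = id := by ext x; simp
    rw [this, mfderiv_id]
  rw [mfderiv_comp (I' := I) _ (mdifferentiableAt_mul_left' _ _)
    (mdifferentiableAt_mul_left' _ _)] at h
  have h2 := congrArg (fun T ↦ T v) h
  have e : g * 1 = g := mul_one g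
  simp only [leftTrivialization, mulInvariantVectorField]
  rw [e] at h2
  exact h2

theorem mulInvariantVectorField_leftTrivialization (g : G) (u : TangentSpace I g) :
    mulInvariantVectorField (leftTrivialization g u) g = u := by
  have h : mfderiv I I ((fun x : G ↦ g * x) ∘ (fun x ↦ g⁻¹ * x)) g = ContinuousLinearMap.id ℝ _ := by
    have : (fun x ↦ g * x) ∘ (fun x ↦ g⁻¹ * x) = id := by ext x; simp
    rw [this, mfderiv_id]
  rw [mfderiv_comp (I' := I) _ (mdifferentiableAt_mul_left' _ _)
    (mdifferentiableAt_mul_left' _ _)] at h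
  have h2 := congrArg (fun T ↦ T u) h
  have e : g⁻¹ * g = 1 := inv_mul_cancel g
  simp only [leftTrivialization, mulInvariantVectorField]
  rw [e] at h2
  exact h2

theorem leftTrivialization_rightInvariantField (v : GroupLieAlgebra I G) (g : G) :
    leftTrivialization g (rightInvariantField v g) = adjointInv g v := by
  have h : (fun x : G ↦ g⁻¹ * x * g) = (fun x : G ↦ g⁻¹ * x) ∘ (fun x ↦ x * g) := by
    ext x; simp [mul_assoc]
  rw [adjointInv, h, mfderiv_comp (I' := I) _ (mdifferentiableAt_mul_left' _ _)
    (mdifferentiableAt_mul_right' _ _)]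
  have e : 1 * g = g := one_mul g
  simp only [leftTrivialization, rightInvariantField]
  rw [e]
  rfl

theorem rightInvariantField_eq (v : GroupLieAlgebra I G) (g : G) :
    rightInvariantField v g = mulInvariantVectorField (adjointInv g v) g := by
  rw [← leftTrivialization_rightInvariantField, mulInvariantVectorField_leftTrivialization]

theorem rightInvariantField_one (v : GroupLieAlgebra I G) :
    rightInvariantField v (1 : G) = v := by
  exact mfderiv_apply_of_eq_id (by ext; simp) 1 v

theorem mulInvariantVectorField_one (v : GroupLieAlgebra I G) :
    mulInvariantVectorField v (1 : G) = v := by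
  exact mfderiv_apply_of_eq_id (by ext; simp) 1 v

theorem adjointInv_one (v : GroupLieAlgebra I G) : adjointInv (1 : G) v = v := by
  exact mfderiv_apply_of_eq_id (by ext; simp) 1 v

end InvariantFields

section Adjoint

variable {E : Type*} [NormedAddCommGroup E] [NormedSpace ℝ E]
  {H : Type*} [TopologicalSpace H] {I : ModelWithCorners ℝ E H}
  {G : Type*} [TopologicalSpace G] [ChartedSpace H G] [Group G] [LieGroup I ∞ G]

theorem mpullback_mul_left_rightInvariantField (a : G) (v : GroupLieAlgebra I G) :
    mpullback I I (a * ·) (rightInvariantField v) = rightInvariantField (adjointInv a v) := by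
  ext x
  rw [mpullback_apply, inverse_mfderiv_mul_left]
  have h1 := mfderiv_comp (I' := I) (1 : G) (mdifferentiableAt_mul_left' a⁻¹ (1 * (a * x)))
    (mdifferentiableAt_mul_right' (a * x) 1)
  have h2 := mfderiv_comp (I' := I) (1 : G) (mdifferentiableAt_mul_right' x (a⁻¹ * 1 * a))
    ((mdifferentiableAt_mul_right' a (a⁻¹ * 1)).comp (1 : G) (mdifferentiableAt_mul_left' a⁻¹ 1))
  have e : (fun y : G ↦ a⁻¹ * y) ∘ (fun y ↦ y * (a * x)) =
      (fun y : G ↦ y * x) ∘ ((fun y ↦ y * a) ∘ fun y ↦ a⁻¹ * y) := by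
    ext y; simp [mul_assoc]
  rw [e] at h1
  have h3 := congrArg (fun T ↦ T v) (h1.symm.trans h2)
  have e1 : 1 * (a * x) = a * x := one_mul _
  have e2 : a⁻¹ * 1 * a = 1 := by simp
  have h4 : (mfderiv I I (fun y : G ↦ a⁻¹ * y) (1 * (a * x))) (mfderiv I I (fun y ↦ y * (a * x)) 1 v) =
    (mfderiv I I (fun y : G ↦ y * x) (a⁻¹ * 1 * a)) (mfderiv I I (fun y ↦ a⁻¹ * y * a) 1 v) := h3
  simp only [rightInvariantField, adjointInv]
  rw [e1, e2] at h4
  exact h4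

theorem adjointInv_injective (g : G) {v : GroupLieAlgebra I G} (hv : adjointInv g v = 0) :
    v = 0 := by
  have h0 : rightInvariantField v g = 0 := by
    rw [rightInvariantField_eq, hv]
    exact map_zero _
  have h2 : mfderiv I I ((fun x : G ↦ x * g⁻¹) ∘ (fun x ↦ x * g)) 1 =
      ContinuousLinearMap.id ℝ _ := by
    have : (fun x ↦ x * g⁻¹) ∘ (fun x ↦ x * g) = id := by ext x; simp
    rw [this, mfderiv_id]
  rw [mfderiv_comp (I' := I) _ (mdifferentiableAt_mul_right' _ _)
    (mdifferentiableAt_mul_right' _ _)] at h2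
  have h3 := congrArg (fun T ↦ T v) h2
  have h4 : mfderiv I I (fun x : G ↦ x * g⁻¹) (1 * g) (mfderiv I I (fun x ↦ x * g) 1 v) = v := h3
  have h5 : mfderiv I I (fun x : G ↦ x * g) 1 v = 0 := h0
  rw [h5] at h4
  exact h4.symm.trans (map_zero _)

theorem adjointInv_lie [FiniteDimensional ℝ E] (g : G) (v w : GroupLieAlgebra I G) :
    adjointInv g ⁅v, w⁆ = ⁅adjointInv g v, adjointInv g w⁆ := by
  have : CompleteSpace E := FiniteDimensional.complete ℝ E
  let c : G → G := fun x ↦ g⁻¹ * x * g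
  let c' : G → G := fun x ↦ g * x * g⁻¹
  have hc : ContMDiff I I ∞ c := contMDiff_mul_right.comp contMDiff_mul_left
  have hc' : ContMDiff I I ∞ c' := contMDiff_mul_right.comp contMDiff_mul_left
  have dc : ∀ x, MDifferentiableAt I I c x := fun x ↦ hc.contMDiffAt.mdifferentiableAt (by simp)
  have dc' : ∀ x, MDifferentiableAt I I c' x := fun x ↦ hc'.contMDiffAt.mdifferentiableAt (by simp)
  have hcc' : c ∘ c' = id := by ext x; simp [c, c', mul_assoc]
  have hc'c : c' ∘ c = id := by ext x; simp [c, c', mul_assoc]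
  have hinv : ∀ x, (mfderiv I I c x).IsInvertible := by
    intro x
    have h1 : mfderiv I I (c' ∘ c) x = ContinuousLinearMap.id ℝ _ := by rw [hc'c, mfderiv_id]
    have h2 : mfderiv I I (c ∘ c') (c x) = ContinuousLinearMap.id ℝ _ := by rw [hcc', mfderiv_id]
    rw [mfderiv_comp (I' := I) _ (dc' _) (dc _)] at h1
    rw [mfderiv_comp (I' := I) _ (dc _) (dc' _)] at h2
    have e : c' (c x) = x := congrFun hc'c x
    rw [e] at h2
    exact ContinuousLinearMap.IsInvertible.of_inverse h2 h1
  have hpull : ∀ u : GroupLieAlgebra I G,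
      mpullback I I c (mulInvariantVectorField (adjointInv g u)) = mulInvariantVectorField u := by
    intro u
    ext x
    refine (hinv x).inverse_apply_eq.2 ?_
    have e : (fun y : G ↦ c x * y) ∘ c = c ∘ (fun y ↦ x * y) := by
      ext y; simp [c, mul_assoc]
    have h1 := mfderiv_comp (I' := I) (1 : G) (mdifferentiableAt_mul_left' (c x) (c 1)) (dc 1)
    have h2 := mfderiv_comp (I' := I) (1 : G) (dc (x * 1)) (mdifferentiableAt_mul_left' x 1)
    rw [e] at h1
    have h3 : mfderiv I I (fun y : G ↦ c x * y) (c 1) (mfderiv I I c 1 u) =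
        mfderiv I I c (x * 1) (mfderiv I I (fun y : G ↦ x * y) 1 u) :=
      congrArg (fun T ↦ T u) (h1.symm.trans h2)
    have e1 : c 1 = 1 := by simp [c]
    have e2 : x * 1 = x := mul_one x
    rw [e1, e2] at h3
    exact h3
  have h := mpullback_mlieBracket (I := I) (I' := I) (f := c) (x₀ := 1) (n := ∞)
    (V := mulInvariantVectorField (adjointInv g v)) (W := mulInvariantVectorField (adjointInv g w))
    ((isSmoothField_mulInvariantVectorField _).mdifferentiableAt _)
    ((isSmoothField_mulInvariantVectorField _).mdifferentiableAt _)
    hc.contMDiffAt (by simpa using ENat.LEInfty.out)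
  rw [hpull, hpull, mpullback_apply] at h
  have h2 := (hinv 1).inverse_apply_eq.1 h
  have e1 : c 1 = 1 := by simp [c]
  rw [e1] at h2
  exact h2.symm

end Adjoint

section Brackets

open Filter Topology

variable {E : Type*} [NormedAddCommGroup E] [NormedSpace ℝ E]
  {H : Type*} [TopologicalSpace H] {I : ModelWithCorners ℝ E H} [I.Boundaryless]
  {G : Type*} [TopologicalSpace G] [ChartedSpace H G] [Group G]

variable (I G) in
/-- The group multiplication in the chart at the identity. -/
noncomputable def chartMul (p : E × E) : E :=
  extChartAt I (1 : G) ((extChartAt I (1 : G)).symm p.1 * (extChartAt I (1 : G)).symm p.2)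

variable [LieGroup I ∞ G]

theorem contDiffAt_chartMul :
    ContDiffAt ℝ ∞ (chartMul I G) (extChartAt I (1 : G) 1, extChartAt I (1 : G) 1) := by
  have hs : ContMDiffAt 𝓘(ℝ, E) I ∞ (extChartAt I (1 : G)).symm (extChartAt I (1 : G) 1) :=
    (contMDiffOn_extChartAt_symm (1 : G)).contMDiffAt (extChartAt_target_mem_nhds _)
  have h1 : ContMDiffAt 𝓘(ℝ, E × E) I ∞ (fun p : E × E ↦ (extChartAt I (1 : G)).symm p.1)
      (extChartAt I (1 : G) 1, extChartAt I (1 : G) 1) :=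
    ContMDiffAt.comp (I' := 𝓘(ℝ, E)) (_ : E × E) hs contDiffAt_fst.contMDiffAt
  have h2 : ContMDiffAt 𝓘(ℝ, E × E) I ∞ (fun p : E × E ↦ (extChartAt I (1 : G)).symm p.2)
      (extChartAt I (1 : G) 1, extChartAt I (1 : G) 1) :=
    ContMDiffAt.comp (I' := 𝓘(ℝ, E)) (_ : E × E) hs contDiffAt_snd.contMDiffAt
  have h3 := h1.mul h2
  refine ContMDiffAt.contDiffAt ?_
  refine ContMDiffAt.comp (I' := I) (_ : E × E) ?_ h3
  exact contMDiffAt_extChartAt' (by simp)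

theorem eventually_differentiableAt_chartMul :
    ∀ᶠ p in 𝓝 (extChartAt I (1 : G) 1, extChartAt I (1 : G) 1),
      DifferentiableAt ℝ (chartMul I G) p := by
  have h := ((contDiffAt_chartMul (I := I) (G := G)).of_le (m := 1) (by simp)).eventually (by simp)
  filter_upwards [h] with p hp using hp.differentiableAt (by simp)

theorem eventually_mfderiv_chart_left (w : GroupLieAlgebra I G) :
    ∀ᶠ a in 𝓝 (1 : G), mfderiv I 𝓘(ℝ, E) (extChartAt I (1 : G)) a (mulInvariantVectorField w a) =
      fderiv ℝ (chartMul I G) (extChartAt I (1 : G) a, extChartAt I (1 : G) 1)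
        (0, mfderiv I 𝓘(ℝ, E) (extChartAt I (1 : G)) 1 w) := by
  have hc : Tendsto (fun a ↦ (extChartAt I (1 : G) a, extChartAt I (1 : G) 1)) (𝓝 1)
      (𝓝 (extChartAt I (1 : G) 1, extChartAt I (1 : G) 1)) :=
    ((continuousAt_extChartAt (1 : G)).prodMk continuousAt_const)
  filter_upwards [hc.eventually eventually_differentiableAt_chartMul,
    chart_source_mem_nhds H (1 : G)] with a ha has
  set φ := extChartAt I (1 : G) with hφ
  have h1 : HasMFDerivAt I 𝓘(ℝ, E) (fun z ↦ φ (a * z)) 1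
      ((mfderiv I 𝓘(ℝ, E) φ (a * 1)).comp (mfderiv I I (fun z ↦ a * z) 1)) := by
    refine HasMFDerivAt.comp (I' := I) _ ?_ (mdifferentiableAt_mul_left' a 1).hasMFDerivAt
    refine (mdifferentiableAt_extChartAt ?_).hasMFDerivAt
    rwa [mul_one]
  have h2 : HasMFDerivAt I 𝓘(ℝ, E) (fun z ↦ chartMul I G (φ a, φ z)) 1
      (((fderiv ℝ (chartMul I G) (φ a, φ 1)).comp (ContinuousLinearMap.inr ℝ E E)).comp
        (mfderiv I 𝓘(ℝ, E) φ 1)) := by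
    have hN : HasFDerivAt (fun y ↦ chartMul I G (φ a, y))
        ((fderiv ℝ (chartMul I G) (φ a, φ 1)).comp (ContinuousLinearMap.inr ℝ E E)) (φ 1) :=
      HasFDerivAt.comp (g := chartMul I G) (φ 1) ha.hasFDerivAt (hasFDerivAt_prodMk_right (φ a) (φ 1))
    exact HasMFDerivAt.comp (I' := 𝓘(ℝ, E)) (g := fun y ↦ chartMul I G (φ a, y)) (f := φ) (1 : G)
      hN.hasMFDerivAt (mdifferentiableAt_extChartAt (mem_chart_source H (1 : G))).hasMFDerivAt
  have h3 : (fun z ↦ chartMul I G (φ a, φ z)) =ᶠ[𝓝 1] (fun z ↦ φ (a * z)) := by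
    filter_upwards [extChartAt_source_mem_nhds (I := I) (1 : G)] with z hz
    simp only [chartMul]
    rw [(extChartAt I (1 : G)).left_inv hz, (extChartAt I (1 : G)).left_inv (by simpa using has)]
  have h4 := (h2.congr_of_eventuallyEq h3.symm).mfderiv.symm.trans h1.mfderiv
  have h5 := congrArg (fun T ↦ T w) h4
  have e : a * 1 = a := mul_one a
  simp only [mulInvariantVectorField]
  rw [e] at h5
  exact h5.symm

theorem eventually_mfderiv_chart_right (w : GroupLieAlgebra I G) :
    ∀ᶠ a in 𝓝 (1 : G), mfderiv I 𝓘(ℝ, E) (extChartAt I (1 : G)) a (rightInvariantField w a) =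
      fderiv ℝ (chartMul I G) (extChartAt I (1 : G) 1, extChartAt I (1 : G) a)
        (mfderiv I 𝓘(ℝ, E) (extChartAt I (1 : G)) 1 w, 0) := by
  have hc : Tendsto (fun a ↦ (extChartAt I (1 : G) 1, extChartAt I (1 : G) a)) (𝓝 1)
      (𝓝 (extChartAt I (1 : G) 1, extChartAt I (1 : G) 1)) :=
    (continuousAt_const.prodMk (continuousAt_extChartAt (1 : G)))
  filter_upwards [hc.eventually eventually_differentiableAt_chartMul,
    chart_source_mem_nhds H (1 : G)] with a ha has
  set φ := extChartAt I (1 : G) with hφ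
  have h1 : HasMFDerivAt I 𝓘(ℝ, E) (fun z ↦ φ (z * a)) 1
      ((mfderiv I 𝓘(ℝ, E) φ (1 * a)).comp (mfderiv I I (fun z ↦ z * a) 1)) := by
    refine HasMFDerivAt.comp (I' := I) _ ?_ (mdifferentiableAt_mul_right' a 1).hasMFDerivAt
    refine (mdifferentiableAt_extChartAt ?_).hasMFDerivAt
    rwa [one_mul]
  have h2 : HasMFDerivAt I 𝓘(ℝ, E) (fun z ↦ chartMul I G (φ z, φ a)) 1
      (((fderiv ℝ (chartMul I G) (φ 1, φ a)).comp (ContinuousLinearMap.inl ℝ E E)).comp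
        (mfderiv I 𝓘(ℝ, E) φ 1)) := by
    have hN : HasFDerivAt (fun y ↦ chartMul I G (y, φ a))
        ((fderiv ℝ (chartMul I G) (φ 1, φ a)).comp (ContinuousLinearMap.inl ℝ E E)) (φ 1) :=
      HasFDerivAt.comp (g := chartMul I G) (φ 1) ha.hasFDerivAt (hasFDerivAt_prodMk_left (φ 1) (φ a))
    exact HasMFDerivAt.comp (I' := 𝓘(ℝ, E)) (g := fun y ↦ chartMul I G (y, φ a)) (f := φ) (1 : G)
      hN.hasMFDerivAt (mdifferentiableAt_extChartAt (mem_chart_source H (1 : G))).hasMFDerivAt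
  have h3 : (fun z ↦ chartMul I G (φ z, φ a)) =ᶠ[𝓝 1] (fun z ↦ φ (z * a)) := by
    filter_upwards [extChartAt_source_mem_nhds (I := I) (1 : G)] with z hz
    simp only [chartMul]
    rw [(extChartAt I (1 : G)).left_inv hz, (extChartAt I (1 : G)).left_inv (by simpa using has)]
  have h4 := (h2.congr_of_eventuallyEq h3.symm).mfderiv.symm.trans h1.mfderiv
  have h5 := congrArg (fun T ↦ T w) h4
  have e : 1 * a = a := one_mul a
  simp only [rightInvariantField]
  rw [e] at h5
  exact h5.symm

/-- A vector field read in a chart, near the base point of the chart. -/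
theorem eventually_mpullbackWithin_extChartAt_symm {V : Π g : G, TangentSpace I g} {F : E → E}
    (h : ∀ᶠ a in 𝓝 (1 : G), mfderiv I 𝓘(ℝ, E) (extChartAt I (1 : G)) a (V a) =
      F (extChartAt I (1 : G) a)) :
    mpullbackWithin 𝓘(ℝ, E) I (extChartAt I (1 : G)).symm V (Set.range I)
      =ᶠ[𝓝 (extChartAt I (1 : G) 1)] F := by
  have hc : Tendsto (extChartAt I (1 : G)).symm (𝓝 (extChartAt I (1 : G) 1)) (𝓝 1) := by
    simpa using! (continuousAt_extChartAt_symm (I := I) (1 : G)).tendsto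
  filter_upwards [hc.eventually h, extChartAt_target_mem_nhds (I := I) (1 : G)] with x hx hxt
  rw [(extChartAt I (1 : G)).right_inv hxt] at hx
  refine (isInvertible_mfderivWithin_extChartAt_symm hxt).inverse_apply_eq.2 ?_
  refine Eq.trans ?_ (congrArg (mfderiv[Set.range I] (extChartAt I (1 : G)).symm x) hx)
  have h2 := mfderivWithin_extChartAt_symm_comp_mfderiv_extChartAt (I := I) (x := (1 : G)) hxt
  exact (congrArg (fun T ↦ T (V ((extChartAt I (1 : G)).symm x))) h2).symm

theorem mlieBracket_left_right_one (v w : GroupLieAlgebra I G) :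
    mlieBracket I (mulInvariantVectorField v) (rightInvariantField w) (1 : G) = 0 := by
  set φ := extChartAt I (1 : G) with hφ
  set v' : E := mfderiv I 𝓘(ℝ, E) φ 1 v with hv'
  set w' : E := mfderiv I 𝓘(ℝ, E) φ 1 w with hw'
  have hV := eventually_mpullbackWithin_extChartAt_symm
    (F := fun x ↦ fderiv ℝ (chartMul I G) (x, φ 1) (0, v')) (eventually_mfderiv_chart_left v)
  have hW := eventually_mpullbackWithin_extChartAt_symm
    (F := fun x ↦ fderiv ℝ (chartMul I G) (φ 1, x) (w', 0)) (eventually_mfderiv_chart_right w)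
  rw [← mlieBracketWithin_univ, mlieBracketWithin_apply]
  have key : lieBracketWithin ℝ
      (mpullbackWithin 𝓘(ℝ, E) I φ.symm (mulInvariantVectorField v) (Set.range I))
      (mpullbackWithin 𝓘(ℝ, E) I φ.symm (rightInvariantField w) (Set.range I))
      (φ.symm ⁻¹' Set.univ ∩ Set.range I) (φ 1) = (0 : E) := by
    rw [I.range_eq_univ] at hV hW
    rw [Set.preimage_univ, Set.univ_inter, I.range_eq_univ]
    refine (congrFun lieBracketWithin_univ _).trans ?_
    refine (hV.lieBracket_vectorField_eq hW).trans ?_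
    have hv0 : fderiv ℝ (chartMul I G) (φ 1, φ 1) (0, v') = v' := by
      have h := (eventually_mfderiv_chart_left (I := I) v).self_of_nhds
      rw [mulInvariantVectorField_one] at h
      exact h.symm
    have hw0 : fderiv ℝ (chartMul I G) (φ 1, φ 1) (w', 0) = w' := by
      have h := (eventually_mfderiv_chart_right (I := I) w).self_of_nhds
      rw [rightInvariantField_one] at h
      exact h.symm
    have hsymm : IsSymmSndFDerivAt ℝ (chartMul I G) (φ 1, φ 1) :=
      (contDiffAt_chartMul (I := I) (G := G)).isSymmSndFDerivAt (by simpa using ENat.LEInfty.out)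
    have hd : HasFDerivAt (fderiv ℝ (chartMul I G))
        (fderiv ℝ (fderiv ℝ (chartMul I G)) (φ 1, φ 1)) (φ 1, φ 1) := by
      refine DifferentiableAt.hasFDerivAt ?_
      exact ((contDiffAt_chartMul (I := I) (G := G)).fderiv_right (m := 1)
        (by norm_num; exact ENat.LEInfty.out)).differentiableAt (by simp)
    have d1 : HasFDerivAt (fun x ↦ fderiv ℝ (chartMul I G) (x, φ 1) (0, v')) _ (φ 1) :=
      (HasFDerivAt.comp (g := fderiv ℝ (chartMul I G)) (f := fun x ↦ (x, φ 1)) (φ 1) hd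
        (hasFDerivAt_prodMk_left (φ 1) (φ 1))).clm_apply
        (hasFDerivAt_const _ _)
    have d2 : HasFDerivAt (fun x ↦ fderiv ℝ (chartMul I G) (φ 1, x) (w', 0)) _ (φ 1) :=
      (HasFDerivAt.comp (g := fderiv ℝ (chartMul I G)) (f := fun x ↦ (φ 1, x)) (φ 1) hd
        (hasFDerivAt_prodMk_right (φ 1) (φ 1))).clm_apply
        (hasFDerivAt_const _ _)
    change fderiv ℝ (fun x ↦ fderiv ℝ (chartMul I G) (φ 1, x) (w', 0)) (φ 1)
        (fderiv ℝ (chartMul I G) (φ 1, φ 1) (0, v')) -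
      fderiv ℝ (fun x ↦ fderiv ℝ (chartMul I G) (x, φ 1) (0, v')) (φ 1)
        (fderiv ℝ (chartMul I G) (φ 1, φ 1) (w', 0)) = 0
    rw [hv0, hw0, d1.fderiv, d2.fderiv, ContinuousLinearMap.comp_zero, ContinuousLinearMap.comp_zero,
      zero_add, zero_add]
    exact sub_eq_zero.2 (hsymm.eq (0, v') (w', 0))
  rw [key]
  exact map_zero _

variable [FiniteDimensional ℝ E]

theorem mlieBracket_left_right (v w : GroupLieAlgebra I G) (g : G) :
    mlieBracket I (mulInvariantVectorField v) (rightInvariantField w) g = 0 := by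
  have : CompleteSpace E := FiniteDimensional.complete ℝ E
  have h := mpullback_mlieBracket (I := I) (I' := I) (f := fun x : G ↦ g * x) (x₀ := 1) (n := ∞)
    (V := mulInvariantVectorField v) (W := rightInvariantField w)
    ((isSmoothField_mulInvariantVectorField v).mdifferentiableAt _)
    ((isSmoothField_rightInvariantField w).mdifferentiableAt _)
    (contMDiff_mul_left (n := ∞)).contMDiffAt (by simpa using ENat.LEInfty.out)
  rw [mpullback_mulInvariantVectorField, mpullback_mul_left_rightInvariantField,
    mlieBracket_left_right_one, mpullback_apply, inverse_mfderiv_mul_left] at h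
  have h1 := congrArg (mfderiv I I (fun x : G ↦ g * x) 1) h
  rw [map_zero] at h1
  have h2 : mfderiv I I ((fun x : G ↦ g * x) ∘ (fun x ↦ g⁻¹ * x)) (g * 1) =
      ContinuousLinearMap.id ℝ _ := by
    have : (fun x ↦ g * x) ∘ (fun x ↦ g⁻¹ * x) = id := by ext x; simp
    rw [this, mfderiv_id]
  rw [mfderiv_comp (I' := I) _ (mdifferentiableAt_mul_left' _ _)
    (mdifferentiableAt_mul_left' _ _)] at h2
  have h3 := congrArg (fun T ↦ T (mlieBracket I (mulInvariantVectorField v) (rightInvariantField w)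
    (g * 1))) h2
  have e : g⁻¹ * (g * 1) = 1 := by simp
  have e' : g * 1 = g := mul_one g
  have h4 : mfderiv I I (fun x : G ↦ g * x) (g⁻¹ * (g * 1)) (mfderiv I I (fun x ↦ g⁻¹ * x) (g * 1)
    (mlieBracket I (mulInvariantVectorField v) (rightInvariantField w) (g * 1))) =
      mlieBracket I (mulInvariantVectorField v) (rightInvariantField w) (g * 1) := h3
  rw [e] at h4
  rw [← e']
  exact h4.symm.trans h1

end Brackets

section Derivations

variable {E : Type*} [NormedAddCommGroup E] [NormedSpace ℝ E]
  {H : Type*} [TopologicalSpace H] {I : ModelWithCorners ℝ E H}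
  {M : Type*} [TopologicalSpace M] [ChartedSpace H M] [IsManifold I ∞ M]

theorem IsSmoothField.contMDiff_mvfderiv {X : Π p : M, TangentSpace I p} (hX : IsSmoothField X)
    {f : M → ℝ} (hf : ContMDiff I 𝓘(ℝ) ∞ f) :
    ContMDiff I 𝓘(ℝ) ∞ (fun p ↦ mvfderiv I f p (X p)) := by
  have h1 : ContMDiff I.tangent 𝓘(ℝ, ℝ).tangent ∞ (tangentMap I 𝓘(ℝ) f) :=
    hf.contMDiff_tangentMap (by simp)
  exact (contMDiff_snd_tangentBundle_modelSpace ℝ 𝓘(ℝ)).comp (h1.comp hX)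

theorem mvfderiv_mlieBracket [CompleteSpace E] {U V W : Π p : M, TangentSpace I p}
    (hU : IsSmoothField U) (hV : IsSmoothField V) (hW : IsSmoothField W) {f : M → ℝ}
    (hf : ContMDiff I 𝓘(ℝ) ∞ f) (p : M) (hp : W p ≠ 0) :
    mvfderiv I f p (mlieBracket I U V p) =
      mvfderiv I (fun q ↦ mvfderiv I f q (V q)) p (U p) -
        mvfderiv I (fun q ↦ mvfderiv I f q (U q)) p (V p) := by
  have h2 : minSmoothness ℝ 2 ≤ (∞ : ℕ∞ω) := by simpa using ENat.LEInfty.out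
  have : IsManifold I (minSmoothness ℝ 2) M := .of_le (n := ∞) h2
  have : IsManifold I (minSmoothness ℝ 3) M := .of_le (n := ∞) (by simpa using ENat.LEInfty.out)
  have : IsManifold I ((2 : ℕ∞) + 1) M := .of_le (n := ∞) (by norm_num; exact ENat.LEInfty.out)
  have hfd : ∀ q, MDifferentiableAt I 𝓘(ℝ) f q := fun q ↦ hf.contMDiffAt.mdifferentiableAt (by simp)
  have hUf := hU.contMDiff_mvfderiv hf
  have hVf := hV.contMDiff_mvfderiv hf
  have hbr : ∀ {X Y : Π p : M, TangentSpace I p}, IsSmoothField X → IsSmoothField Y →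
      MDifferentiableAt I I.tangent (fun q ↦ (mlieBracket I X Y q : TangentBundle I M)) p := by
    intro X Y hX hY
    have := ContMDiffAt.mlieBracket_vectorField (m := 1) (n := 2) (I := I) (x := p)
      ((hX p).of_le ENat.LEInfty.out) ((hY p).of_le ENat.LEInfty.out) (by simp; norm_num)
    exact this.mdifferentiableAt (by simp)
  have e : ∀ {X : Π p : M, TangentSpace I p}, mlieBracket I X (f • W) =
      (fun q ↦ mvfderiv I f q (X q)) • W + f • mlieBracket I X W := by
    intro X
    ext q
    exact mlieBracket_smul_right (hfd q) (hW.mdifferentiableAt q)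
  have hsm : ∀ {h : M → ℝ} {Y : Π p : M, TangentSpace I p}, MDifferentiableAt I 𝓘(ℝ) h p →
      MDifferentiableAt I I.tangent (fun q ↦ (Y q : TangentBundle I M)) p →
      MDifferentiableAt I I.tangent (fun q ↦ ((h • Y) q : TangentBundle I M)) p :=
    fun h1 h2 ↦ h1.smul_section h2
  have e2 : ∀ {X Y : Π p : M, TangentSpace I p}, IsSmoothField X → IsSmoothField Y →
      mlieBracket I X (mlieBracket I Y (f • W)) p =
        mvfderiv I (fun q ↦ mvfderiv I f q (Y q)) p (X p) • W p +
          mvfderiv I f p (Y p) • mlieBracket I X W p + (mvfderiv I f p (X p) • mlieBracket I Y W p +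
            f p • mlieBracket I X (mlieBracket I Y W) p) := by
    intro X Y hX hY
    have hYf := ((hY.contMDiff_mvfderiv hf).contMDiffAt (x := p)).mdifferentiableAt (by simp)
    rw [e, mlieBracket_add_right (hsm hYf (hW.mdifferentiableAt p)) (hsm (hfd p) (hbr hY hW)),
      mlieBracket_smul_right hYf (hW.mdifferentiableAt p),
      mlieBracket_smul_right (hfd p) (hbr hY hW)]
  have hfW : IsSmoothField (f • W) := ContMDiff.smul_section hf hW
  have J1 := leibniz_identity_mlieBracket_apply (I := I) (x := p) ((hU p).of_le h2)
    ((hV p).of_le h2) ((hfW p).of_le h2)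
  have J2 := leibniz_identity_mlieBracket_apply (I := I) (x := p) ((hU p).of_le h2)
    ((hV p).of_le h2) ((hW p).of_le h2)
  rw [e2 hU hV, e2 hV hU, e, J2] at J1
  have J3 : (mvfderiv I f p (mlieBracket I U V p) -
      (mvfderiv I (fun q ↦ mvfderiv I f q (V q)) p (U p) -
        mvfderiv I (fun q ↦ mvfderiv I f q (U q)) p (V p))) • W p = 0 := by
    simp only [Pi.add_apply, Pi.smul_apply'] at J1
    rw [← sub_eq_zero] at J1
    rw [← neg_eq_zero, ← J1]
    module
  exact sub_eq_zero.1 ((smul_eq_zero.1 J3).resolve_right hp)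

end Derivations

section LeftInvariantMetric

variable {E : Type*} [NormedAddCommGroup E] [NormedSpace ℝ E] [FiniteDimensional ℝ E]
  {H : Type*} [TopologicalSpace H] {I : ModelWithCorners ℝ E H}
  {G : Type*} [TopologicalSpace G] [ChartedSpace H G] [Group G]
  {ι : Type*}

/-- The left-invariant one-form extending a coordinate of the Lie algebra. -/
noncomputable def coframe (b : Module.Basis ι ℝ (GroupLieAlgebra I G)) (i : ι) (p : G) :
    TangentSpace I p →L[ℝ] ℝ :=
  haveI : FiniteDimensional ℝ (GroupLieAlgebra I G) := inferInstanceAs (FiniteDimensional ℝ E)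
  haveI : T2Space (GroupLieAlgebra I G) := inferInstanceAs (T2Space E)
  (LinearMap.toContinuousLinearMap (b.coord i)).comp (leftTrivialization p)

theorem coframe_apply (b : Module.Basis ι ℝ (GroupLieAlgebra I G)) (i : ι) (p : G)
    (u : TangentSpace I p) : coframe b i p u = b.repr (leftTrivialization p u) i := rfl

variable [LieGroup I ∞ G]

theorem contMDiffAt_coframe (b : Module.Basis ι ℝ (GroupLieAlgebra I G)) (i : ι)
    {X : Π g : G, TangentSpace I g} {p : G}
    (hX : ContMDiffAt I I.tangent ∞ (fun g ↦ (X g : TangentBundle I G)) p) :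
    ContMDiffAt I 𝓘(ℝ) ∞ (fun g ↦ coframe b i g (X g)) p := by
  have : FiniteDimensional ℝ (GroupLieAlgebra I G) := inferInstanceAs (FiniteDimensional ℝ E)
  have : T2Space (GroupLieAlgebra I G) := inferInstanceAs (T2Space E)
  let c : E →L[ℝ] ℝ := LinearMap.toContinuousLinearMap (b.coord i)
  exact ContMDiffAt.comp (I' := 𝓘(ℝ, E)) p c.contMDiff.contMDiffAt
    (contMDiffAt_leftTrivialization hX)

theorem sum_coframe_smul [Fintype ι] (b : Module.Basis ι ℝ (GroupLieAlgebra I G)) (p : G)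
    (u : TangentSpace I p) :
    ∑ i, coframe b i p u • mulInvariantVectorField (b i) p = u := by
  have h := b.sum_repr (leftTrivialization p u)
  have h2 := congrArg (fun v ↦ mfderiv I I (fun x : G ↦ p * x) 1 v) h
  refine Eq.trans ?_ (h2.trans (mulInvariantVectorField_leftTrivialization p u))
  refine Eq.symm ((map_sum _ _ _).trans ?_)
  exact Finset.sum_congr rfl fun i _ ↦ map_smul _ _ _

variable [DecidableEq ι]

theorem coframe_mulInvariantVectorField (b : Module.Basis ι ℝ (GroupLieAlgebra I G)) (i j : ι)
    (p : G) : coframe b i p (mulInvariantVectorField (b j) p) = if i = j then 1 else 0 := by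
  rw [coframe_apply, leftTrivialization_mulInvariantVectorField, b.repr_self_apply]
  simp only [eq_comm]

end LeftInvariantMetric

section Metric

variable {E : Type*} [NormedAddCommGroup E] [NormedSpace ℝ E] [FiniteDimensional ℝ E]
  {H : Type*} [TopologicalSpace H] {I : ModelWithCorners ℝ E H}
  {G : Type*} [TopologicalSpace G] [ChartedSpace H G] [Group G]
  {ι : Type*} [Fintype ι]

theorem coframe_mul_left [LieGroup I ∞ G] (b : Module.Basis ι ℝ (GroupLieAlgebra I G)) (i : ι) (a p : G)
    (u : TangentSpace I p) : coframe b i (a * p) (mfderiv I I (fun q ↦ a * q) p u) = coframe b i p u := by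
  have h : leftTrivialization (a * p) (mfderiv I I (fun q ↦ a * q) p u) = leftTrivialization p u := by
    have e : (fun x : G ↦ (a * p)⁻¹ * x) ∘ (fun q ↦ a * q) = fun x ↦ p⁻¹ * x := by
      ext x; simp [mul_assoc]
    have h1 := mfderiv_comp (I' := I) p (mdifferentiableAt_mul_left' (a * p)⁻¹ (a * p))
      (mdifferentiableAt_mul_left' a p)
    rw [e] at h1
    exact (congrArg (fun T ↦ T u) h1).symm
  rw [coframe_apply, coframe_apply, h]

/-- The scalar product for which a left-invariant frame is orthonormal. -/
noncomputable def frameInner (b : Module.Basis ι ℝ (GroupLieAlgebra I G)) (p : G) :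
    TangentSpace I p →L[ℝ] TangentSpace I p →L[ℝ] ℝ :=
  ∑ i, (coframe b i p).smulRight (coframe b i p)

theorem frameInner_apply (b : Module.Basis ι ℝ (GroupLieAlgebra I G)) (p : G)
    (u v : TangentSpace I p) :
    frameInner b p u v = ∑ i, coframe b i p u * coframe b i p v := by
  simp [frameInner]

theorem contMDiff_frameInner [LieGroup I ∞ G] (b : Module.Basis ι ℝ (GroupLieAlgebra I G)) :
    ContMDiff I (I.prod 𝓘(ℝ, E →L[ℝ] E →L[ℝ] ℝ)) ∞
      (fun p ↦ TotalSpace.mk' (E →L[ℝ] E →L[ℝ] ℝ)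
        (E := fun p : G ↦ TangentSpace I p →L[ℝ] TangentSpace I p →L[ℝ] ℝ) p (frameInner b p)) := by
  intro p
  refine (contMDiffAt_hom_bundle _).2 ⟨contMDiffAt_id, ?_⟩
  let e := Module.finBasis ℝ E
  let t := trivializationAt E (TangentSpace I : G → Type _) p
  let C : Fin (Module.finrank ℝ E) → E →L[ℝ] ℝ := fun i ↦
    LinearMap.toContinuousLinearMap (e.coord i)
  have hs : ∀ i, ContMDiffAt I I.tangent ∞ (fun q ↦ (t.localFrame e i q : TangentBundle I G)) p :=
    fun i ↦ contMDiffAt_localFrame_of_mem ∞ t e i (FiberBundle.mem_baseSet_trivializationAt' p)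
  have hsum : ∀ B : E →L[ℝ] E →L[ℝ] ℝ, B = ∑ i, ∑ j, B (e i) (e j) • (C i).smulRight (C j) := by
    intro B
    ext u v
    conv_lhs => rw [← e.sum_repr u, ← e.sum_repr v]
    simp only [map_sum, map_smul, sum_apply, smul_apply, smul_eq_mul, Finset.mul_sum]
    rw [Finset.sum_comm]
    refine Finset.sum_congr rfl fun i _ ↦ Finset.sum_congr rfl fun j _ ↦ ?_
    simp [C]
    ring
  have hF : ContMDiffAt I 𝓘(ℝ, E →L[ℝ] E →L[ℝ] ℝ) ∞ (fun q ↦ ∑ i, ∑ j,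
      (∑ k, coframe b k q (t.localFrame e i q) * coframe b k q (t.localFrame e j q)) •
        ((C i).smulRight (C j) : E →L[ℝ] E →L[ℝ] ℝ)) p := by
    refine contMDiffAt_finsetSum fun i _ ↦ contMDiffAt_finsetSum fun j _ ↦ ?_
    refine ContMDiffAt.comp (I' := 𝓘(ℝ)) p (ContinuousLinearMap.contMDiff (n := ∞)
      ((1 : ℝ →L[ℝ] ℝ).smulRight
        ((C i).smulRight (C j) : E →L[ℝ] E →L[ℝ] ℝ))).contMDiffAt ?_
    refine contMDiffAt_finsetSum fun k _ ↦ ?_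
    exact (contMDiffAt_coframe b k (hs i)).mul (contMDiffAt_coframe b k (hs j))
  refine hF.congr_of_eventuallyEq ?_
  have hmem : ∀ᶠ q in nhds p, q ∈ t.baseSet :=
    t.open_baseSet.mem_nhds (FiberBundle.mem_baseSet_trivializationAt' p)
  filter_upwards [hmem] with q hq
  refine (hsum _).trans ?_
  refine Finset.sum_congr rfl fun i _ ↦ Finset.sum_congr rfl fun j _ ↦ ?_
  congr 1
  rw [inCoordinates_apply_eq₂ hq hq (Set.mem_univ _)]
  rw [← frameInner_apply]
  simp [t.localFrame_apply_of_mem_baseSet e hq]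
  rfl

variable [LieGroup I ∞ G]

/-- The left-invariant metric for which a basis of the Lie algebra is orthonormal. -/
noncomputable def leftInvariantMetric (b : Module.Basis ι ℝ (GroupLieAlgebra I G)) :
    RiemMetric I G where
  inner := frameInner b
  symm p u v := by
    simp only [frameInner_apply, mul_comm]
  pos p u hu := by
    rw [frameInner_apply]
    by_contra h
    have h0 : ∑ i, coframe b i p u * coframe b i p u = 0 :=
      le_antisymm (not_lt.1 h) (Finset.sum_nonneg fun i _ ↦ mul_self_nonneg _)
    have h1 := (Finset.sum_eq_zero_iff_of_nonneg fun i _ ↦ mul_self_nonneg _).1 h0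
    apply hu
    rw [← sum_coframe_smul b p u]
    exact Finset.sum_eq_zero fun i hi ↦ by rw [mul_self_eq_zero.1 (h1 i hi), zero_smul]
  isVonNBounded p := by
    let T : (ι → ℝ) →L[ℝ] TangentSpace I p :=
      ∑ i, (ContinuousLinearMap.proj (R := ℝ) (φ := fun _ : ι ↦ ℝ) i).smulRight
        (mulInvariantVectorField (b i) p)
    have hb : Bornology.IsVonNBounded ℝ (Metric.closedBall (0 : ι → ℝ) 1) :=
      NormedSpace.isVonNBounded_closedBall ℝ _ _
    refine (hb.image T).subset fun u hu ↦ (Set.mem_image _ _ _).2 ⟨fun i ↦ coframe b i p u, ?_, ?_⟩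
    · rw [mem_closedBall_zero_iff, pi_norm_le_iff_of_nonneg zero_le_one]
      intro i
      have hu' : ∑ i, coframe b i p u * coframe b i p u < 1 := by
        rw [← frameInner_apply]; exact hu
      have := Finset.single_le_sum (f := fun i ↦ coframe b i p u * coframe b i p u)
        (fun i _ ↦ mul_self_nonneg _) (Finset.mem_univ i)
      rw [Real.norm_eq_abs, abs_le_one_iff_mul_self_le_one]
      exact this.trans hu'.le
    · have : T (fun i ↦ coframe b i p u) = ∑ i, coframe b i p u • mulInvariantVectorField (b i) p := by
        simp [T]
      rw [this, sum_coframe_smul]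
  contMDiff := contMDiff_frameInner b

theorem leftInvariantMetric_inner (b : Module.Basis ι ℝ (GroupLieAlgebra I G)) (p : G)
    (u v : TangentSpace I p) :
    (leftInvariantMetric b).inner p u v = ∑ i, coframe b i p u * coframe b i p v :=
  frameInner_apply b p u v

theorem isLeftInvariant_leftInvariantMetric (b : Module.Basis ι ℝ (GroupLieAlgebra I G)) :
    IsLeftInvariant (leftInvariantMetric b) := by
  intro a p u v
  simp only [leftInvariantMetric_inner, coframe_mul_left]

theorem leftInvariantMetric_inner_one (b : Module.Basis ι ℝ (GroupLieAlgebra I G))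
    (u v : GroupLieAlgebra I G) :
    (leftInvariantMetric b).inner 1 u v = ∑ i, b.repr u i * b.repr v i := by
  rw [leftInvariantMetric_inner]
  have : ∀ w : GroupLieAlgebra I G, leftTrivialization (1 : G) w = w := by
    intro w
    have h := leftTrivialization_mulInvariantVectorField w (1 : G)
    rwa [mulInvariantVectorField_one] at h
  simp only [coframe_apply, this]

end Metric

section FrameCalculus

variable {E : Type*} [NormedAddCommGroup E] [NormedSpace ℝ E] [FiniteDimensional ℝ E]
  {H : Type*} [TopologicalSpace H] {I : ModelWithCorners ℝ E H}
  {G : Type*} [TopologicalSpace G] [ChartedSpace H G] [Group G]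
  {ι : Type*}

/-- The coefficients of a vector field in a left-invariant frame. -/
noncomputable def frameCoeff (b : Module.Basis ι ℝ (GroupLieAlgebra I G))
    (X : Π p : G, TangentSpace I p) (i : ι) (p : G) : ℝ :=
  coframe b i p (X p)

/-- The structure constants of the Lie algebra. -/
noncomputable def structConst (b : Module.Basis ι ℝ (GroupLieAlgebra I G)) (i j k : ι) : ℝ :=
  b.repr ⁅b i, b j⁆ k

theorem frameCoeff_add (b : Module.Basis ι ℝ (GroupLieAlgebra I G))
    (X Y : Π p : G, TangentSpace I p) (i : ι) :
    frameCoeff b (X + Y) i = frameCoeff b X i + frameCoeff b Y i := by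
  ext p
  exact map_add _ _ _

theorem frameCoeff_smul (b : Module.Basis ι ℝ (GroupLieAlgebra I G)) (f : G → ℝ)
    (X : Π p : G, TangentSpace I p) (i : ι) :
    frameCoeff b (f • X) i = f * frameCoeff b X i := by
  ext p
  exact map_smul _ _ _

variable [LieGroup I ∞ G]

theorem mdifferentiableAt_frameCoeff (b : Module.Basis ι ℝ (GroupLieAlgebra I G))
    {X : Π p : G, TangentSpace I p} {p : G} (hX : MDiffAt (T% X) p) (i : ι) :
    MDifferentiableAt I 𝓘(ℝ) (frameCoeff b X i) p := by
  classical
  have : Finite ι := by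
    have : FiniteDimensional ℝ (GroupLieAlgebra I G) := inferInstanceAs (FiniteDimensional ℝ E)
    exact Module.Finite.finite_basis b
  have := Fintype.ofFinite ι
  have h := MDifferentiableAt.clm_bundle_apply₂ (𝕜 := ℝ) (F₁ := E) (F₂ := E) (F₃ := ℝ)
    (IM := I) (IB := I) (x := p) (E₁ := fun q : G ↦ TangentSpace I q)
    (E₂ := fun q : G ↦ TangentSpace I q) (E₃ := Bundle.Trivial G ℝ)
    (b := fun q ↦ q) (ψ := (leftInvariantMetric b).inner) (v := X)
    (w := mulInvariantVectorField (b i))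
    ((leftInvariantMetric b).contMDiff.mdifferentiable (by simp) p) hX
    ((isSmoothField_mulInvariantVectorField (b i)).mdifferentiableAt p)
  have h2 := ((mdifferentiableAt_totalSpace I _).1 h).2
  refine h2.congr_of_eventuallyEq (Filter.Eventually.of_forall fun q ↦ ?_)
  change _ = (leftInvariantMetric b).inner q (X q) (mulInvariantVectorField (b i) q)
  simp [leftInvariantMetric_inner, coframe_mulInvariantVectorField, frameCoeff]

theorem IsSmoothField.contMDiff_frameCoeff (b : Module.Basis ι ℝ (GroupLieAlgebra I G))
    {X : Π p : G, TangentSpace I p} (hX : IsSmoothField X) (i : ι) :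
    ContMDiff I 𝓘(ℝ) ∞ (frameCoeff b X i) :=
  fun p ↦ contMDiffAt_coframe b i (hX p)

theorem frameCoeff_mulInvariantVectorField [DecidableEq ι]
    (b : Module.Basis ι ℝ (GroupLieAlgebra I G)) (i j : ι) :
    frameCoeff b (mulInvariantVectorField (b j)) i = fun _ ↦ if i = j then (1 : ℝ) else 0 := by
  ext p
  exact coframe_mulInvariantVectorField b i j p

theorem ext_coframe (b : Module.Basis ι ℝ (GroupLieAlgebra I G)) {p : G} {u v : TangentSpace I p}
    (h : ∀ i, coframe b i p u = coframe b i p v) : u = v := by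
  have h1 : leftTrivialization p u = leftTrivialization p v := b.ext_elem h
  rw [← mulInvariantVectorField_leftTrivialization p u, h1,
    mulInvariantVectorField_leftTrivialization]

theorem mvfderiv_eq_sum [Fintype ι] (b : Module.Basis ι ℝ (GroupLieAlgebra I G)) (f : G → ℝ) (p : G)
    (u : TangentSpace I p) :
    mvfderiv I f p u = ∑ j, coframe b j p u * mvfderiv I f p (mulInvariantVectorField (b j) p) := by
  conv_lhs => rw [← sum_coframe_smul b p u]
  simp only [map_sum, map_smul, smul_eq_mul]

theorem coframe_mlieBracket_mulInvariantVectorField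
    (b : Module.Basis ι ℝ (GroupLieAlgebra I G)) (i j k : ι) (p : G) :
    coframe b k p (mlieBracket I (mulInvariantVectorField (b i)) (mulInvariantVectorField (b j)) p)
      = structConst b i j k := by
  have : CompleteSpace E := FiniteDimensional.complete ℝ E
  rw [← mulInvariantVector_mlieBracket, coframe_apply, leftTrivialization_mulInvariantVectorField,
    ← GroupLieAlgebra.bracket_def]
  rfl

theorem coframe_mlieBracket [Fintype ι] (b : Module.Basis ι ℝ (GroupLieAlgebra I G))
    {X Y : Π p : G, TangentSpace I p} {p : G} (hX : MDiffAt (T% X) p) (hY : MDiffAt (T% Y) p)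
    (k : ι) :
    coframe b k p (mlieBracket I X Y p) = mvfderiv I (frameCoeff b Y k) p (X p) -
      mvfderiv I (frameCoeff b X k) p (Y p) +
      ∑ i, ∑ j, frameCoeff b X i p * frameCoeff b Y j p * structConst b i j k := by
  classical
  have : CompleteSpace E := FiniteDimensional.complete ℝ E
  let Φ : (Π p : G, TangentSpace I p) → (Π p : G, TangentSpace I p) → ℝ := fun X Y ↦
    coframe b k p (mlieBracket I X Y p) - mvfderiv I (frameCoeff b Y k) p (X p) +
      mvfderiv I (frameCoeff b X k) p (Y p)
  have hΦ₁ : ∀ Z : Π p : G, TangentSpace I p, MDiffAt (T% Z) p →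
      TensorialAt I E (Φ · Z) p := by
    refine fun Z _ ↦ ⟨fun {f σ} hf hσ ↦ ?_, fun {σ σ'} hσ hσ' ↦ ?_⟩
    · simp only [Φ]
      rw [mlieBracket_smul_left hf hσ, frameCoeff_smul,
        mvfderiv_mul hf (mdifferentiableAt_frameCoeff b hσ k)]
      simp [frameCoeff]
      ring
    · simp only [Φ]
      rw [mlieBracket_add_left hσ hσ', frameCoeff_add,
        mvfderiv_add (mdifferentiableAt_frameCoeff b hσ k) (mdifferentiableAt_frameCoeff b hσ' k)]
      simp
      ring
  have hΦ₂ : ∀ Z : Π p : G, TangentSpace I p, MDiffAt (T% Z) p →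
      TensorialAt I E (Φ Z) p := by
    refine fun Z _ ↦ ⟨fun {f σ} hf hσ ↦ ?_, fun {σ σ'} hσ hσ' ↦ ?_⟩
    · simp only [Φ]
      rw [mlieBracket_smul_right hf hσ, frameCoeff_smul,
        mvfderiv_mul hf (mdifferentiableAt_frameCoeff b hσ k)]
      simp [frameCoeff]
      ring
    · simp only [Φ]
      rw [mlieBracket_add_right hσ hσ', frameCoeff_add,
        mvfderiv_add (mdifferentiableAt_frameCoeff b hσ k) (mdifferentiableAt_frameCoeff b hσ' k)]
      simp
      ring
  have hL : ∀ i, MDiffAt (T% (mulInvariantVectorField (b i) : Π p : G, TangentSpace I p)) p :=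
    fun i ↦ (isSmoothField_mulInvariantVectorField (b i)).mdifferentiableAt p
  have hB : ∀ i j, Φ (mulInvariantVectorField (b i)) (mulInvariantVectorField (b j)) =
      structConst b i j k := by
    intro i j
    simp only [Φ, frameCoeff_mulInvariantVectorField]
    rw [mvfderiv_const, mvfderiv_const, coframe_mlieBracket_mulInvariantVectorField]
    simp
  have h1 := TensorialAt.mkHom₂_apply hΦ₁ hΦ₂ hX hY
  have h2 : Φ X Y = ∑ i, ∑ j, frameCoeff b X i p * frameCoeff b Y j p * structConst b i j k := by
    rw [← h1]
    conv_lhs => rw [← sum_coframe_smul b p (X p), ← sum_coframe_smul b p (Y p)]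
    simp only [map_sum, map_smul, sum_apply, smul_apply, Finset.smul_sum]
    rw [Finset.sum_comm]
    refine Finset.sum_congr rfl fun i _ ↦ Finset.sum_congr rfl fun j _ ↦ ?_
    have h3 := (TensorialAt.mkHom₂_apply hΦ₁ hΦ₂ (hL i) (hL j)).trans (hB i j)
    rw [h3]
    simp only [frameCoeff, smul_eq_mul]
    ring
  simp only [Φ] at h2
  linarith

end FrameCalculus

section Product

variable {E : Type*} [NormedAddCommGroup E] [NormedSpace ℝ E]
  {H : Type*} [TopologicalSpace H] {I : ModelWithCorners ℝ E H}
  {M : Type*} [TopologicalSpace M] [ChartedSpace H M] {ι : Type*} [Fintype ι]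

theorem mvfderiv_sum_mul {f g : ι → M → ℝ} {p : M}
    (hf : ∀ i, MDifferentiableAt I 𝓘(ℝ) (f i) p) (hg : ∀ i, MDifferentiableAt I 𝓘(ℝ) (g i) p)
    (u : TangentSpace I p) :
    mvfderiv I (fun q ↦ ∑ i, f i q * g i q) p u =
      ∑ i, (mvfderiv I (f i) p u * g i p + f i p * mvfderiv I (g i) p u) := by
  classical
  have key : ∀ s : Finset ι, MDifferentiableAt I 𝓘(ℝ) (fun q ↦ ∑ i ∈ s, f i q * g i q) p ∧
      mvfderiv I (fun q ↦ ∑ i ∈ s, f i q * g i q) p u =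
        ∑ i ∈ s, (mvfderiv I (f i) p u * g i p + f i p * mvfderiv I (g i) p u) := by
    intro s
    induction s using Finset.induction_on with
    | empty =>
      simp only [Finset.sum_empty]
      exact ⟨mdifferentiableAt_const, by rw [mvfderiv_const]; rfl⟩
    | insert i s hi ih =>
      simp only [Finset.sum_insert hi]
      have hm : MDifferentiableAt I 𝓘(ℝ) (f i * g i) p := (hf i).mul (hg i)
      refine ⟨hm.add ih.1, ?_⟩
      have h1 := mvfderiv_add hm ih.1
      rw [mvfderiv_mul (hf i) (hg i)] at h1
      refine (congrArg (fun T ↦ T u) h1).trans ?_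
      simp only [add_apply, smul_apply, smul_eq_mul]
      rw [ih.2]
      ring
  exact (key Finset.univ).2

end Product

section KillingEquation

variable {E : Type*} [NormedAddCommGroup E] [NormedSpace ℝ E] [FiniteDimensional ℝ E]
  {H : Type*} [TopologicalSpace H] {I : ModelWithCorners ℝ E H}
  {G : Type*} [TopologicalSpace G] [ChartedSpace H G] [Group G] [LieGroup I ∞ G]
  {ι : Type*} [Fintype ι]

theorem isKilling_leftInvariantMetric_iff (b : Module.Basis ι ℝ (GroupLieAlgebra I G))
    {X : Π p : G, TangentSpace I p} (hX : IsSmoothField X) :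
    IsKilling (leftInvariantMetric b) X ↔ ∀ p j k,
      (∑ i, frameCoeff b X i p * structConst b i j k -
        mvfderiv I (frameCoeff b X k) p (mulInvariantVectorField (b j) p)) +
      (∑ i, frameCoeff b X i p * structConst b i k j -
        mvfderiv I (frameCoeff b X j) p (mulInvariantVectorField (b k) p)) = 0 := by
  classical
  have key : ∀ Y Z : Π p : G, TangentSpace I p, IsSmoothField Y → IsSmoothField Z → ∀ p,
      mvfderiv I (fun q ↦ (leftInvariantMetric b).inner q (Y q) (Z q)) p (X p) -
        ((leftInvariantMetric b).inner p (mlieBracket I X Y p) (Z p) +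
          (leftInvariantMetric b).inner p (Y p) (mlieBracket I X Z p)) =
      - ∑ j, ∑ k, frameCoeff b Y j p * frameCoeff b Z k p *
      ((∑ i, frameCoeff b X i p * structConst b i j k -
        mvfderiv I (frameCoeff b X k) p (mulInvariantVectorField (b j) p)) +
      (∑ i, frameCoeff b X i p * structConst b i k j -
        mvfderiv I (frameCoeff b X j) p (mulInvariantVectorField (b k) p))) := by
    intro Y Z hY hZ p
    have h1 : (fun q ↦ (leftInvariantMetric b).inner q (Y q) (Z q)) =
        fun q ↦ ∑ k, frameCoeff b Y k q * frameCoeff b Z k q := by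
      ext q
      rw [leftInvariantMetric_inner]
      rfl
    have hXp := hX.mdifferentiableAt p
    have hYp := hY.mdifferentiableAt p
    have hZp := hZ.mdifferentiableAt p
    rw [h1, mvfderiv_sum_mul (fun i ↦ mdifferentiableAt_frameCoeff b hYp i)
      (fun i ↦ mdifferentiableAt_frameCoeff b hZp i),
      leftInvariantMetric_inner, leftInvariantMetric_inner]
    simp only [coframe_mlieBracket b hXp hYp, coframe_mlieBracket b hXp hZp]
    have e1 : ∀ k, mvfderiv I (frameCoeff b X k) p (Y p) = ∑ j, frameCoeff b Y j p *
        mvfderiv I (frameCoeff b X k) p (mulInvariantVectorField (b j) p) :=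
      fun k ↦ mvfderiv_eq_sum b _ p _
    have e2 : ∀ k, mvfderiv I (frameCoeff b X k) p (Z p) = ∑ j, frameCoeff b Z j p *
        mvfderiv I (frameCoeff b X k) p (mulInvariantVectorField (b j) p) :=
      fun k ↦ mvfderiv_eq_sum b _ p _
    have e3 : ∀ k, coframe b k p (Y p) = frameCoeff b Y k p := fun _ ↦ rfl
    have e4 : ∀ k, coframe b k p (Z p) = frameCoeff b Z k p := fun _ ↦ rfl
    simp only [e1, e2, e3, e4]
    set x := fun i ↦ frameCoeff b X i p
    set y := fun i ↦ frameCoeff b Y i p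
    set z := fun i ↦ frameCoeff b Z i p
    have s1 : ∑ j, ∑ k, y j * z k * ((∑ i, x i * structConst b i j k -
        mvfderiv I (frameCoeff b X k) p (mulInvariantVectorField (b j) p)) +
      (∑ i, x i * structConst b i k j -
        mvfderiv I (frameCoeff b X j) p (mulInvariantVectorField (b k) p))) =
      ∑ k, (∑ i, ∑ j, x i * y j * structConst b i j k - ∑ j, y j *
        mvfderiv I (frameCoeff b X k) p (mulInvariantVectorField (b j) p)) * z k +
      ∑ j, y j * (∑ i, ∑ k, x i * z k * structConst b i k j - ∑ k, z k *
        mvfderiv I (frameCoeff b X j) p (mulInvariantVectorField (b k) p)) := by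
      simp only [mul_add, Finset.sum_add_distrib]
      congr 1
      · rw [Finset.sum_comm]
        refine Finset.sum_congr rfl fun k _ ↦ ?_
        rw [Finset.sum_comm (f := fun i j ↦ x i * y j * structConst b i j k),
          ← Finset.sum_sub_distrib, Finset.sum_mul]
        refine Finset.sum_congr rfl fun j _ ↦ ?_
        simp only [mul_assoc, mul_sub, sub_mul, Finset.mul_sum, Finset.sum_mul]
        congr 1
        · exact Finset.sum_congr rfl fun i _ ↦ by ring
        · ring
      · refine Finset.sum_congr rfl fun j _ ↦ ?_
        rw [Finset.sum_comm (f := fun i k ↦ x i * z k * structConst b i k j),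
          ← Finset.sum_sub_distrib, Finset.mul_sum]
        refine Finset.sum_congr rfl fun k _ ↦ ?_
        simp only [mul_assoc, mul_sub, Finset.mul_sum]
        congr 1
        exact Finset.sum_congr rfl fun i _ ↦ by ring
    refine Eq.trans ?_ (congrArg Neg.neg s1.symm)
    rw [← Finset.sum_add_distrib, ← Finset.sum_add_distrib, ← Finset.sum_sub_distrib,
      ← Finset.sum_neg_distrib]
    refine Finset.sum_congr rfl fun k _ ↦ ?_
    simp only [x, y, z]
    ring
  constructor
  · intro h p j k
    have h1 := key (mulInvariantVectorField (b j)) (mulInvariantVectorField (b k))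
      (isSmoothField_mulInvariantVectorField _) (isSmoothField_mulInvariantVectorField _) p
    rw [sub_eq_zero.2 (h.lie_metric _ _ (isSmoothField_mulInvariantVectorField _)
      (isSmoothField_mulInvariantVectorField _) p)] at h1
    simp only [frameCoeff_mulInvariantVectorField] at h1
    simp at h1
    linarith
  · intro h
    refine ⟨hX, fun Y Z hY hZ p ↦ ?_⟩
    have h1 := key Y Z hY hZ p
    simp only [h, mul_zero, Finset.sum_const_zero, neg_zero] at h1
    exact sub_eq_zero.1 h1

end KillingEquation

section LeviCivita

variable {E : Type*} [NormedAddCommGroup E] [NormedSpace ℝ E] [FiniteDimensional ℝ E]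
  {H : Type*} [TopologicalSpace H] {I : ModelWithCorners ℝ E H}
  {G : Type*} [TopologicalSpace G] [ChartedSpace H G] [Group G]
  {ι : Type*} [Fintype ι]

/-- The Christoffel symbols of a left-invariant metric in a left-invariant orthonormal frame. -/
noncomputable def christoffel (b : Module.Basis ι ℝ (GroupLieAlgebra I G)) (j i k : ι) : ℝ :=
  (structConst b j i k - structConst b i k j + structConst b k j i) / 2

theorem structConst_swap [CompleteSpace E] [LieGroup I ∞ G]
    (b : Module.Basis ι ℝ (GroupLieAlgebra I G)) (i j k : ι) :
    structConst b i j k = - structConst b j i k := by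
  rw [structConst, structConst, ← lie_skew (b i) (b j)]
  exact congrArg (fun v ↦ v k) (map_neg b.repr _)

variable [LieGroup I ∞ G]

/-- The Levi-Civita connection of a left-invariant metric. -/
noncomputable def leviCivita (b : Module.Basis ι ℝ (GroupLieAlgebra I G)) :
    CovariantDerivative I E (TangentSpace I : G → Type _) where
  toFun X p := ∑ k, (mvfderiv I (frameCoeff b X k) p +
    ∑ i, ∑ j, (frameCoeff b X i p * christoffel b j i k) • coframe b j p).smulRight
      (mulInvariantVectorField (b k) p)
  isCovariantDerivativeOnUniv := by
    refine ⟨fun {X Y p} hX hY _ ↦ ?_, fun {X f p} hX hf _ ↦ ?_⟩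
    · rw [← Finset.sum_add_distrib]
      refine Finset.sum_congr rfl fun k _ ↦ ?_
      ext u
      rw [frameCoeff_add, mvfderiv_add (mdifferentiableAt_frameCoeff b hX k)
        (mdifferentiableAt_frameCoeff b hY k)]
      simp only [frameCoeff_add, Pi.add_apply, add_apply, sum_apply, smul_apply,
        ContinuousLinearMap.smulRight_apply, add_mul, add_smul, Finset.sum_add_distrib]
      abel
    · ext u
      have e : (mvfderiv I f p).smulRight (X p) u =
          ∑ k, (mvfderiv I f p u * frameCoeff b X k p) • mulInvariantVectorField (b k) p := by
        have h := sum_coframe_smul b p (X p)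
        refine (congrArg (fun v ↦ mvfderiv I f p u • v) h.symm).trans ?_
        simp only [Finset.smul_sum, smul_smul]
        rfl
      rw [add_apply, e, smul_apply, sum_apply, sum_apply, Finset.smul_sum, ← Finset.sum_add_distrib]
      refine Finset.sum_congr rfl fun k _ ↦ ?_
      rw [frameCoeff_smul, mvfderiv_mul hf (mdifferentiableAt_frameCoeff b hX k)]
      simp only [frameCoeff_smul, Pi.mul_apply, add_apply, sum_apply, smul_apply, smul_smul,
        ContinuousLinearMap.smulRight_apply, ← add_smul, smul_eq_mul, mul_add, Finset.mul_sum]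
      congr 1
      simp only [mul_assoc]
      ring

theorem coframe_leviCivita (b : Module.Basis ι ℝ (GroupLieAlgebra I G))
    (X : Π p : G, TangentSpace I p) (p : G) (u : TangentSpace I p) (k : ι) :
    coframe b k p (leviCivita b X p u) = mvfderiv I (frameCoeff b X k) p u +
      ∑ i, ∑ j, frameCoeff b X i p * christoffel b j i k * coframe b j p u := by
  classical
  simp only [leviCivita, sum_apply, map_sum, ContinuousLinearMap.smulRight_apply, map_smul,
    coframe_mulInvariantVectorField]
  simp

theorem isLeviCivita_leviCivita (b : Module.Basis ι ℝ (GroupLieAlgebra I G)) :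
    IsLeviCivita (leftInvariantMetric b) (leviCivita b) := by
  have : CompleteSpace E := FiniteDimensional.complete ℝ E
  constructor
  · refine (leviCivita b).torsion_eq_zero_iff.2 fun {X Y p} hX hY ↦ ?_
    refine ext_coframe b fun k ↦ ?_
    rw [map_sub, coframe_leviCivita, coframe_leviCivita, coframe_mlieBracket b hX hY]
    have e : ∑ i, ∑ j, frameCoeff b Y i p * christoffel b j i k * coframe b j p (X p) -
        ∑ i, ∑ j, frameCoeff b X i p * christoffel b j i k * coframe b j p (Y p) =
        ∑ i, ∑ j, frameCoeff b X i p * frameCoeff b Y j p * structConst b i j k := by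
      rw [Finset.sum_comm, ← Finset.sum_sub_distrib]
      refine Finset.sum_congr rfl fun i _ ↦ ?_
      rw [← Finset.sum_sub_distrib]
      refine Finset.sum_congr rfl fun j _ ↦ ?_
      simp only [christoffel, frameCoeff]
      rw [structConst_swap b j i k, structConst_swap b k j i, structConst_swap b i k j]
      ring
    linarith
  · intro p X Y Z hX hY hZ
    have h1 : (fun q ↦ (leftInvariantMetric b).inner q (Y q) (Z q)) =
        fun q ↦ ∑ k, frameCoeff b Y k q * frameCoeff b Z k q := by
      ext q
      rw [leftInvariantMetric_inner]
      rfl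
    rw [h1, mvfderiv_sum_mul (fun i ↦ mdifferentiableAt_frameCoeff b hY i)
      (fun i ↦ mdifferentiableAt_frameCoeff b hZ i),
      leftInvariantMetric_inner, leftInvariantMetric_inner]
    simp only [coframe_leviCivita]
    have e : ∑ k, (∑ i, ∑ j, frameCoeff b Y i p * christoffel b j i k * coframe b j p (X p)) *
        frameCoeff b Z k p + ∑ k, frameCoeff b Y k p *
        (∑ i, ∑ j, frameCoeff b Z i p * christoffel b j i k * coframe b j p (X p)) = 0 := by
      simp only [Finset.sum_mul, Finset.mul_sum]
      rw [Finset.sum_comm, ← Finset.sum_add_distrib]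
      refine Finset.sum_eq_zero fun i _ ↦ ?_
      rw [← Finset.sum_add_distrib]
      refine Finset.sum_eq_zero fun k _ ↦ ?_
      rw [← Finset.sum_add_distrib]
      refine Finset.sum_eq_zero fun j _ ↦ ?_
      simp only [christoffel]
      rw [structConst_swap b j i k, structConst_swap b k j i, structConst_swap b i k j,
        structConst_swap b j k i]
      ring
    have e1 : ∀ k, coframe b k p (Y p) = frameCoeff b Y k p := fun _ ↦ rfl
    have e2 : ∀ k, coframe b k p (Z p) = frameCoeff b Z k p := fun _ ↦ rfl
    simp only [e1, e2, add_mul, mul_add, Finset.sum_add_distrib]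
    linarith

theorem isParallelAt_leftInvariantMetric_iff (b : Module.Basis ι ℝ (GroupLieAlgebra I G))
    {X : Π p : G, TangentSpace I p} (hX : IsSmoothField X) (p : G) :
    IsParallelAt (leftInvariantMetric b) X p ↔ ∀ j k,
      mvfderiv I (frameCoeff b X k) p (mulInvariantVectorField (b j) p) +
        ∑ i, frameCoeff b X i p * christoffel b j i k = 0 := by
  classical
  have key : ∀ j k, coframe b k p (leviCivita b X p (mulInvariantVectorField (b j) p)) =
      mvfderiv I (frameCoeff b X k) p (mulInvariantVectorField (b j) p) +
        ∑ i, frameCoeff b X i p * christoffel b j i k := by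
    intro j k
    rw [coframe_leviCivita]
    simp [coframe_mulInvariantVectorField]
  constructor
  · rintro ⟨cov, hcov, h⟩ j k
    rw [← key, (isLeviCivita_leviCivita b).unique hcov (hX.mdifferentiableAt p), h, map_zero]
  · intro h
    refine ⟨leviCivita b, isLeviCivita_leviCivita b, fun Y ↦ ?_⟩
    rw [← sum_coframe_smul b p (Y p), map_sum]
    refine Finset.sum_eq_zero fun j _ ↦ ?_
    rw [map_smul]
    refine smul_eq_zero_of_right _ (ext_coframe b fun k ↦ ?_)
    rw [key, h, map_zero]

end LeviCivita

section FrameDeriv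

variable {E : Type*} [NormedAddCommGroup E] [NormedSpace ℝ E]
  {H : Type*} [TopologicalSpace H] {I : ModelWithCorners ℝ E H}
  {G : Type*} [TopologicalSpace G] [ChartedSpace H G] [Group G]
  {ι : Type*}

/-- The derivative of a function along a field of a left-invariant frame. -/
noncomputable def frameDeriv (b : Module.Basis ι ℝ (GroupLieAlgebra I G)) (j : ι) (f : G → ℝ)
    (p : G) : ℝ :=
  mvfderiv I f p (mulInvariantVectorField (b j) p)

/-- The function `f` is smooth with derivatives `f₀`, `f₁`, `f₂` along a left-invariant frame. -/
structure HasFrameDeriv (b : Module.Basis (Fin 3) ℝ (GroupLieAlgebra I G)) (f f₀ f₁ f₂ : G → ℝ) :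
    Prop where
  contMDiff : ContMDiff I 𝓘(ℝ) ∞ f
  deriv₀ : ∀ p, frameDeriv b 0 f p = f₀ p
  deriv₁ : ∀ p, frameDeriv b 1 f p = f₁ p
  deriv₂ : ∀ p, frameDeriv b 2 f p = f₂ p

theorem frameDeriv_const (b : Module.Basis ι ℝ (GroupLieAlgebra I G)) (j : ι) (c : ℝ) (p : G) :
    frameDeriv b j (fun _ ↦ c) p = 0 := by
  rw [frameDeriv, mvfderiv_const]
  rfl

theorem frameDeriv_add (b : Module.Basis ι ℝ (GroupLieAlgebra I G)) (j : ι) {f g : G → ℝ}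
    (hf : ContMDiff I 𝓘(ℝ) ∞ f) (hg : ContMDiff I 𝓘(ℝ) ∞ g) (p : G) :
    frameDeriv b j (fun q ↦ f q + g q) p = frameDeriv b j f p + frameDeriv b j g p :=
  congrArg (fun T ↦ T (mulInvariantVectorField (b j) p))
    (mvfderiv_add (hf.mdifferentiable (by simp) p) (hg.mdifferentiable (by simp) p))

theorem frameDeriv_mul (b : Module.Basis ι ℝ (GroupLieAlgebra I G)) (j : ι) {f g : G → ℝ}
    (hf : ContMDiff I 𝓘(ℝ) ∞ f) (hg : ContMDiff I 𝓘(ℝ) ∞ g) (p : G) :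
    frameDeriv b j (fun q ↦ f q * g q) p = frameDeriv b j f p * g p + f p * frameDeriv b j g p := by
  have h := congrArg (fun T ↦ T (mulInvariantVectorField (b j) p))
    (mvfderiv_mul (hf.mdifferentiable (by simp) p) (hg.mdifferentiable (by simp) p))
  refine h.trans ?_
  simp only [add_apply, smul_apply, smul_eq_mul, frameDeriv]
  ring

theorem HasFrameDeriv.const (b : Module.Basis (Fin 3) ℝ (GroupLieAlgebra I G)) (c : ℝ) :
    HasFrameDeriv b (fun _ ↦ c) (fun _ ↦ 0) (fun _ ↦ 0) (fun _ ↦ 0) :=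
  ⟨contMDiff_const, frameDeriv_const b 0 c, frameDeriv_const b 1 c, frameDeriv_const b 2 c⟩

variable {b : Module.Basis (Fin 3) ℝ (GroupLieAlgebra I G)} {f f₀ f₁ f₂ g g₀ g₁ g₂ : G → ℝ}

theorem HasFrameDeriv.add (hf : HasFrameDeriv b f f₀ f₁ f₂) (hg : HasFrameDeriv b g g₀ g₁ g₂) :
    HasFrameDeriv b (fun p ↦ f p + g p) (fun p ↦ f₀ p + g₀ p) (fun p ↦ f₁ p + g₁ p)
      (fun p ↦ f₂ p + g₂ p) where
  contMDiff := hf.contMDiff.add hg.contMDiff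
  deriv₀ p := by rw [frameDeriv_add b 0 hf.contMDiff hg.contMDiff, hf.deriv₀, hg.deriv₀]
  deriv₁ p := by rw [frameDeriv_add b 1 hf.contMDiff hg.contMDiff, hf.deriv₁, hg.deriv₁]
  deriv₂ p := by rw [frameDeriv_add b 2 hf.contMDiff hg.contMDiff, hf.deriv₂, hg.deriv₂]

theorem HasFrameDeriv.mul (hf : HasFrameDeriv b f f₀ f₁ f₂) (hg : HasFrameDeriv b g g₀ g₁ g₂) :
    HasFrameDeriv b (fun p ↦ f p * g p) (fun p ↦ f₀ p * g p + f p * g₀ p)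
      (fun p ↦ f₁ p * g p + f p * g₁ p) (fun p ↦ f₂ p * g p + f p * g₂ p) where
  contMDiff := hf.contMDiff.mul hg.contMDiff
  deriv₀ p := by rw [frameDeriv_mul b 0 hf.contMDiff hg.contMDiff, hf.deriv₀, hg.deriv₀]
  deriv₁ p := by rw [frameDeriv_mul b 1 hf.contMDiff hg.contMDiff, hf.deriv₁, hg.deriv₁]
  deriv₂ p := by rw [frameDeriv_mul b 2 hf.contMDiff hg.contMDiff, hf.deriv₂, hg.deriv₂]

theorem HasFrameDeriv.const_mul (c : ℝ) (hf : HasFrameDeriv b f f₀ f₁ f₂) :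
    HasFrameDeriv b (fun p ↦ c * f p) (fun p ↦ c * f₀ p) (fun p ↦ c * f₁ p)
      (fun p ↦ c * f₂ p) := by
  simpa using (HasFrameDeriv.const b c).mul hf

theorem HasFrameDeriv.neg (hf : HasFrameDeriv b f f₀ f₁ f₂) :
    HasFrameDeriv b (fun p ↦ -f p) (fun p ↦ -f₀ p) (fun p ↦ -f₁ p) (fun p ↦ -f₂ p) := by
  simpa using hf.const_mul (-1)

theorem HasFrameDeriv.sub (hf : HasFrameDeriv b f f₀ f₁ f₂) (hg : HasFrameDeriv b g g₀ g₁ g₂) :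
    HasFrameDeriv b (fun p ↦ f p - g p) (fun p ↦ f₀ p - g₀ p) (fun p ↦ f₁ p - g₁ p)
      (fun p ↦ f₂ p - g₂ p) := by
  simpa [sub_eq_add_neg] using hf.add hg.neg

theorem HasFrameDeriv.congr {f' f₀' f₁' f₂' : G → ℝ} (hf : HasFrameDeriv b f f₀ f₁ f₂)
    (h : ∀ p, f' p = f p) (h₀ : ∀ p, f₀' p = f₀ p) (h₁ : ∀ p, f₁' p = f₁ p)
    (h₂ : ∀ p, f₂' p = f₂ p) : HasFrameDeriv b f' f₀' f₁' f₂' := by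
  rwa [funext h, funext h₀, funext h₁, funext h₂]

theorem HasFrameDeriv.inv (hf : HasFrameDeriv b f f₀ f₁ f₂) (h0 : ∀ p, f p ≠ 0) :
    HasFrameDeriv b (fun p ↦ (f p)⁻¹) (fun p ↦ -f₀ p * ((f p)⁻¹ * (f p)⁻¹))
      (fun p ↦ -f₁ p * ((f p)⁻¹ * (f p)⁻¹)) (fun p ↦ -f₂ p * ((f p)⁻¹ * (f p)⁻¹)) := by
  have hs : ContMDiff I 𝓘(ℝ) ∞ (fun p ↦ (f p)⁻¹) := hf.contMDiff.inv₀ h0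
  have key : ∀ j p, frameDeriv b j (fun p ↦ (f p)⁻¹) p =
      -frameDeriv b j f p * ((f p)⁻¹ * (f p)⁻¹) := by
    intro j p
    have h1 := frameDeriv_mul b j hf.contMDiff hs p
    have h2 : (fun q ↦ f q * (f q)⁻¹) = fun _ ↦ (1 : ℝ) := by
      ext q
      exact mul_inv_cancel₀ (h0 q)
    rw [h2, frameDeriv_const] at h1
    have := h0 p
    field_simp at h1 ⊢
    linarith
  exact ⟨hs, fun p ↦ by rw [key, hf.deriv₀], fun p ↦ by rw [key, hf.deriv₁],
    fun p ↦ by rw [key, hf.deriv₂]⟩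

end FrameDeriv

section Frame

variable {E : Type*} [NormedAddCommGroup E] [NormedSpace ℝ E] [FiniteDimensional ℝ E]
  {H : Type*} [TopologicalSpace H] {I : ModelWithCorners ℝ E H}
  {G : Type*} [TopologicalSpace G] [ChartedSpace H G] [Group G] [LieGroup I ∞ G]
  {ι : Type*}

theorem contMDiff_frameDeriv (b : Module.Basis ι ℝ (GroupLieAlgebra I G)) (j : ι) {f : G → ℝ}
    (hf : ContMDiff I 𝓘(ℝ) ∞ f) : ContMDiff I 𝓘(ℝ) ∞ (frameDeriv b j f) :=
  (isSmoothField_mulInvariantVectorField (b j)).contMDiff_mvfderiv hf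

variable [Fintype ι]

theorem frameDeriv_commutator (b : Module.Basis ι ℝ (GroupLieAlgebra I G)) (i j : ι) {f : G → ℝ}
    (hf : ContMDiff I 𝓘(ℝ) ∞ f) (p : G) :
    frameDeriv b i (frameDeriv b j f) p - frameDeriv b j (frameDeriv b i f) p =
      ∑ k, structConst b i j k * frameDeriv b k f p := by
  classical
  have : CompleteSpace E := FiniteDimensional.complete ℝ E
  have hL := fun i ↦ isSmoothField_mulInvariantVectorField (I := I) (G := G) (b i)
  have hne : mulInvariantVectorField (b i) p ≠ 0 := by
    intro h
    have h1 := coframe_mulInvariantVectorField b i i p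
    rw [h, map_zero] at h1
    simp at h1
  refine (mvfderiv_mlieBracket (hL i) (hL j) (hL i) hf p hne).symm.trans ?_
  rw [mvfderiv_eq_sum b]
  exact Finset.sum_congr rfl fun k _ ↦ by
    rw [coframe_mlieBracket_mulInvariantVectorField]; rfl

theorem mem_symmetrySet_leftInvariantMetric_iff (b : Module.Basis ι ℝ (GroupLieAlgebra I G))
    (x : GroupLieAlgebra I G) :
    x ∈ symmetrySet (leftInvariantMetric b) (1 : G) ↔ ∃ F : ι → G → ℝ,
      (∀ i, ContMDiff I 𝓘(ℝ) ∞ (F i)) ∧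
      (∀ p j k, (∑ i, F i p * structConst b i j k - frameDeriv b j (F k) p) +
        (∑ i, F i p * structConst b i k j - frameDeriv b k (F j) p) = 0) ∧
      (∀ j k, frameDeriv b j (F k) 1 + ∑ i, F i 1 * christoffel b j i k = 0) ∧
      ∀ i, b.repr x i = F i 1 := by
  classical
  have h1 : ∀ w : GroupLieAlgebra I G, leftTrivialization (1 : G) w = w := by
    intro w
    have h := leftTrivialization_mulInvariantVectorField w (1 : G)
    rwa [mulInvariantVectorField_one] at h
  constructor
  · rintro ⟨X, hX, hp, rfl⟩
    refine ⟨frameCoeff b X, hX.smooth.contMDiff_frameCoeff b,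
      (isKilling_leftInvariantMetric_iff b hX.smooth).1 hX,
      (isParallelAt_leftInvariantMetric_iff b hX.smooth 1).1 hp, fun i ↦ ?_⟩
    rw [frameCoeff, coframe_apply, h1]
  · rintro ⟨F, hF, hK, hP, hx⟩
    let X : Π p : G, TangentSpace I p := fun p ↦ ∑ i, F i p • mulInvariantVectorField (b i) p
    have hXs : IsSmoothField X := by
      refine ContMDiff.sum_section fun i _ ↦ ?_
      exact ContMDiff.smul_section (hF i) (isSmoothField_mulInvariantVectorField (b i))
    have hc : ∀ i, frameCoeff b X i = F i := by
      intro i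
      ext p
      simp [X, frameCoeff, map_sum, coframe_mulInvariantVectorField]
    refine ⟨X, (isKilling_leftInvariantMetric_iff b hXs).2 ?_,
      (isParallelAt_leftInvariantMetric_iff b hXs 1).2 ?_, ?_⟩
    · simpa only [hc] using! hK
    · simpa only [hc] using! hP
    · refine ext_coframe b fun i ↦ ?_
      refine (congrFun (hc i) 1).trans ?_
      rw [← hx i, coframe_apply, h1]

end Frame

section RightInvariant

variable {E : Type*} [NormedAddCommGroup E] [NormedSpace ℝ E] [FiniteDimensional ℝ E]
  {H : Type*} [TopologicalSpace H] {I : ModelWithCorners ℝ E H} [I.Boundaryless]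
  {G : Type*} [TopologicalSpace G] [ChartedSpace H G] [Group G] [LieGroup I ∞ G]
  {ι : Type*} [Fintype ι]

theorem contMDiff_repr_adjointInv (b : Module.Basis ι ℝ (GroupLieAlgebra I G))
    (v : GroupLieAlgebra I G) (k : ι) :
    ContMDiff I 𝓘(ℝ) ∞ (fun p ↦ b.repr (adjointInv p v) k) := by
  have h := (isSmoothField_rightInvariantField (I := I) (G := G) v).contMDiff_frameCoeff b k
  refine h.congr fun p ↦ ?_
  rw [frameCoeff, coframe_apply, leftTrivialization_rightInvariantField]

theorem frameDeriv_repr_adjointInv (b : Module.Basis ι ℝ (GroupLieAlgebra I G))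
    (v : GroupLieAlgebra I G) (j k : ι) (p : G) :
    frameDeriv b j (fun p ↦ b.repr (adjointInv p v) k) p =
      -∑ i, b.repr (adjointInv p v) i * structConst b j i k := by
  classical
  have h := coframe_mlieBracket b (p := p)
    ((isSmoothField_mulInvariantVectorField (b j)).mdifferentiableAt p)
    ((isSmoothField_rightInvariantField v).mdifferentiableAt p) k
  rw [mlieBracket_left_right, map_zero] at h
  have e : ∀ i, frameCoeff b (rightInvariantField v) i = fun p ↦ b.repr (adjointInv p v) i := by
    intro i
    ext p
    rw [frameCoeff, coframe_apply, leftTrivialization_rightInvariantField]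
  simp only [frameCoeff_mulInvariantVectorField, e] at h
  rw [mvfderiv_const] at h
  simp at h
  simp only [frameDeriv]
  linarith

end RightInvariant

/-- A basis of a Lie algebra for which the last two vectors span an abelian ideal, on which the
first one acts by the matrix with rows `(α, β)` and `(γ, δ)`. -/
structure IsAdapted {𝔤 : Type*} [LieRing 𝔤] [LieAlgebra ℝ 𝔤] (b : Module.Basis (Fin 3) ℝ 𝔤)
    (α β γ δ : ℝ) : Prop where
  lie01 : ⁅b 0, b 1⁆ = α • b 1 + γ • b 2
  lie02 : ⁅b 0, b 2⁆ = β • b 1 + δ • b 2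
  lie12 : ⁅b 1, b 2⁆ = 0

section Adapted

variable {E : Type*} [NormedAddCommGroup E] [NormedSpace ℝ E] [FiniteDimensional ℝ E]
  [CompleteSpace E]
  {H : Type*} [TopologicalSpace H] {I : ModelWithCorners ℝ E H}
  {G : Type*} [TopologicalSpace G] [ChartedSpace H G] [Group G] [LieGroup I ∞ G]
  {b : Module.Basis (Fin 3) ℝ (GroupLieAlgebra I G)} {α β γ δ : ℝ}

theorem IsAdapted.structConst_eq (h : IsAdapted b α β γ δ) :
    structConst b = ![![![0, 0, 0], ![0, α, γ], ![0, β, δ]], ![![0, -α, -γ], ![0, 0, 0], ![0, 0, 0]],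
      ![![0, -β, -δ], ![0, 0, 0], ![0, 0, 0]]] := by
  have h01 : ∀ k, structConst b 0 1 k = ![0, α, γ] k := by
    intro k
    rw [structConst, h.lie01]
    fin_cases k <;> simp
  have h02 : ∀ k, structConst b 0 2 k = ![0, β, δ] k := by
    intro k
    rw [structConst, h.lie02]
    fin_cases k <;> simp
  have h12 : ∀ k, structConst b 1 2 k = 0 := by
    intro k
    rw [structConst, h.lie12]
    simp
  have hs : ∀ i k, structConst b i i k = 0 := by
    intro i k
    have := structConst_swap b i i k
    linarith
  have h10 : ∀ k, structConst b 1 0 k = ![0, -α, -γ] k := by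
    intro k
    rw [structConst_swap, h01]
    fin_cases k <;> simp
  have h20 : ∀ k, structConst b 2 0 k = ![0, -β, -δ] k := by
    intro k
    rw [structConst_swap, h02]
    fin_cases k <;> simp
  have h21 : ∀ k, structConst b 2 1 k = 0 := by
    intro k
    rw [structConst_swap, h12, neg_zero]
  ext i j k
  fin_cases i <;> fin_cases j <;> fin_cases k <;> simp [h01, h02, h12, hs, h10, h20, h21]

theorem IsAdapted.mem_symmetrySet (h : IsAdapted b α β γ δ)
    {F₀ F₁ F₂ D₀₀ D₁₀ D₂₀ D₀₁ D₁₁ D₂₁ D₀₂ D₁₂ D₂₂ : G → ℝ}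
    (h₀ : HasFrameDeriv b F₀ D₀₀ D₁₀ D₂₀) (h₁ : HasFrameDeriv b F₁ D₀₁ D₁₁ D₂₁)
    (h₂ : HasFrameDeriv b F₂ D₀₂ D₁₂ D₂₂)
    (k₀₀ : ∀ p, D₀₀ p = 0) (k₁₁ : ∀ p, D₁₁ p = α * F₀ p) (k₂₂ : ∀ p, D₂₂ p = δ * F₀ p)
    (k₀₁ : ∀ p, D₁₀ p + D₀₁ p = -(α * F₁ p + β * F₂ p))
    (k₀₂ : ∀ p, D₂₀ p + D₀₂ p = -(γ * F₁ p + δ * F₂ p))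
    (k₁₂ : ∀ p, D₁₂ p + D₂₁ p = (β + γ) * F₀ p)
    (p₀₁ : D₀₁ 1 = (γ - β) / 2 * F₂ 1) (p₀₂ : D₀₂ 1 = -((γ - β) / 2 * F₁ 1))
    (p₁₂ : D₁₂ 1 = (β + γ) / 2 * F₀ 1) {x : GroupLieAlgebra I G}
    (x₀ : b.repr x 0 = F₀ 1) (x₁ : b.repr x 1 = F₁ 1) (x₂ : b.repr x 2 = F₂ 1) :
    x ∈ symmetrySet (leftInvariantMetric b) (1 : G) := by
  refine (mem_symmetrySet_leftInvariantMetric_iff b x).2 ⟨![F₀, F₁, F₂], ?_, ?_, ?_, ?_⟩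
  · intro i
    fin_cases i
    exacts [h₀.contMDiff, h₁.contMDiff, h₂.contMDiff]
  · intro p j k
    have e₀₀ := k₀₀ p
    have e₁₁ := k₁₁ p
    have e₂₂ := k₂₂ p
    have e₀₁ := k₀₁ p
    have e₀₂ := k₀₂ p
    have e₁₂ := k₁₂ p
    fin_cases j <;> fin_cases k <;>
      simp [h.structConst_eq, Fin.sum_univ_three, h₀.deriv₀, h₀.deriv₁, h₀.deriv₂, h₁.deriv₀,
        h₁.deriv₁, h₁.deriv₂, h₂.deriv₀, h₂.deriv₁, h₂.deriv₂] <;> linarith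
  · intro j k
    have e₀₀ := k₀₀ 1
    have e₁₁ := k₁₁ 1
    have e₂₂ := k₂₂ 1
    have e₀₁ := k₀₁ 1
    have e₀₂ := k₀₂ 1
    have e₁₂ := k₁₂ 1
    fin_cases j <;> fin_cases k <;>
      simp [christoffel, h.structConst_eq, Fin.sum_univ_three, h₀.deriv₀, h₀.deriv₁, h₀.deriv₂,
        h₁.deriv₀, h₁.deriv₁, h₁.deriv₂, h₂.deriv₀, h₂.deriv₁, h₂.deriv₂] <;> linarith
  · intro i
    fin_cases i
    exacts [x₀, x₁, x₂]

theorem IsAdapted.exists_of_mem_symmetrySet (h : IsAdapted b α β γ δ) {x : GroupLieAlgebra I G}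
    (hx : x ∈ symmetrySet (leftInvariantMetric b) (1 : G)) :
    ∃ F₀ F₁ F₂ : G → ℝ, ContMDiff I 𝓘(ℝ) ∞ F₀ ∧ ContMDiff I 𝓘(ℝ) ∞ F₁ ∧ ContMDiff I 𝓘(ℝ) ∞ F₂ ∧
      (∀ p, frameDeriv b 0 F₀ p = 0) ∧ (∀ p, frameDeriv b 1 F₁ p = α * F₀ p) ∧
      (∀ p, frameDeriv b 2 F₂ p = δ * F₀ p) ∧
      (∀ p, frameDeriv b 0 F₁ p = -frameDeriv b 1 F₀ p - (α * F₁ p + β * F₂ p)) ∧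
      (∀ p, frameDeriv b 0 F₂ p = -frameDeriv b 2 F₀ p - (γ * F₁ p + δ * F₂ p)) ∧
      (∀ p, frameDeriv b 2 F₁ p = (β + γ) * F₀ p - frameDeriv b 1 F₂ p) ∧
      frameDeriv b 1 F₀ 1 = -(α * F₁ 1 + (β + γ) / 2 * F₂ 1) ∧
      frameDeriv b 2 F₀ 1 = -((β + γ) / 2 * F₁ 1 + δ * F₂ 1) ∧
      frameDeriv b 1 F₂ 1 = (β + γ) / 2 * F₀ 1 ∧
      b.repr x 0 = F₀ 1 ∧ b.repr x 1 = F₁ 1 ∧ b.repr x 2 = F₂ 1 := by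
  obtain ⟨F, hF, hK, hP, hx⟩ := (mem_symmetrySet_leftInvariantMetric_iff b x).1 hx
  refine ⟨F 0, F 1, F 2, hF 0, hF 1, hF 2, fun p ↦ ?_, fun p ↦ ?_, fun p ↦ ?_, fun p ↦ ?_,
    fun p ↦ ?_, fun p ↦ ?_, ?_, ?_, ?_, hx 0, hx 1, hx 2⟩
  · have := hK p 0 0
    simp [h.structConst_eq, Fin.sum_univ_three] at this
    linarith
  · have := hK p 1 1
    simp [h.structConst_eq, Fin.sum_univ_three] at this
    linarith
  · have := hK p 2 2
    simp [h.structConst_eq, Fin.sum_univ_three] at this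
    linarith
  · have := hK p 0 1
    simp [h.structConst_eq, Fin.sum_univ_three] at this
    linarith
  · have := hK p 0 2
    simp [h.structConst_eq, Fin.sum_univ_three] at this
    linarith
  · have := hK p 1 2
    simp [h.structConst_eq, Fin.sum_univ_three] at this
    linarith
  · have := hP 1 0
    simp [christoffel, h.structConst_eq, Fin.sum_univ_three] at this
    linarith
  · have := hP 2 0
    simp [christoffel, h.structConst_eq, Fin.sum_univ_three] at this
    linarith
  · have := hP 1 2
    simp [christoffel, h.structConst_eq, Fin.sum_univ_three] at this
    linarith

theorem IsAdapted.frameDeriv_commutator01 (h : IsAdapted b α β γ δ) {f : G → ℝ}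
    (hf : ContMDiff I 𝓘(ℝ) ∞ f) (p : G) :
    frameDeriv b 0 (frameDeriv b 1 f) p - frameDeriv b 1 (frameDeriv b 0 f) p =
      α * frameDeriv b 1 f p + γ * frameDeriv b 2 f p := by
  rw [frameDeriv_commutator b 0 1 hf, h.structConst_eq]
  simp [Fin.sum_univ_three]

theorem IsAdapted.frameDeriv_commutator02 (h : IsAdapted b α β γ δ) {f : G → ℝ}
    (hf : ContMDiff I 𝓘(ℝ) ∞ f) (p : G) :
    frameDeriv b 0 (frameDeriv b 2 f) p - frameDeriv b 2 (frameDeriv b 0 f) p =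
      β * frameDeriv b 1 f p + δ * frameDeriv b 2 f p := by
  rw [frameDeriv_commutator b 0 2 hf, h.structConst_eq]
  simp [Fin.sum_univ_three]

theorem IsAdapted.frameDeriv_commutator12 (h : IsAdapted b α β γ δ) {f : G → ℝ}
    (hf : ContMDiff I 𝓘(ℝ) ∞ f) (p : G) :
    frameDeriv b 1 (frameDeriv b 2 f) p = frameDeriv b 2 (frameDeriv b 1 f) p := by
  refine sub_eq_zero.1 ?_
  rw [frameDeriv_commutator b 1 2 hf, h.structConst_eq]
  simp [Fin.sum_univ_three]

variable [I.Boundaryless]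

theorem IsAdapted.hasFrameDeriv_adjointInv_zero (h : IsAdapted b α β γ δ)
    (v : GroupLieAlgebra I G) :
    HasFrameDeriv b (fun p ↦ b.repr (adjointInv p v) 0) (fun _ ↦ 0) (fun _ ↦ 0) (fun _ ↦ 0) := by
  refine ⟨contMDiff_repr_adjointInv b v 0, fun p ↦ ?_, fun p ↦ ?_, fun p ↦ ?_⟩ <;>
  · rw [frameDeriv_repr_adjointInv b v, h.structConst_eq]
    simp [Fin.sum_univ_three]

theorem IsAdapted.hasFrameDeriv_adjointInv_one (h : IsAdapted b α β γ δ)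
    (v : GroupLieAlgebra I G) :
    HasFrameDeriv b (fun p ↦ b.repr (adjointInv p v) 1)
      (fun p ↦ -(α * b.repr (adjointInv p v) 1 + β * b.repr (adjointInv p v) 2))
      (fun p ↦ α * b.repr (adjointInv p v) 0) (fun p ↦ β * b.repr (adjointInv p v) 0) := by
  refine ⟨contMDiff_repr_adjointInv b v 1, fun p ↦ ?_, fun p ↦ ?_, fun p ↦ ?_⟩ <;>
  · rw [frameDeriv_repr_adjointInv b v, h.structConst_eq]
    simp [Fin.sum_univ_three]
    ring

theorem IsAdapted.hasFrameDeriv_adjointInv_two (h : IsAdapted b α β γ δ)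
    (v : GroupLieAlgebra I G) :
    HasFrameDeriv b (fun p ↦ b.repr (adjointInv p v) 2)
      (fun p ↦ -(γ * b.repr (adjointInv p v) 1 + δ * b.repr (adjointInv p v) 2))
      (fun p ↦ γ * b.repr (adjointInv p v) 0) (fun p ↦ δ * b.repr (adjointInv p v) 0) := by
  refine ⟨contMDiff_repr_adjointInv b v 2, fun p ↦ ?_, fun p ↦ ?_, fun p ↦ ?_⟩ <;>
  · rw [frameDeriv_repr_adjointInv b v, h.structConst_eq]
    simp [Fin.sum_univ_three]
    ring

theorem repr_adjointInv_one (b : Module.Basis (Fin 3) ℝ (GroupLieAlgebra I G))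
    (v : GroupLieAlgebra I G) (i : Fin 3) : b.repr (adjointInv (1 : G) v) i = b.repr v i := by
  rw [adjointInv_one]

/-- A right-invariant field is parallel at the identity as soon as two of its covariant derivatives
vanish there. -/
theorem IsAdapted.rightInvariant_mem_symmetrySet (h : IsAdapted b α β γ δ)
    (v : GroupLieAlgebra I G)
    (h₁ : -(α * b.repr v 1 + β * b.repr v 2) = (γ - β) / 2 * b.repr v 2)
    (h₂ : γ * b.repr v 1 + δ * b.repr v 2 = (γ - β) / 2 * b.repr v 1)
    (h₁₂ : (γ - β) * b.repr v 0 = 0) :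
    v ∈ symmetrySet (leftInvariantMetric b) (1 : G) := by
  refine h.mem_symmetrySet (h.hasFrameDeriv_adjointInv_zero v) (h.hasFrameDeriv_adjointInv_one v)
    (h.hasFrameDeriv_adjointInv_two v) ?_ ?_ ?_ ?_ ?_ ?_ ?_ ?_ ?_ ?_ ?_ ?_
  · intro p; ring
  · intro p; ring
  · intro p; ring
  · intro p; ring
  · intro p; ring
  · intro p; ring
  · simp only [repr_adjointInv_one]; linarith
  · simp only [repr_adjointInv_one]; linarith
  · simp only [repr_adjointInv_one]; linarith
  all_goals exact (repr_adjointInv_one b v _).symm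

end Adapted

section Algebra

theorem exists_basis_of_det_ne_zero {V : Type*} [AddCommGroup V] [Module ℝ V]
    (b : Module.Basis (Fin 3) ℝ V) (v : Fin 3 → V) (h : (b.toMatrix v).det ≠ 0) :
    ∃ b' : Module.Basis (Fin 3) ℝ V, ∀ i, b' i = v i := by
  have h1 := (b.is_basis_iff_det (v := v)).2 (by rw [b.det_apply]; exact isUnit_iff_ne_zero.2 h)
  exact ⟨Module.Basis.mk h1.1 h1.2.ge, fun i ↦ by simp⟩

variable {𝔤 : Type*} [LieRing 𝔤] [LieAlgebra ℝ 𝔤]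

theorem exists_basis_fin_three (b : Module.Basis (Fin 3) ℝ 𝔤) (p q r x y x' y' : ℝ)
    (h : p * (x * y' - x' * y) ≠ 0) :
    ∃ b' : Module.Basis (Fin 3) ℝ 𝔤, b' 0 = p • b 0 + q • b 1 + r • b 2 ∧
      b' 1 = x • b 1 + y • b 2 ∧ b' 2 = x' • b 1 + y' • b 2 := by
  obtain ⟨b', hb'⟩ := exists_basis_of_det_ne_zero b
    ![p • b 0 + q • b 1 + r • b 2, x • b 1 + y • b 2, x' • b 1 + y' • b 2] (by
      rw [Matrix.det_fin_three]
      simp [Module.Basis.toMatrix_apply]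
      intro h0
      apply h
      linarith)
  exact ⟨b', hb' 0, hb' 1, hb' 2⟩

theorem IsAdapted.lie_apply {b : Module.Basis (Fin 3) ℝ 𝔤} {α β γ δ : ℝ}
    (h : IsAdapted b α β γ δ) (p q r x y : ℝ) :
    ⁅p • b 0 + q • b 1 + r • b 2, x • b 1 + y • b 2⁆ =
      (p * (α * x + β * y)) • b 1 + (p * (γ * x + δ * y)) • b 2 := by
  have h21 : ⁅b 2, b 1⁆ = 0 := by rw [← lie_skew, h.lie12, neg_zero]
  simp only [lie_add, add_lie, lie_smul, smul_lie, h.lie01, h.lie02, h.lie12, h21, lie_self]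
  module

theorem IsAdapted.change {b b' : Module.Basis (Fin 3) ℝ 𝔤} {α β γ δ α' β' γ' δ' : ℝ}
    (h : IsAdapted b α β γ δ) {p q r x y x' y' : ℝ}
    (h₀ : b' 0 = p • b 0 + q • b 1 + r • b 2)
    (h₁ : b' 1 = x • b 1 + y • b 2) (h₂ : b' 2 = x' • b 1 + y' • b 2)
    (e₁ : p * (α * x + β * y) = α' * x + γ' * x') (e₂ : p * (γ * x + δ * y) = α' * y + γ' * y')
    (e₃ : p * (α * x' + β * y') = β' * x + δ' * x')
    (e₄ : p * (γ * x' + δ * y') = β' * y + δ' * y') :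
    IsAdapted b' α' β' γ' δ' := by
  constructor
  · rw [h₀, h₁, h₂, h.lie_apply, e₁, e₂]
    module
  · rw [h₀, h₁, h₂, h.lie_apply, e₃, e₄]
    module
  · have := h.lie_apply 0 x y x' y'
    rw [h₁, h₂]
    simpa using this

theorem IsAdapted.exists_change {b : Module.Basis (Fin 3) ℝ 𝔤} {α β γ δ : ℝ}
    (h : IsAdapted b α β γ δ) {α' β' γ' δ' : ℝ} (x y x' y' : ℝ) (hd : x * y' - x' * y ≠ 0)
    (e₁ : α * x + β * y = α' * x + γ' * x') (e₂ : γ * x + δ * y = α' * y + γ' * y')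
    (e₃ : α * x' + β * y' = β' * x + δ' * x') (e₄ : γ * x' + δ * y' = β' * y + δ' * y') :
    ∃ b' : Module.Basis (Fin 3) ℝ 𝔤, IsAdapted b' α' β' γ' δ' := by
  obtain ⟨b', h₀, h₁, h₂⟩ := exists_basis_fin_three b 1 0 0 x y x' y' (by simpa using hd)
  exact ⟨b', h.change h₀ h₁ h₂ (by linarith) (by linarith) (by linarith) (by linarith)⟩

theorem exists_isAdapted [LieAlgebra.IsSolvable 𝔤] (h3 : Module.finrank ℝ 𝔤 = 3) :
    ∃ (b : Module.Basis (Fin 3) ℝ 𝔤) (α β γ δ : ℝ), IsAdapted b α β γ δ := by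
  have : FiniteDimensional ℝ 𝔤 := Module.finite_of_finrank_pos (by omega)
  have : Nontrivial 𝔤 := Module.nontrivial_of_finrank_pos (R := ℝ) (by omega)
  have hlt := LieAlgebra.derivedSeries_lt_top_of_solvable ℝ 𝔤
  obtain ⟨ℓ, hℓ, hker⟩ := Submodule.exists_le_ker_of_lt_top
    (LieAlgebra.derivedSeries ℝ 𝔤 1).toSubmodule (by
      rw [← LieSubmodule.top_toSubmodule (R := ℝ) (L := 𝔤) (M := 𝔤)]
      exact hlt)
  have hb : ∀ x y : 𝔤, ℓ ⁅x, y⁆ = 0 := by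
    intro x y
    apply hker
    rw [LieAlgebra.derivedSeries_def, LieAlgebra.derivedSeriesOfIdeal_succ,
      LieAlgebra.derivedSeriesOfIdeal_zero]
    exact LieSubmodule.lie_mem_lie (LieSubmodule.mem_top x) (LieSubmodule.mem_top y)
  obtain ⟨y₀, hy₀⟩ : ∃ y, ℓ y ≠ 0 := by
    by_contra hne
    push Not at hne
    exact hℓ (LinearMap.ext hne)
  have hk : Module.finrank ℝ (LinearMap.ker ℓ) = 2 := by
    have h1 := LinearMap.finrank_range_add_finrank_ker ℓ
    have h2 : LinearMap.range ℓ = ⊤ := LinearMap.range_eq_top.2 (LinearMap.surjective hℓ)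
    rw [h2, finrank_top, Module.finrank_self, h3] at h1
    omega
  let k : Module.Basis (Fin 2) ℝ (LinearMap.ker ℓ) := Module.finBasisOfFinrankEq ℝ _ hk
  have hspan : ∀ x : 𝔤, ℓ x = 0 → ∃ s t : ℝ, x = s • (k 0 : 𝔤) + t • (k 1 : 𝔤) := by
    intro x hx
    have h1 := k.sum_repr ⟨x, hx⟩
    rw [Fin.sum_univ_two] at h1
    exact ⟨_, _, (congrArg Subtype.val h1).symm⟩
  have hk0 : ∀ i, ℓ (k i : 𝔤) = 0 := fun i ↦ (k i).2
  have hli : LinearIndependent ℝ ![y₀, (k 0 : 𝔤), (k 1 : 𝔤)] := by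
    rw [Fintype.linearIndependent_iff]
    intro c hc
    simp only [Fin.sum_univ_three, Matrix.cons_val_zero, Matrix.cons_val_one, Matrix.cons_val] at hc
    have h0 : c 0 = 0 := by
      have h1 := congrArg ℓ hc
      simp [hk0] at h1
      exact h1.resolve_right hy₀
    rw [h0, zero_smul, zero_add] at hc
    have h2 : ∑ i, (![c 1, c 2] i) • k i = 0 := by
      rw [Fin.sum_univ_two]
      exact Subtype.ext hc
    have h3 := Fintype.linearIndependent_iff.1 k.linearIndependent _ h2
    have h4 := h3 0
    have h5 := h3 1
    simp at h4 h5
    intro i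
    fin_cases i
    exacts [h0, h4, h5]
  let e := basisOfLinearIndependentOfCardEqFinrank hli (by simp [h3])
  have e0 : e 0 = y₀ := by simp [e]
  have e1 : e 1 = (k 0 : 𝔤) := by simp [e]
  have e2 : e 2 = (k 1 : 𝔤) := by simp [e]
  rw [← e1, ← e2] at hspan
  obtain ⟨w₁, w₂, hw⟩ := hspan _ (hb (e 1) (e 2))
  obtain ⟨α, γ, h01⟩ := hspan _ (hb (e 0) (e 1))
  obtain ⟨β, δ, h02⟩ := hspan _ (hb (e 0) (e 2))
  by_cases hw0 : w₁ = 0 ∧ w₂ = 0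
  · refine ⟨e, α, β, γ, δ, h01, h02, ?_⟩
    rw [hw, hw0.1, hw0.2]
    simp
  have hN : w₁ ^ 2 + w₂ ^ 2 ≠ 0 := by
    intro h
    exact hw0 ⟨by nlinarith [sq_nonneg w₁, sq_nonneg w₂], by nlinarith [sq_nonneg w₁, sq_nonneg w₂]⟩
  set N := w₁ ^ 2 + w₂ ^ 2 with hNdef
  have hdet : w₂ / N * w₂ - w₁ * (-w₁ / N) = 1 := by
    field_simp
    rw [hNdef]
    ring
  obtain ⟨f, f0, f1, f2⟩ := exists_basis_fin_three e 1 0 0 (w₂ / N) (-w₁ / N) w₁ w₂ (by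
    rw [hdet]; simp)
  have h21 : ⁅e 2, e 1⁆ = -(w₁ • e 1 + w₂ • e 2) := by rw [← lie_skew, hw]
  have f12 : ⁅f 1, f 2⁆ = f 2 := by
    rw [f1, f2]
    simp only [lie_add, add_lie, lie_smul, smul_lie, hw, h21, lie_self]
    refine Eq.trans ?_ (one_smul ℝ (w₁ • e 1 + w₂ • e 2))
    rw [← hdet]
    module
  have hspan' : ∀ x : 𝔤, ℓ x = 0 → ∃ s t : ℝ, x = s • f 1 + t • f 2 := by
    intro x hx
    obtain ⟨s, t, rfl⟩ := hspan x hx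
    refine ⟨s * w₂ - t * w₁, t * (w₂ / N) - s * (-w₁ / N), ?_⟩
    rw [f1, f2]
    refine (one_smul ℝ (s • e 1 + t • e 2)).symm.trans ?_
    rw [← hdet]
    module
  obtain ⟨a, c, g01⟩ := hspan' _ (hb (f 0) (f 1))
  obtain ⟨a', c', g02⟩ := hspan' _ (hb (f 0) (f 2))
  have f21 : ⁅f 2, f 1⁆ = -f 2 := by rw [← lie_skew, f12]
  have J := leibniz_lie (f 0) (f 1) (f 2)
  rw [f12, g01, g02] at J
  simp only [lie_add, add_lie, lie_smul, smul_lie, f12, lie_self, smul_zero, add_zero, zero_add] at J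
  have J1 : a' • f 1 + (-a) • f 2 = 0 := by
    rw [← sub_eq_zero] at J
    rw [← J]
    module
  have J2 := congrArg (fun x ↦ f.repr x) J1
  have ha' : a' = 0 := by
    have := congrArg (fun x ↦ x 1) J2
    simpa using this
  have ha : a = 0 := by
    have := congrArg (fun x ↦ x 2) J2
    simpa using this
  rw [ha, zero_smul, zero_add] at g01
  rw [ha', zero_smul, zero_add] at g02
  obtain ⟨b, hb'⟩ := exists_basis_of_det_ne_zero f ![f 1, f 2, f 0 + (-c') • f 1 + c • f 2] (by
    rw [Matrix.det_fin_three]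
    simp [Module.Basis.toMatrix_apply])
  have b0 : b 0 = f 1 := hb' 0
  have b1 : b 1 = f 2 := hb' 1
  have b2 : b 2 = f 0 + (-c') • f 1 + c • f 2 := hb' 2
  have f10 : ⁅f 1, f 0⁆ = -(c • f 2) := by rw [← lie_skew, g01]
  have f20 : ⁅f 2, f 0⁆ = -(c' • f 2) := by rw [← lie_skew, g02]
  refine ⟨b, 1, 0, 0, 0, ?_, ?_, ?_⟩
  · rw [b0, b1, f12]
    simp
  · rw [b0, b2]
    simp only [lie_add, lie_smul, f10, f12, lie_self]
    module
  · rw [b1, b2]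
    simp only [lie_add, lie_smul, f20, f21, lie_self]
    module

/-- The normal forms of a three-dimensional solvable Lie algebra used for the choice of metric. -/
theorem IsAdapted.exists_normalForm {b : Module.Basis (Fin 3) ℝ 𝔤} {α β γ δ : ℝ}
    (h : IsAdapted b α β γ δ) :
    (∃ (b' : Module.Basis (Fin 3) ℝ 𝔤) (p q : ℝ), IsAdapted b' p 0 0 q) ∨
    (∃ (b' : Module.Basis (Fin 3) ℝ 𝔤) (p q : ℝ), IsAdapted b' 0 p (-p) q) ∨
    ∃ b' : Module.Basis (Fin 3) ℝ 𝔤, IsAdapted b' 0 1 0 0 := by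
  by_cases h0 : β = 0 ∧ γ = 0
  · obtain ⟨rfl, rfl⟩ := h0
    exact Or.inl ⟨b, α, δ, h⟩
  obtain ⟨e, τ, Δ, he⟩ : ∃ (e : Module.Basis (Fin 3) ℝ 𝔤) (τ Δ : ℝ), IsAdapted e 0 (-Δ) 1 τ := by
    by_cases hγ : γ = 0
    · have hβ : β ≠ 0 := fun hβ ↦ h0 ⟨hβ, hγ⟩
      obtain ⟨e, he⟩ := h.exists_change (α' := 0) (β' := -(α * δ - β * γ)) (γ' := 1) (δ' := α + δ)
        0 1 β δ (by simpa using hβ) (by ring) (by ring) (by ring) (by ring)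
      exact ⟨e, _, _, he⟩
    · obtain ⟨e, he⟩ := h.exists_change (α' := 0) (β' := -(α * δ - β * γ)) (γ' := 1) (δ' := α + δ)
        1 0 α γ (by simpa using hγ) (by ring) (by ring) (by ring) (by ring)
      exact ⟨e, _, _, he⟩
  rcases lt_or_ge 0 Δ with hΔ | hΔ
  · refine Or.inr (Or.inl ?_)
    have hs : √Δ ≠ 0 := (Real.sqrt_pos.2 hΔ).ne'
    have hs2 : √Δ * √Δ = Δ := Real.mul_self_sqrt hΔ.le
    obtain ⟨b', hb'⟩ := he.exists_change (α' := 0) (β' := √Δ) (γ' := -√Δ) (δ' := τ)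
      1 0 0 (-(√Δ)⁻¹) (by simpa using hs) (by ring) (by field_simp; ring)
      (by field_simp; linarith) (by ring)
    exact ⟨b', _, _, hb'⟩
  · have hD : 0 ≤ τ ^ 2 - 4 * Δ := by nlinarith [sq_nonneg τ]
    rcases hD.eq_or_lt with hD | hD
    · have hτ : τ = 0 := by nlinarith [sq_nonneg τ]
      have hΔ0 : Δ = 0 := by rw [hτ] at hD; linarith
      subst hτ hΔ0
      refine Or.inr (Or.inr ?_)
      exact he.exists_change 0 1 1 0 (by norm_num) (by ring) (by ring) (by ring) (by ring)
    · refine Or.inl ?_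
      set s := √(τ ^ 2 - 4 * Δ) with hs
      have hs0 : s ≠ 0 := (Real.sqrt_pos.2 hD).ne'
      have hs2 : s * s = τ ^ 2 - 4 * Δ := Real.mul_self_sqrt hD.le
      obtain ⟨b', hb'⟩ := he.exists_change (α' := (τ + s) / 2) (β' := 0) (γ' := 0)
        (δ' := (τ - s) / 2) (-((τ - s) / 2)) 1 (-((τ + s) / 2)) 1
        (by intro h; apply hs0; linarith) (by linarith) (by ring) (by linarith) (by ring)
      exact ⟨b', _, _, hb'⟩

end Algebra

section Fields

variable {E : Type*} [NormedAddCommGroup E] [NormedSpace ℝ E] [FiniteDimensional ℝ E]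
  [CompleteSpace E]
  {H : Type*} [TopologicalSpace H] {I : ModelWithCorners ℝ E H} [I.Boundaryless]
  {G : Type*} [TopologicalSpace G] [ChartedSpace H G] [Group G] [LieGroup I ∞ G]
  {b : Module.Basis (Fin 3) ℝ (GroupLieAlgebra I G)} {p q k : ℝ}

theorem IsAdapted.mem_symmetrySet_of_diagonal (h : IsAdapted b p 0 0 q) :
    b 0 ∈ symmetrySet (leftInvariantMetric b) (1 : G) :=
  h.rightInvariant_mem_symmetrySet (b 0) (by simp) (by simp) (by simp)

theorem IsAdapted.mem_symmetrySet_of_complex (h : IsAdapted b 0 p (-p) q) :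
    b 1 ∈ symmetrySet (leftInvariantMetric b) (1 : G) :=
  h.rightInvariant_mem_symmetrySet (b 1) (by simp) (by simp; ring) (by simp)

theorem IsAdapted.mem_symmetrySet_of_heisenberg (h : IsAdapted b 0 1 0 0) :
    b 1 ∈ symmetrySet (leftInvariantMetric b) (1 : G) := by
  have f₀ := h.hasFrameDeriv_adjointInv_zero (b 2)
  have f₁ := h.hasFrameDeriv_adjointInv_one (b 2)
  have f₂ := h.hasFrameDeriv_adjointInv_two (b 2)
  have h₀ := h.hasFrameDeriv_adjointInv_zero (b 0)
  have h₁ := h.hasFrameDeriv_adjointInv_one (b 0)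
  have h₂ := h.hasFrameDeriv_adjointInv_two (b 0)
  have hy := (f₂.mul h₁).sub (h₂.mul f₁)
  have hx := (h₁.mul f₀).sub (f₁.mul h₀)
  have hd := (h₀.mul f₂).sub (h₂.mul f₀)
  refine h.mem_symmetrySet ((hd.mul hy).const_mul (-1 / 2))
    ((HasFrameDeriv.const b 1).sub (((hx.mul hx).add (hy.mul hy)).const_mul (1 / 4)))
    ((hd.mul hx).const_mul (1 / 2)) ?_ ?_ ?_ ?_ ?_ ?_ ?_ ?_ ?_ ?_ ?_ ?_
  · intro p; ring
  · intro p; ring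
  · intro p; ring
  · intro p; ring
  · intro p; ring
  · intro p; ring
  · simp [repr_adjointInv_one]
  · simp [repr_adjointInv_one]; norm_num
  all_goals simp [repr_adjointInv_one]

theorem IsAdapted.mem_symmetrySet_of_skew (h : IsAdapted b 0 (-k) k 0) (i : Fin 3) :
    b i ∈ symmetrySet (leftInvariantMetric b) (1 : G) := by
  fin_cases i
  · exact h.mem_symmetrySet (HasFrameDeriv.const b 1) (HasFrameDeriv.const b 0)
      (HasFrameDeriv.const b 0) (by simp) (by simp) (by simp) (by simp) (by simp) (by simp)
      (by simp) (by simp) (by simp) (by simp) (by simp) (by simp)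
  · exact h.rightInvariant_mem_symmetrySet (b 1) (by simp) (by simp) (by simp)
  · exact h.rightInvariant_mem_symmetrySet (b 2) (by simp) (by simp) (by simp)

theorem IsAdapted.repr_lie_zero {𝔤 : Type*} [LieRing 𝔤] [LieAlgebra ℝ 𝔤]
    {b : Module.Basis (Fin 3) ℝ 𝔤} {α β γ δ : ℝ} (h : IsAdapted b α β γ δ) (v w : 𝔤) :
    b.repr ⁅v, w⁆ 0 = 0 ∧
    b.repr ⁅v, w⁆ 1 = α * (b.repr v 0 * b.repr w 1 - b.repr v 1 * b.repr w 0) +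
      β * (b.repr v 0 * b.repr w 2 - b.repr v 2 * b.repr w 0) ∧
    b.repr ⁅v, w⁆ 2 = γ * (b.repr v 0 * b.repr w 1 - b.repr v 1 * b.repr w 0) +
      δ * (b.repr v 0 * b.repr w 2 - b.repr v 2 * b.repr w 0) := by
  have h10 : ⁅b 1, b 0⁆ = -(α • b 1 + γ • b 2) := by rw [← lie_skew, h.lie01]
  have h20 : ⁅b 2, b 0⁆ = -(β • b 1 + δ • b 2) := by rw [← lie_skew, h.lie02]
  have h21 : ⁅b 2, b 1⁆ = 0 := by rw [← lie_skew, h.lie12, neg_zero]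
  have key : ⁅v, w⁆ = (α * (b.repr v 0 * b.repr w 1 - b.repr v 1 * b.repr w 0) +
      β * (b.repr v 0 * b.repr w 2 - b.repr v 2 * b.repr w 0)) • b 1 +
      (γ * (b.repr v 0 * b.repr w 1 - b.repr v 1 * b.repr w 0) +
      δ * (b.repr v 0 * b.repr w 2 - b.repr v 2 * b.repr w 0)) • b 2 := by
    conv_lhs => rw [← b.sum_repr v, ← b.sum_repr w]
    simp only [Fin.sum_univ_three, lie_add, add_lie, lie_smul, smul_lie, h.lie01, h.lie02, h.lie12,
      h10, h20, h21, lie_self]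
    module
  rw [key]
  simp

theorem IsAdapted.mem_symmetrySet_of_rank_one_aux (h : IsAdapted b 0 0 0 p) (hp : p ≠ 0)
    {u w : G → ℝ} (du : HasFrameDeriv b u (fun g ↦ -p * u g) (fun _ ↦ 0) (fun _ ↦ 0))
    (dw : HasFrameDeriv b w (fun g ↦ -p * w g) (fun _ ↦ 0) (fun _ ↦ p)) (hu : ∀ g, u g ≠ 0)
    (u₁ : u 1 = 1) (w₁ : w 1 = 0) : b 2 ∈ symmetrySet (leftInvariantMetric b) (1 : G) := by
  have dq := (du.inv hu).congr (f₀' := fun g ↦ p * (u g)⁻¹) (f₁' := fun _ ↦ 0) (f₂' := fun _ ↦ 0)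
    (fun _ ↦ rfl) (fun g ↦ by field_simp [hu g]) (fun g ↦ by ring) (fun g ↦ by ring)
  have dy := ((dw.mul dq).const_mul p⁻¹).congr (f₀' := fun _ ↦ 0) (f₁' := fun _ ↦ 0)
    (f₂' := fun g ↦ (u g)⁻¹) (fun _ ↦ rfl) (fun g ↦ by ring) (fun g ↦ by ring)
    (fun g ↦ by field_simp; ring)
  have hz : HasFrameDeriv b _ _ _ _ := ((du.mul (dy.mul dy)).const_mul (p / 2)).sub
    ((dq.add du).const_mul (1 / (2 * p)))
  have hm : (-1 / p) • b 2 ∈ symmetrySet (leftInvariantMetric b) (1 : G) := by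
    refine h.mem_symmetrySet dy (HasFrameDeriv.const b 0) hz ?_ ?_ ?_ ?_ ?_ ?_ ?_ ?_ ?_ ?_ ?_ ?_
    · intro g; ring
    · intro g; ring
    · intro g
      have := hu g
      field_simp
      ring
    · intro g; ring
    · intro g
      field_simp
      ring
    · intro g; ring
    · ring
    · rw [u₁, w₁]; simp
    · simp
    · simp [w₁]
    · simp
    · simp [u₁, w₁]
      ring
  have h2 := symmetrySet_smul (-p) hm
  have e : (-p) • ((-1 / p) • b 2) = b 2 := by
    rw [smul_smul, show -p * (-1 / p) = 1 by field_simp, one_smul]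
  rw [← e]
  exact h2

theorem IsAdapted.mem_symmetrySet_of_rank_one (h : IsAdapted b 0 0 0 p) (hp : p ≠ 0) (i : Fin 3) :
    b i ∈ symmetrySet (leftInvariantMetric b) (1 : G) := by
  fin_cases i
  · exact h.rightInvariant_mem_symmetrySet (b 0) (by simp) (by simp) (by simp)
  · exact h.rightInvariant_mem_symmetrySet (b 1) (by simp) (by simp) (by simp)
  change b 2 ∈ _
  have hlie : ∀ g : G, p • adjointInv g (b 2) = ⁅adjointInv g (b 0), adjointInv g (b 2)⁆ := by
    intro g
    rw [← adjointInv_lie, h.lie02, zero_smul, zero_add]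
    exact (map_smul (mfderiv I I (fun x : G ↦ g⁻¹ * x * g) 1) p (b 2)).symm
  have hr := fun g : G ↦ h.repr_lie_zero (adjointInv g (b 0)) (adjointInv g (b 2))
  simp only [← hlie, map_smul, Finsupp.smul_apply, smul_eq_mul, zero_mul, add_zero, zero_add,
    mul_eq_zero, hp, false_or] at hr
  have u₀ : ∀ g : G, b.repr (adjointInv g (b 2)) 0 = 0 := fun g ↦ (hr g).1
  have hu : ∀ g : G, b.repr (adjointInv g (b 2)) 2 ≠ 0 := by
    intro g h0
    refine b.ne_zero 2 (adjointInv_injective g (b.ext_elem fun i ↦ ?_))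
    rw [map_zero]
    fin_cases i
    exacts [u₀ g, (hr g).2.1, h0]
  have hc : ∀ g : G, b.repr (adjointInv g (b 0)) 0 = 1 := by
    intro g
    have := (hr g).2.2
    rw [u₀ g] at this
    have h2 := mul_left_cancel₀ hp this
    rw [mul_zero, sub_zero] at h2
    exact mul_right_cancel₀ (hu g) (by rw [one_mul]; exact h2.symm)
  have du := (h.hasFrameDeriv_adjointInv_two (b 2)).congr (f₀' := fun g ↦ -p *
    b.repr (adjointInv g (b 2)) 2) (f₁' := fun _ ↦ 0) (f₂' := fun _ ↦ 0) (fun _ ↦ rfl)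
    (fun g ↦ by ring) (fun g ↦ by ring) (fun g ↦ by simp [u₀])
  have dw := (h.hasFrameDeriv_adjointInv_two (b 0)).congr (f₀' := fun g ↦ -p *
    b.repr (adjointInv g (b 0)) 2) (f₁' := fun _ ↦ 0) (f₂' := fun _ ↦ p) (fun _ ↦ rfl)
    (fun g ↦ by ring) (fun g ↦ by ring) (fun g ↦ by simp [hc])
  refine h.mem_symmetrySet_of_rank_one_aux hp du dw hu ?_ ?_ <;> simp [repr_adjointInv_one]

theorem IsAdapted.mem_symmetrySet_of_conformal_aux (h : IsAdapted b p (-k) k p) (hp : p ≠ 0)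
    {u v h₁ h₂ : G → ℝ}
    (du : HasFrameDeriv b u (fun g ↦ -(p * u g - k * v g)) (fun _ ↦ 0) (fun _ ↦ 0))
    (dv : HasFrameDeriv b v (fun g ↦ -(k * u g + p * v g)) (fun _ ↦ 0) (fun _ ↦ 0))
    (dh₁ : HasFrameDeriv b h₁ (fun g ↦ -(p * h₁ g - k * h₂ g)) (fun _ ↦ p) (fun _ ↦ -k))
    (dh₂ : HasFrameDeriv b h₂ (fun g ↦ -(k * h₁ g + p * h₂ g)) (fun _ ↦ k) (fun _ ↦ p))
    (hn : ∀ g, u g * u g + v g * v g ≠ 0)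
    (u₁ : u 1 = 1) (v₁ : v 1 = 0) (h₁₁ : h₁ 1 = 0) (h₂₁ : h₂ 1 = 0) (i : Fin 3) :
    b i ∈ symmetrySet (leftInvariantMetric b) (1 : G) := by
  have hm : p ^ 2 + k ^ 2 ≠ 0 := by positivity
  have dn := ((du.mul du).add (dv.mul dv)).congr
    (f₀' := fun g ↦ -2 * p * (u g * u g + v g * v g)) (f₁' := fun _ ↦ 0) (f₂' := fun _ ↦ 0)
    (fun _ ↦ rfl) (fun g ↦ by ring) (fun g ↦ by ring) (fun g ↦ by ring)
  have dN := dn.inv hn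
  obtain ⟨q, q', dq, dq', hq, hq', q₁, q'₁⟩ : ∃ q q' : G → ℝ,
      HasFrameDeriv b q (fun g ↦ p * q g - k * q' g) (fun _ ↦ 0) (fun _ ↦ 0) ∧
      HasFrameDeriv b q' (fun g ↦ k * q g + p * q' g) (fun _ ↦ 0) (fun _ ↦ 0) ∧
      (∀ g, q g * u g - q' g * v g = 1) ∧ (∀ g, q g * v g + q' g * u g = 0) ∧
      q 1 = 1 ∧ q' 1 = 0 := by
    refine ⟨_, _, (du.mul dN).congr (fun _ ↦ rfl) ?_ ?_ ?_, (dv.neg.mul dN).congr (fun _ ↦ rfl)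
      ?_ ?_ ?_, ?_, ?_, ?_, ?_⟩
    · intro g
      have := hn g
      field_simp
      ring
    · intro g; ring
    · intro g; ring
    · intro g
      have := hn g
      field_simp
      ring
    · intro g; ring
    · intro g; ring
    · intro g
      linear_combination mul_inv_cancel₀ (hn g)
    · intro g
      ring
    · simp [u₁, v₁]
    · simp [v₁]
  have dQ₁ := (dq.mul dh₁).sub (dq'.mul dh₂)
  have dQ₂ := (dq.mul dh₂).add (dq'.mul dh₁)
  obtain ⟨y, y', dy, dy', y₁, y'₁⟩ : ∃ y y' : G → ℝ,
      HasFrameDeriv b y (fun _ ↦ 0) q (fun g ↦ -q' g) ∧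
      HasFrameDeriv b y' (fun _ ↦ 0) q' q ∧ y 1 = 0 ∧ y' 1 = 0 := by
    refine ⟨_, _, (((dQ₁.const_mul p).add (dQ₂.const_mul k)).const_mul (p ^ 2 + k ^ 2)⁻¹).congr
      (fun _ ↦ rfl) ?_ ?_ ?_, (((dQ₂.const_mul p).sub (dQ₁.const_mul k)).const_mul
      (p ^ 2 + k ^ 2)⁻¹).congr (fun _ ↦ rfl) ?_ ?_ ?_, ?_, ?_⟩
    · intro g; ring
    · intro g; field_simp; ring
    · intro g; field_simp; ring
    · intro g; ring
    · intro g; field_simp; ring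
    · intro g; field_simp; ring
    · simp [h₁₁, h₂₁]
    · simp [h₁₁, h₂₁]
  have dS₁ := ((dy.mul dy).sub (dy'.mul dy')).const_mul (1 / 2)
  have dS₂ := dy.mul dy'
  have dT₁ := ((du.mul dS₁).sub (dv.mul dS₂)).congr
    (f₀' := fun g ↦ -(p * (u g * (1 / 2 * (y g * y g - y' g * y' g)) - v g * (y g * y' g)) -
      k * (u g * (y g * y' g) + v g * (1 / 2 * (y g * y g - y' g * y' g)))))
    (f₁' := y) (f₂' := fun g ↦ -y' g) (fun _ ↦ rfl)
    (fun g ↦ by ring)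
    (fun g ↦ by linear_combination (-y g) * hq g + y' g * hq' g)
    (fun g ↦ by linear_combination y' g * hq g + y g * hq' g)
  have dT₂ := ((du.mul dS₂).add (dv.mul dS₁)).congr
    (f₀' := fun g ↦ -(k * (u g * (1 / 2 * (y g * y g - y' g * y' g)) - v g * (y g * y' g)) +
      p * (u g * (y g * y' g) + v g * (1 / 2 * (y g * y g - y' g * y' g)))))
    (f₁' := y') (f₂' := y) (fun _ ↦ rfl)
    (fun g ↦ by ring)
    (fun g ↦ by linear_combination (-y' g) * hq g - y g * hq' g)
    (fun g ↦ by linear_combination (-y g) * hq g + y' g * hq' g)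
  have e : ∀ w : GroupLieAlgebra I G, (-p) • ((-1 / p) • w) = w := by
    intro w
    rw [smul_smul, show -p * (-1 / p) = 1 by field_simp, one_smul]
  fin_cases i
  · refine h.mem_symmetrySet (HasFrameDeriv.const b 1)
      (((dh₁.const_mul p).add (dh₂.const_mul k)).const_mul (p * (p ^ 2 + k ^ 2)⁻¹))
      (((dh₂.const_mul p).sub (dh₁.const_mul k)).const_mul (p * (p ^ 2 + k ^ 2)⁻¹))
      ?_ ?_ ?_ ?_ ?_ ?_ ?_ ?_ ?_ ?_ ?_ ?_
    · intro g; ring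
    · intro g; field_simp; try ring
    · intro g; field_simp; try ring
    · intro g; field_simp; try ring
    · intro g; field_simp; try ring
    · intro g; ring
    all_goals simp [h₁₁, h₂₁]
    exact Or.inr (by ring)
  · change b 1 ∈ _
    have hm : (-1 / p) • b 1 ∈ symmetrySet (leftInvariantMetric b) (1 : G) := by
      refine h.mem_symmetrySet dy
        ((dT₁.const_mul p).sub ((dq.add du).const_mul (1 / (2 * p))))
        ((dT₂.const_mul p).sub ((dv.sub dq').const_mul (1 / (2 * p))))
        ?_ ?_ ?_ ?_ ?_ ?_ ?_ ?_ ?_ ?_ ?_ ?_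
      · intro g; ring
      · intro g; ring
      · intro g; ring
      · intro g; field_simp; ring
      · intro g; field_simp; ring
      · intro g; ring
      all_goals simp [u₁, v₁, q₁, q'₁, y₁, y'₁]
      all_goals field_simp
      all_goals try ring
    rw [← e (b 1)]
    exact symmetrySet_smul (-p) hm
  · change b 2 ∈ _
    have hm : (-1 / p) • b 2 ∈ symmetrySet (leftInvariantMetric b) (1 : G) := by
      refine h.mem_symmetrySet dy'
        ((dT₂.const_mul p).add ((dv.sub dq').const_mul (1 / (2 * p))))
        ((dT₁.const_mul (-p)).sub ((dq.add du).const_mul (1 / (2 * p))))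
        ?_ ?_ ?_ ?_ ?_ ?_ ?_ ?_ ?_ ?_ ?_ ?_
      · intro g; ring
      · intro g; ring
      · intro g; ring
      · intro g; field_simp; ring
      · intro g; field_simp; ring
      · intro g; ring
      all_goals simp [u₁, v₁, q₁, q'₁, y₁, y'₁]
      all_goals field_simp
      all_goals try ring
    rw [← e (b 2)]
    exact symmetrySet_smul (-p) hm

theorem IsAdapted.mem_symmetrySet_of_conformal (h : IsAdapted b p (-k) k p) (hp : p ≠ 0)
    (i : Fin 3) : b i ∈ symmetrySet (leftInvariantMetric b) (1 : G) := by
  have hm : 0 < p ^ 2 + k ^ 2 := by positivity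
  have hadd : ∀ (g : G) (x y : GroupLieAlgebra I G),
      adjointInv g (x + y) = adjointInv g x + adjointInv g y := fun g x y ↦
    map_add (mfderiv I I (fun x : G ↦ g⁻¹ * x * g) 1) x y
  have hsmul : ∀ (g : G) (c : ℝ) (x : GroupLieAlgebra I G),
      adjointInv g (c • x) = c • adjointInv g x := fun g c x ↦
    map_smul (mfderiv I I (fun x : G ↦ g⁻¹ * x * g) 1) c x
  have e₁ : ∀ g : G, (p ^ 2 + k ^ 2) • adjointInv g (b 1) =
      p • ⁅adjointInv g (b 0), adjointInv g (b 1)⁆ -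
        k • ⁅adjointInv g (b 0), adjointInv g (b 2)⁆ := by
    intro g
    simp only [← adjointInv_lie, h.lie01, h.lie02, hadd, hsmul]
    module
  have u₀ : ∀ g : G, b.repr (adjointInv g (b 1)) 0 = 0 := by
    intro g
    have h1 := congrArg (fun x ↦ b.repr x 0) (e₁ g)
    simp only [map_sub, map_smul, Finsupp.sub_apply, Finsupp.smul_apply, smul_eq_mul,
      (h.repr_lie_zero _ _).1, mul_zero, sub_zero] at h1
    exact (mul_eq_zero.1 h1).resolve_left hm.ne'
  have hn : ∀ g : G, b.repr (adjointInv g (b 1)) 1 * b.repr (adjointInv g (b 1)) 1 +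
      b.repr (adjointInv g (b 1)) 2 * b.repr (adjointInv g (b 1)) 2 ≠ 0 := by
    intro g h0
    refine b.ne_zero 1 (adjointInv_injective g (b.ext_elem fun i ↦ ?_))
    rw [map_zero]
    have h1 := mul_self_nonneg (b.repr (adjointInv g (b 1)) 1)
    have h2 := mul_self_nonneg (b.repr (adjointInv g (b 1)) 2)
    have h3 : b.repr (adjointInv g (b 1)) 1 = 0 := mul_self_eq_zero.1 (by linarith)
    have h4 : b.repr (adjointInv g (b 1)) 2 = 0 := mul_self_eq_zero.1 (by linarith)
    fin_cases i
    exacts [u₀ g, h3, h4]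
  have hc : ∀ g : G, b.repr (adjointInv g (b 0)) 0 ≠ 0 := by
    intro g h0
    have h1 : adjointInv g ⁅b 0, b 1⁆ = 0 := by
      rw [adjointInv_lie]
      have h2 := h.repr_lie_zero (adjointInv g (b 0)) (adjointInv g (b 1))
      simp only [h0, u₀ g, zero_mul, mul_zero, sub_zero, add_zero] at h2
      refine b.ext_elem fun i ↦ ?_
      rw [show b.repr 0 = 0 from map_zero _]
      fin_cases i
      exacts [h2.1, h2.2.1, h2.2.2]
    have h2 := congrArg (fun x ↦ b.repr x 1) (adjointInv_injective g h1)
    rw [h.lie01] at h2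
    simp at h2
    exact hp h2
  have du := (h.hasFrameDeriv_adjointInv_one (b 1)).congr
    (f₀' := fun g ↦ -(p * b.repr (adjointInv g (b 1)) 1 - k * b.repr (adjointInv g (b 1)) 2))
    (f₁' := fun _ ↦ 0) (f₂' := fun _ ↦ 0) (fun _ ↦ rfl) (fun g ↦ by ring)
    (fun g ↦ by simp [u₀]) (fun g ↦ by simp [u₀])
  have dv := (h.hasFrameDeriv_adjointInv_two (b 1)).congr
    (f₀' := fun g ↦ -(k * b.repr (adjointInv g (b 1)) 1 + p * b.repr (adjointInv g (b 1)) 2))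
    (f₁' := fun _ ↦ 0) (f₂' := fun _ ↦ 0) (fun _ ↦ rfl) (fun g ↦ by ring)
    (fun g ↦ by simp [u₀]) (fun g ↦ by simp [u₀])
  have dc := (h.hasFrameDeriv_adjointInv_zero (b 0)).inv hc
  have dh₁ := ((h.hasFrameDeriv_adjointInv_one (b 0)).mul dc).congr
    (f₀' := fun g ↦ -(p * (b.repr (adjointInv g (b 0)) 1 * (b.repr (adjointInv g (b 0)) 0)⁻¹) -
      k * (b.repr (adjointInv g (b 0)) 2 * (b.repr (adjointInv g (b 0)) 0)⁻¹)))
    (f₁' := fun _ ↦ p) (f₂' := fun _ ↦ -k) (fun _ ↦ rfl) (fun g ↦ by ring)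
    (fun g ↦ by linear_combination (-p) * mul_inv_cancel₀ (hc g))
    (fun g ↦ by linear_combination k * mul_inv_cancel₀ (hc g))
  have dh₂ := ((h.hasFrameDeriv_adjointInv_two (b 0)).mul dc).congr
    (f₀' := fun g ↦ -(k * (b.repr (adjointInv g (b 0)) 1 * (b.repr (adjointInv g (b 0)) 0)⁻¹) +
      p * (b.repr (adjointInv g (b 0)) 2 * (b.repr (adjointInv g (b 0)) 0)⁻¹)))
    (f₁' := fun _ ↦ k) (f₂' := fun _ ↦ p) (fun _ ↦ rfl) (fun g ↦ by ring)
    (fun g ↦ by linear_combination (-k) * mul_inv_cancel₀ (hc g))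
    (fun g ↦ by linear_combination (-p) * mul_inv_cancel₀ (hc g))
  refine h.mem_symmetrySet_of_conformal_aux hp du dv dh₁ dh₂ hn ?_ ?_ ?_ ?_ i <;>
    simp [repr_adjointInv_one]

end Fields

section Obstruction

variable {E : Type*} [NormedAddCommGroup E] [NormedSpace ℝ E] [FiniteDimensional ℝ E]
  [CompleteSpace E]
  {H : Type*} [TopologicalSpace H] {I : ModelWithCorners ℝ E H}
  {G : Type*} [TopologicalSpace G] [ChartedSpace H G] [Group G] [LieGroup I ∞ G]
  {b : Module.Basis (Fin 3) ℝ (GroupLieAlgebra I G)} {α β γ δ : ℝ}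

theorem HasFrameDeriv.of_contMDiff (b : Module.Basis (Fin 3) ℝ (GroupLieAlgebra I G)) {f : G → ℝ}
    (hf : ContMDiff I 𝓘(ℝ) ∞ f) :
    HasFrameDeriv b f (frameDeriv b 0 f) (frameDeriv b 1 f) (frameDeriv b 2 f) :=
  ⟨hf, fun _ ↦ rfl, fun _ ↦ rfl, fun _ ↦ rfl⟩

theorem HasFrameDeriv.eq_zero {f f₀ f₁ f₂ : G → ℝ} (hf : HasFrameDeriv b f f₀ f₁ f₂)
    (h : ∀ p, f p = 0) (p : G) : f₀ p = 0 ∧ f₁ p = 0 ∧ f₂ p = 0 := by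
  rw [funext h] at hf
  rw [← hf.deriv₀, ← hf.deriv₁, ← hf.deriv₂]
  exact ⟨frameDeriv_const b 0 0 p, frameDeriv_const b 1 0 p, frameDeriv_const b 2 0 p⟩

theorem IsAdapted.commutator (h : IsAdapted b α β γ δ)
    {f f₀ f₁ f₂ f₀₁ f₀₂ f₁₀ f₁₂ f₂₀ f₂₁ g₀ g₁ g₂ : G → ℝ} (hf : HasFrameDeriv b f f₀ f₁ f₂)
    (hf₀ : HasFrameDeriv b f₀ g₀ f₁₀ f₂₀) (hf₁ : HasFrameDeriv b f₁ f₀₁ g₁ f₂₁)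
    (hf₂ : HasFrameDeriv b f₂ f₀₂ f₁₂ g₂) (p : G) :
    f₀₁ p - f₁₀ p = α * f₁ p + γ * f₂ p ∧ f₀₂ p - f₂₀ p = β * f₁ p + δ * f₂ p ∧
      f₁₂ p = f₂₁ p := by
  have h01 := h.frameDeriv_commutator01 hf.contMDiff p
  have h02 := h.frameDeriv_commutator02 hf.contMDiff p
  have h12 := h.frameDeriv_commutator12 hf.contMDiff p
  rw [funext hf.deriv₀, funext hf.deriv₁, funext hf.deriv₂] at *
  rw [hf₀.deriv₁, hf₁.deriv₀] at h01
  rw [hf₀.deriv₂, hf₂.deriv₀] at h02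
  rw [hf₂.deriv₁, hf₁.deriv₂] at h12
  exact ⟨h01, h02, h12⟩

/-- The integrability conditions of the Killing equation. -/
theorem IsAdapted.eq_zero_of_mem_symmetrySet {p₁ p₂ k : ℝ} (h : IsAdapted b p₁ (-k) k p₂)
    (hd : p₁ ≠ p₂) {x : GroupLieAlgebra I G}
    (hx : x ∈ symmetrySet (leftInvariantMetric b) (1 : G)) :
    k * b.repr x 0 = 0 ∧ p₁ * (k * b.repr x 1 + p₂ * b.repr x 2) = 0 ∧
      p₂ * (p₁ * b.repr x 1 - k * b.repr x 2) = 0 := by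
  obtain ⟨F₀, F₁, F₂, s₀, s₁, s₂, e₀₀, e₁₁, e₂₂, e₀₁, e₀₂, e₂₁, z₁, z₂, z₁₂, x₀, x₁, x₂⟩ :=
    h.exists_of_mem_symmetrySet hx
  rw [x₀, x₁, x₂]
  set B := frameDeriv b 1 F₀ with hB
  set C := frameDeriv b 2 F₀ with hC
  set W := frameDeriv b 1 F₂ with hW
  have dB := HasFrameDeriv.of_contMDiff b (contMDiff_frameDeriv b 1 s₀)
  have dC := HasFrameDeriv.of_contMDiff b (contMDiff_frameDeriv b 2 s₀)
  have dW := HasFrameDeriv.of_contMDiff b (contMDiff_frameDeriv b 1 s₂)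
  rw [← hB] at dB
  rw [← hC] at dC
  rw [← hW] at dW
  have d₀ : HasFrameDeriv b F₀ (fun _ ↦ 0) B C := ⟨s₀, e₀₀, fun _ ↦ rfl, fun _ ↦ rfl⟩
  have d₁ : HasFrameDeriv b F₁ (fun p ↦ -B p - (p₁ * F₁ p + -k * F₂ p)) (fun p ↦ p₁ * F₀ p)
      (fun p ↦ -W p) := ⟨s₁, e₀₁, e₁₁, fun p ↦ by rw [e₂₁ p]; ring⟩
  have d₂ : HasFrameDeriv b F₂ (fun p ↦ -C p - (k * F₁ p + p₂ * F₂ p)) W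
      (fun p ↦ p₂ * F₀ p) := ⟨s₂, e₀₂, fun _ ↦ rfl, e₂₂⟩
  have c₀ := h.commutator d₀ (HasFrameDeriv.const b 0) dB dC
  have c₁ := h.commutator d₁ (dB.neg.sub ((d₁.const_mul p₁).add (d₂.const_mul (-k))))
    (d₀.const_mul p₁) dW.neg
  have c₂ := h.commutator d₂ (dC.neg.sub ((d₁.const_mul k).add (d₂.const_mul p₂)))
    dW (d₀.const_mul p₂)
  have dA := ((d₀.const_mul k).sub dW).congr (f' := fun p ↦ k * F₀ p - W p) (f₀' := fun _ ↦ 0)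
    (f₁' := fun p ↦ k * B p + p₁ * C p) (f₂' := fun p ↦ k * C p - p₂ * B p) (fun _ ↦ rfl)
    (fun p ↦ by
      obtain ⟨c01, c02, c03⟩ := c₀ p
      obtain ⟨c11, c12, c13⟩ := c₁ p
      obtain ⟨c21, c22, c23⟩ := c₂ p
      linarith) (fun p ↦ by
      obtain ⟨c01, c02, c03⟩ := c₀ p
      obtain ⟨c11, c12, c13⟩ := c₁ p
      obtain ⟨c21, c22, c23⟩ := c₂ p
      linarith) (fun p ↦ by
      obtain ⟨c01, c02, c03⟩ := c₀ p
      obtain ⟨c11, c12, c13⟩ := c₁ p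
      obtain ⟨c21, c22, c23⟩ := c₂ p
      linarith)
  set A := fun p ↦ k * F₀ p - W p with hA
  have dB' := dB.congr (f' := B) (f₀' := fun p ↦ p₁ * B p + k * C p) (f₁' := fun _ ↦ 0)
    (f₂' := fun p ↦ -((p₁ - p₂) * A p)) (fun _ ↦ rfl)
    (fun p ↦ by
      obtain ⟨c01, c02, c03⟩ := c₀ p
      linarith) (fun p ↦ by
      obtain ⟨c11, c12, c13⟩ := c₁ p
      linarith) (fun p ↦ by
      obtain ⟨c01, c02, c03⟩ := c₀ p
      obtain ⟨c11, c12, c13⟩ := c₁ p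
      obtain ⟨c21, c22, c23⟩ := c₂ p
      simp only [hA]
      linarith)
  have dC' := dC.congr (f' := C) (f₀' := fun p ↦ p₂ * C p - k * B p)
    (f₁' := fun p ↦ -((p₁ - p₂) * A p)) (f₂' := fun _ ↦ 0) (fun _ ↦ rfl)
    (fun p ↦ by
      obtain ⟨c01, c02, c03⟩ := c₀ p
      linarith) (fun p ↦ by
      obtain ⟨c01, c02, c03⟩ := c₀ p
      obtain ⟨c11, c12, c13⟩ := c₁ p
      obtain ⟨c21, c22, c23⟩ := c₂ p
      simp only [hA]
      linarith) (fun p ↦ by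
      obtain ⟨c21, c22, c23⟩ := c₂ p
      linarith)
  have c₃ := h.commutator dA (HasFrameDeriv.const b 0) ((dB'.const_mul k).add (dC'.const_mul p₁))
    ((dC'.const_mul k).sub (dB'.const_mul p₂))
  have hd' : p₁ - p₂ ≠ 0 := sub_ne_zero.2 hd
  have r₁ : ∀ p, k * B p + p₁ * C p = 0 := fun p ↦ by
    refine (mul_eq_zero.1 (?_ : (p₁ - p₂) * _ = 0)).resolve_left hd'
    linear_combination -(c₃ p).1
  have r₂ : ∀ p, k * C p - p₂ * B p = 0 := fun p ↦ by
    refine (mul_eq_zero.1 (?_ : (p₁ - p₂) * _ = 0)).resolve_left hd'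
    linear_combination (c₃ p).2.1
  have t₁ := ((dB'.const_mul k).add (dC'.const_mul p₁)).eq_zero r₁ 1
  have t₂ := ((dC'.const_mul k).sub (dB'.const_mul p₂)).eq_zero r₂ 1
  have hA0 : A 1 = 0 := by
    have q₁ : (p₁ - p₂) * (p₁ * A 1) = 0 := by linear_combination -t₁.2.1
    have q₂ : (p₁ - p₂) * (p₂ * A 1) = 0 := by linear_combination t₂.2.2
    have q₃ : (p₁ - p₂) * ((p₁ - p₂) * A 1) = 0 := by linear_combination q₁ - q₂
    exact (mul_eq_zero.1 ((mul_eq_zero.1 q₃).resolve_left hd')).resolve_left hd'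
  have hr₁ := r₁ 1
  have hr₂ := r₂ 1
  simp only [hA] at hA0
  refine ⟨?_, ?_, ?_⟩
  · linear_combination hA0 + z₁₂
  · linear_combination -hr₁ + k * z₁ + p₁ * z₂
  · linear_combination hr₂ - k * z₂ + p₂ * z₁

end Obstruction

section Orthonormal

variable {𝔤 : Type*} [LieRing 𝔤] [LieAlgebra ℝ 𝔤]

theorem IsAdapted.exists_change_general {b : Module.Basis (Fin 3) ℝ 𝔤} {α β γ δ : ℝ}
    (h : IsAdapted b α β γ δ) (p q r x y x' y' : ℝ) (hd : p * (x * y' - x' * y) ≠ 0) :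
    ∃ (b' : Module.Basis (Fin 3) ℝ 𝔤) (α' β' γ' δ' : ℝ), IsAdapted b' α' β' γ' δ' ∧
      b' 0 = p • b 0 + q • b 1 + r • b 2 ∧ b' 1 = x • b 1 + y • b 2 ∧
      b' 2 = x' • b 1 + y' • b 2 := by
  obtain ⟨b', h₀, h₁, h₂⟩ := exists_basis_fin_three b p q r x y x' y' hd
  have hD : x * y' - x' * y ≠ 0 := right_ne_zero_of_mul hd
  set D := x * y' - x' * y with hDdef
  refine ⟨b', (p * (α * x + β * y) * y' - p * (γ * x + δ * y) * x') / D,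
    (p * (α * x' + β * y') * y' - p * (γ * x' + δ * y') * x') / D,
    (x * (p * (γ * x + δ * y)) - y * (p * (α * x + β * y))) / D,
    (x * (p * (γ * x' + δ * y')) - y * (p * (α * x' + β * y'))) / D,
    h.change h₀ h₁ h₂ ?_ ?_ ?_ ?_, h₀, h₁, h₂⟩
  · field_simp
    rw [hDdef]
    ring
  · field_simp
    rw [hDdef]
    ring
  · field_simp
    rw [hDdef]
    ring
  · field_simp
    rw [hDdef]
    ring

theorem exists_diagonalizing_rotation (s d : ℝ) :
    ∃ x y : ℝ, x * x + y * y = 1 ∧ s * (x * x - y * y) + d * (x * y) = 0 := by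
  by_cases hs : s = 0
  · exact ⟨1, 0, by norm_num, by simp [hs]⟩
  set R := √(d ^ 2 + 4 * s ^ 2) with hR
  have hR2 : R * R = d ^ 2 + 4 * s ^ 2 := Real.mul_self_sqrt (by positivity)
  have hN : 0 < (2 * s) ^ 2 + (d + R) ^ 2 := by positivity
  set N := √((2 * s) ^ 2 + (d + R) ^ 2) with hNdef
  have hN2 : N * N = (2 * s) ^ 2 + (d + R) ^ 2 := Real.mul_self_sqrt hN.le
  have hN0 : N ≠ 0 := (Real.sqrt_pos.2 hN).ne'
  refine ⟨2 * s / N, (d + R) / N, ?_, ?_⟩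
  · field_simp
    linear_combination -hN2
  · field_simp
    linear_combination (-s) * hR2

theorem IsAdapted.exists_orthonormal {b : Module.Basis (Fin 3) ℝ 𝔤} {α β γ δ : ℝ}
    (h : IsAdapted b α β γ δ) (Q : LinearMap.BilinForm ℝ 𝔤) (hsymm : ∀ x y, Q x y = Q y x)
    (hpos : ∀ x, x ≠ 0 → 0 < Q x x) :
    ∃ (b' : Module.Basis (Fin 3) ℝ 𝔤) (p₁ p₂ k : ℝ), IsAdapted b' p₁ (-k) k p₂ ∧
      ∀ i j, Q (b' i) (b' j) = if i = j then 1 else 0 := by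
  have hb := fun (b : Module.Basis (Fin 3) ℝ 𝔤) i ↦ hpos (b i) (b.ne_zero i)
  obtain ⟨e, α₁, β₁, γ₁, δ₁, he, e0, e1, e2⟩ := h.exists_change_general 1 0 0 1 0
    (-(Q (b 1) (b 2) / Q (b 1) (b 1))) 1 (by norm_num)
  have q12 : Q (e 1) (e 2) = 0 := by
    have := (hb b 1).ne'
    rw [e1, e2]
    simp only [map_add, map_smul, LinearMap.add_apply, LinearMap.smul_apply, smul_eq_mul]
    field_simp
    ring
  obtain ⟨f, α₂, β₂, γ₂, δ₂, hf, f0, f1, f2⟩ := he.exists_change_general 1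
    (-(Q (e 0) (e 1) / Q (e 1) (e 1))) (-(Q (e 0) (e 2) / Q (e 2) (e 2))) 1 0 0 1 (by norm_num)
  have r12 : Q (f 1) (f 2) = 0 := by
    rw [f1, f2]
    simp [q12]
  have r01 : Q (f 0) (f 1) = 0 := by
    have := (hb e 1).ne'
    rw [f0, f1]
    simp only [map_add, map_smul, LinearMap.add_apply, LinearMap.smul_apply, smul_eq_mul, hsymm (e 2) (e 1), q12]
    field_simp
    ring
  have r02 : Q (f 0) (f 2) = 0 := by
    have := (hb e 2).ne'
    rw [f0, f2]
    simp only [map_add, map_smul, LinearMap.add_apply, LinearMap.smul_apply, smul_eq_mul, q12]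
    field_simp
    ring
  have hsq : ∀ i, √(Q (f i) (f i)) ≠ 0 := fun i ↦ (Real.sqrt_pos.2 (hb f i)).ne'
  have hsq2 : ∀ i, √(Q (f i) (f i)) * √(Q (f i) (f i)) = Q (f i) (f i) :=
    fun i ↦ Real.mul_self_sqrt (hb f i).le
  obtain ⟨u, α₃, β₃, γ₃, δ₃, hu, u0, u1, u2⟩ := hf.exists_change_general (√(Q (f 0) (f 0)))⁻¹ 0 0
    (√(Q (f 1) (f 1)))⁻¹ 0 0 (√(Q (f 2) (f 2)))⁻¹ (by
      simp only [mul_zero, sub_zero]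
      exact mul_ne_zero (inv_ne_zero (hsq 0)) (mul_ne_zero (inv_ne_zero (hsq 1))
        (inv_ne_zero (hsq 2))))
  simp only [zero_smul, add_zero, zero_add] at u0 u1 u2
  have hone : ∀ i, (√(Q (f i) (f i)))⁻¹ * ((√(Q (f i) (f i)))⁻¹ * Q (f i) (f i)) = 1 := by
    intro i
    have h1 := hsq i
    rw [← mul_assoc, ← mul_inv, hsq2]
    exact inv_mul_cancel₀ (hb f i).ne'
  have s00 : Q (u 0) (u 0) = 1 := by
    rw [u0]
    simpa only [map_smul, LinearMap.smul_apply, smul_eq_mul] using hone 0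
  have s11 : Q (u 1) (u 1) = 1 := by
    rw [u1]
    simpa only [map_smul, LinearMap.smul_apply, smul_eq_mul] using hone 1
  have s22 : Q (u 2) (u 2) = 1 := by
    rw [u2]
    simpa only [map_smul, LinearMap.smul_apply, smul_eq_mul] using hone 2
  have s01 : Q (u 0) (u 1) = 0 := by
    rw [u0, u1]
    simp only [map_smul, LinearMap.smul_apply, smul_eq_mul, r01, mul_zero]
  have s02 : Q (u 0) (u 2) = 0 := by
    rw [u0, u2]
    simp only [map_smul, LinearMap.smul_apply, smul_eq_mul, r02, mul_zero]
  have s12 : Q (u 1) (u 2) = 0 := by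
    rw [u1, u2]
    simp only [map_smul, LinearMap.smul_apply, smul_eq_mul, r12, mul_zero]
  have s10 := (hsymm (u 1) (u 0)).trans s01
  have s20 := (hsymm (u 2) (u 0)).trans s02
  have s21 := (hsymm (u 2) (u 1)).trans s12
  obtain ⟨x, y, hxy, hrot⟩ := exists_diagonalizing_rotation ((β₃ + γ₃) / 2) (δ₃ - α₃)
  obtain ⟨v, v0, v1, v2⟩ := exists_basis_fin_three u 1 0 0 x y (-y) x (by
    intro h0
    linarith)
  refine ⟨v, x * (α₃ * x + β₃ * y) + y * (γ₃ * x + δ₃ * y),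
    -y * (-α₃ * y + β₃ * x) + x * (-γ₃ * y + δ₃ * x),
    -y * (α₃ * x + β₃ * y) + x * (γ₃ * x + δ₃ * y),
    hu.change v0 v1 v2 ?_ ?_ ?_ ?_, ?_⟩
  · linear_combination (-(α₃ * x + β₃ * y)) * hxy
  · linear_combination (-(γ₃ * x + δ₃ * y)) * hxy
  · linear_combination (-(-α₃ * y + β₃ * x)) * hxy + (2 * x) * hrot
  · linear_combination (-(-γ₃ * y + δ₃ * x)) * hxy + (2 * y) * hrot
  · simp only [one_smul, zero_smul, add_zero] at v0
    have w00 : Q (v 0) (v 0) = 1 := by rw [v0, s00]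
    have w01 : Q (v 0) (v 1) = 0 := by
      rw [v0, v1]
      simp [s01, s02]
    have w02 : Q (v 0) (v 2) = 0 := by
      rw [v0, v2]
      simp [s01, s02]
    have w11 : Q (v 1) (v 1) = 1 := by
      rw [v1]
      simp only [map_add, map_smul, LinearMap.add_apply, LinearMap.smul_apply, smul_eq_mul, s11, s12, s21, s22]
      linarith
    have w12 : Q (v 1) (v 2) = 0 := by
      rw [v1, v2]
      simp only [map_add, map_smul, LinearMap.add_apply, LinearMap.smul_apply, smul_eq_mul, s11, s12, s21, s22]
      ring
    have w22 : Q (v 2) (v 2) = 1 := by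
      rw [v2]
      simp only [map_add, map_smul, LinearMap.add_apply, LinearMap.smul_apply, smul_eq_mul, s11, s12, s21, s22]
      linarith
    have w10 := (hsymm (v 1) (v 0)).trans w01
    have w20 := (hsymm (v 2) (v 0)).trans w02
    have w21 := (hsymm (v 2) (v 1)).trans w12
    intro i j
    fin_cases i <;> fin_cases j <;> simp [w00, w01, w02, w10, w11, w12, w20, w21, w22]

end Orthonormal

section Index

variable {E : Type*} [NormedAddCommGroup E] [NormedSpace ℝ E] [FiniteDimensional ℝ E]
  {H : Type*} [TopologicalSpace H] {I : ModelWithCorners ℝ E H}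
  {G : Type*} [TopologicalSpace G] [ChartedSpace H G] [Group G] [LieGroup I ∞ G]

theorem indexOfSymmetry_pos {g : RiemMetric I G} {x : GroupLieAlgebra I G} (hx : x ≠ 0)
    (h : x ∈ symmetrySet g (1 : G)) : 0 < indexOfSymmetry g := by
  have : FiniteDimensional ℝ (TangentSpace I (1 : G)) := inferInstanceAs (FiniteDimensional ℝ E)
  rw [indexOfSymmetry, Module.finrank_pos_iff]
  refine ⟨⟨⟨x, Submodule.subset_span h⟩, 0, fun h0 ↦ hx ?_⟩⟩
  exact congrArg Subtype.val h0

theorem indexOfSymmetry_le_one {g : RiemMetric I G} (w : GroupLieAlgebra I G)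
    (h : ∀ x ∈ symmetrySet g (1 : G), ∃ c : ℝ, x = c • w) : indexOfSymmetry g ≤ 1 := by
  have : FiniteDimensional ℝ (TangentSpace I (1 : G)) := inferInstanceAs (FiniteDimensional ℝ E)
  have hle : symmetrySubspace g (1 : G) ≤ Submodule.span ℝ {(w : TangentSpace I (1 : G))} := by
    refine Submodule.span_le.2 fun x hx ↦ ?_
    obtain ⟨c, rfl⟩ := h x hx
    exact Submodule.smul_mem _ _ (Submodule.mem_span_singleton_self _)
  exact (Submodule.finrank_mono hle).trans
    ((finrank_span_le_card _).trans (by simp))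

theorem indexOfSymmetry_eq_finrank {ι : Type*} {g : RiemMetric I G}
    (b : Module.Basis ι ℝ (GroupLieAlgebra I G)) (h : ∀ i, b i ∈ symmetrySet g (1 : G)) :
    indexOfSymmetry g = Module.finrank ℝ (GroupLieAlgebra I G) := by
  have hs : symmetrySubspace g (1 : G) = ⊤ := by
    refine top_le_iff.1 ?_
    refine (b.span_eq.ge : (⊤ : Submodule ℝ (GroupLieAlgebra I G)) ≤ _).trans ?_
    refine Submodule.span_mono ?_
    rintro _ ⟨i, rfl⟩
    exact h i
  rw [indexOfSymmetry, hs]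
  exact finrank_top ℝ (GroupLieAlgebra I G)

theorem eq_leftInvariantMetric {ι : Type*} [Fintype ι] [DecidableEq ι] {g : RiemMetric I G}
    (hg : IsLeftInvariant g) (b : Module.Basis ι ℝ (GroupLieAlgebra I G))
    (hb : ∀ i j, g.inner 1 (b i) (b j) = if i = j then (1 : ℝ) else 0) :
    g = leftInvariantMetric b := by
  have key : ∀ p i j, g.inner p (mulInvariantVectorField (b i) p) (mulInvariantVectorField (b j) p)
      = if i = j then (1 : ℝ) else 0 := by
    intro p i j
    rw [← hb, ← hg p 1 (b i) (b j)]
    have e : p * 1 = p := mul_one p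
    simp only [mulInvariantVectorField]
    rw [e]
  have hin : g.inner = (leftInvariantMetric b).inner := by
    ext p u v
    rw [leftInvariantMetric_inner]
    conv_lhs => rw [← sum_coframe_smul b p u, ← sum_coframe_smul b p v]
    simp only [map_sum, map_smul, sum_apply, smul_apply, key]
    simp [mul_comm]
  obtain ⟨inner₁, _, _, _, _⟩ := g
  generalize leftInvariantMetric b = g' at hin
  obtain ⟨inner₂, _, _, _, _⟩ := g'
  cases hin
  rfl

variable [I.Boundaryless] [CompleteSpace E]

theorem IsAdapted.indexOfSymmetry_ne_two {b : Module.Basis (Fin 3) ℝ (GroupLieAlgebra I G)}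
    {p₁ p₂ k : ℝ} (h : IsAdapted b p₁ (-k) k p₂) (h0 : ¬(k = 0 ∧ p₂ = 0 ∧ p₁ ≠ 0)) :
    indexOfSymmetry (leftInvariantMetric b) ≠ 2 := by
  have h3 : Module.finrank ℝ (GroupLieAlgebra I G) = 3 := by
    rw [Module.finrank_eq_card_basis b, Fintype.card_fin]
  have hall : (∀ i, b i ∈ symmetrySet (leftInvariantMetric b) (1 : G)) →
      indexOfSymmetry (leftInvariantMetric b) ≠ 2 := by
    intro hi
    rw [indexOfSymmetry_eq_finrank b hi, h3]
    norm_num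
  have hline : ∀ w : GroupLieAlgebra I G,
      (∀ x ∈ symmetrySet (leftInvariantMetric b) (1 : G), ∃ c : ℝ, ∀ i, b.repr x i = c * b.repr w i) →
      indexOfSymmetry (leftInvariantMetric b) ≠ 2 := by
    intro w hw
    have := indexOfSymmetry_le_one (g := leftInvariantMetric b) w fun x hx ↦ by
      obtain ⟨c, hc⟩ := hw x hx
      refine ⟨c, b.ext_elem fun i ↦ (hc i).trans ?_⟩
      rw [map_smul]
      rfl
    omega
  by_cases hp : p₁ = p₂
  · subst hp
    by_cases hp : p₁ = 0
    · subst hp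
      exact hall h.mem_symmetrySet_of_skew
    · exact hall (h.mem_symmetrySet_of_conformal hp)
  have hS := fun x hx ↦ h.eq_zero_of_mem_symmetrySet hp (x := x) hx
  by_cases hk : k = 0
  · subst hk
    by_cases hp₁ : p₁ = 0
    · subst hp₁
      rw [neg_zero] at h
      exact hall (h.mem_symmetrySet_of_rank_one (Ne.symm hp))
    · have hp₂ : p₂ ≠ 0 := fun hp₂ ↦ h0 ⟨rfl, hp₂, hp₁⟩
      refine hline (b 0) fun x hx ↦ ⟨b.repr x 0, fun i ↦ ?_⟩
      obtain ⟨-, e₁, e₂⟩ := hS x hx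
      simp [hp₁, hp₂] at e₁ e₂
      fin_cases i <;> simp [e₁, e₂]
  · by_cases hp₁ : p₁ = 0
    · have hp₂ : p₂ ≠ 0 := fun hp₂ ↦ hp (hp₁.trans hp₂.symm)
      subst hp₁
      refine hline (b 1) fun x hx ↦ ⟨b.repr x 1, fun i ↦ ?_⟩
      obtain ⟨e₀, -, e₂⟩ := hS x hx
      simp [hk, hp₂] at e₀ e₂
      fin_cases i <;> simp [e₀, e₂]
    · refine hline (p₂ • b 1 + (-k) • b 2) fun x hx ↦ ⟨-(b.repr x 2 / k), fun i ↦ ?_⟩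
      obtain ⟨e₀, e₁, -⟩ := hS x hx
      have e₃ := (mul_eq_zero.1 e₁).resolve_left hp₁
      have e₄ := (mul_eq_zero.1 e₀).resolve_left hk
      fin_cases i
      · simp [e₄]
      · simp
        field_simp
        linarith
      · simp
        field_simp

end Index

theorem indexOfSymmetry_ne_two {G : Type*} [TopologicalSpace G]
    [ChartedSpace (EuclideanSpace ℝ (Fin 3)) G] [Group G] [LieGroup (𝓡 3) ∞ G]
    [LieAlgebra.IsSolvable (GroupLieAlgebra (𝓡 3) G)] (g : RiemMetric (𝓡 3) G)
    (hg : IsLeftInvariant g) : indexOfSymmetry g ≠ 2 := by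
  have h3 : Module.finrank ℝ (GroupLieAlgebra (𝓡 3) G) = 3 :=
    finrank_euclideanSpace_fin (𝕜 := ℝ) (n := 3)
  obtain ⟨b₀, _, _, _, _, h₀⟩ := exists_isAdapted h3
  let Q : LinearMap.BilinForm ℝ (GroupLieAlgebra (𝓡 3) G) :=
    LinearMap.mk₂ ℝ (fun u v ↦ g.inner 1 u v)
      (fun u u' v ↦ congrArg (fun T ↦ T v) (map_add (g.inner (1 : G)) u u'))
      (fun c u v ↦ congrArg (fun T ↦ T v) (map_smul (g.inner (1 : G)) c u))
      (fun u v v' ↦ map_add (g.inner (1 : G) u) v v')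
      (fun c u v ↦ map_smul (g.inner (1 : G) u) c v)
  obtain ⟨b, p₁, p₂, k, h, hb⟩ := h₀.exists_orthonormal Q (fun u v ↦ g.symm 1 u v)
    (fun u hu ↦ g.pos 1 u hu)
  by_cases hc : k = 0 ∧ p₂ = 0 ∧ p₁ ≠ 0
  · obtain ⟨rfl, rfl, hp₁⟩ := hc
    obtain ⟨b', e0, e1, e2⟩ := exists_basis_fin_three b 1 0 0 0 1 1 0 (by norm_num)
    have h' : IsAdapted b' 0 (-0) 0 p₁ := h.change e0 e1 e2 (by ring) (by ring) (by ring) (by ring)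
    simp only [one_smul, zero_smul, add_zero, zero_add] at e0 e1 e2
    rw [eq_leftInvariantMetric hg b' fun i j ↦ ?_]
    · exact h'.indexOfSymmetry_ne_two (by simp [hp₁])
    · have hb' : ∀ i j, g.inner 1 (b i) (b j) = if i = j then (1 : ℝ) else 0 := hb
      fin_cases i <;> fin_cases j <;> simp [e0, e1, e2, hb']
  · rw [eq_leftInvariantMetric hg b hb]
    exact h.indexOfSymmetry_ne_two hc

theorem exists_metric_pos_index {𝔤 : Type*} [LieRing 𝔤] [LieAlgebra ℝ 𝔤] [LieAlgebra.IsSolvable 𝔤]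
    (h3 : Module.finrank ℝ 𝔤 = 3) :
    ∃ b : Module.Basis (Fin 3) ℝ 𝔤, ∀ (G : Type*) [TopologicalSpace G]
      [ChartedSpace (EuclideanSpace ℝ (Fin 3)) G] [Group G] [LieGroup (𝓡 3) ∞ G]
      (φ : GroupLieAlgebra (𝓡 3) G ≃ₗ⁅ℝ⁆ 𝔤),
      0 < indexOfSymmetry (I := 𝓡 3) (G := G)
        (leftInvariantMetric (b.map φ.symm.toLinearEquiv)) := by
  obtain ⟨b₀, _, _, _, _, h₀⟩ := exists_isAdapted h3
  have hmap : ∀ {b : Module.Basis (Fin 3) ℝ 𝔤} {α β γ δ : ℝ}, IsAdapted b α β γ δ →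
      ∀ (G : Type _) [TopologicalSpace G]
      [ChartedSpace (EuclideanSpace ℝ (Fin 3)) G] [Group G] [LieGroup (𝓡 3) ∞ G]
      (φ : GroupLieAlgebra (𝓡 3) G ≃ₗ⁅ℝ⁆ 𝔤),
      IsAdapted (b.map φ.symm.toLinearEquiv) α β γ δ := by
    intro b α β γ δ h G _ _ _ _ φ
    have e : ∀ i, (b.map φ.symm.toLinearEquiv) i = φ.symm (b i) := fun _ ↦ rfl
    constructor
    · rw [e, e, e, ← LieEquiv.map_lie, h.lie01, map_add, map_smul, map_smul]
    · rw [e, e, e, ← LieEquiv.map_lie, h.lie02, map_add, map_smul, map_smul]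
    · rw [e, e, ← LieEquiv.map_lie, h.lie12, map_zero]
  rcases h₀.exists_normalForm with ⟨b, p, q, h⟩ | ⟨b, p, q, h⟩ | ⟨b, h⟩
  · exact ⟨b, fun G _ _ _ _ φ ↦ indexOfSymmetry_pos (Module.Basis.ne_zero _ _)
      (hmap h G φ).mem_symmetrySet_of_diagonal⟩
  · exact ⟨b, fun G _ _ _ _ φ ↦ indexOfSymmetry_pos (Module.Basis.ne_zero _ _)
      (hmap h G φ).mem_symmetrySet_of_complex⟩
  · exact ⟨b, fun G _ _ _ _ φ ↦ indexOfSymmetry_pos (Module.Basis.ne_zero _ _)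
      (hmap h G φ).mem_symmetrySet_of_heisenberg⟩

section ExpGroup

variable {E : Type*} [NormedAddCommGroup E] [NormedSpace ℝ E] [CompleteSpace E]

theorem apply_exp_smul_apply {ℓ : E →L[ℝ] ℝ} {A : E →L[ℝ] E} (hA : ∀ x, ℓ (A x) = 0) (t : ℝ)
    (x : E) : ℓ (NormedSpace.exp (t • A) x) = ℓ x := by
  have hd : ∀ s : ℝ, HasDerivAt (fun s : ℝ ↦ ℓ (NormedSpace.exp (s • A) x)) 0 s := fun s ↦ by
    have h := ℓ.hasFDerivAt.comp_hasDerivAt s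
      (((hasDerivAt_exp_smul_const' A s).clm_apply (hasDerivAt_const s x)))
    refine h.congr_deriv ?_
    simp [hA]
  have h := is_const_of_deriv_eq_zero (fun s ↦ (hd s).differentiableAt) (fun s ↦ (hd s).deriv) t 0
  simpa using h

theorem exp_add_smul_apply (A : E →L[ℝ] E) (s t : ℝ) (x : E) :
    NormedSpace.exp ((s + t) • A) x = NormedSpace.exp (s • A) (NormedSpace.exp (t • A) x) := by
  let := NormedAlgebra.restrictScalars ℚ ℝ (E →L[ℝ] E)
  rw [add_smul, NormedSpace.exp_add_of_commute (((Commute.refl A).smul_left s).smul_right t)]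
  rfl

theorem contDiff_exp_smul (A : E →L[ℝ] E) :
    ContDiff ℝ ∞ (fun t : ℝ ↦ NormedSpace.exp (t • A)) := by
  have h : ContDiff ℝ ∞ (NormedSpace.exp : (E →L[ℝ] E) → E →L[ℝ] E) :=
    contDiff_iff_contDiffAt.2 fun B ↦ (NormedSpace.exp_analytic (𝕂 := ℝ) B).contDiffAt
  exact h.comp (contDiff_id.smul contDiff_const)

/-- The semidirect product group law `x * y = x + exp (ℓ x • A) y` on `E`. -/
@[reducible] noncomputable def expGroup (ℓ : E →L[ℝ] ℝ) (A : E →L[ℝ] E) (hA : ∀ x, ℓ (A x) = 0) :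
    Group E where
  mul x y := x + NormedSpace.exp (ℓ x • A) y
  one := 0
  inv x := -NormedSpace.exp ((-ℓ x) • A) x
  mul_assoc x y z := by
    change x + NormedSpace.exp (ℓ x • A) y +
      NormedSpace.exp (ℓ (x + NormedSpace.exp (ℓ x • A) y) • A) z =
      x + NormedSpace.exp (ℓ x • A) (y + NormedSpace.exp (ℓ y • A) z)
    rw [map_add, map_add, apply_exp_smul_apply hA, exp_add_smul_apply, add_assoc]
  one_mul x := by
    change 0 + NormedSpace.exp (ℓ 0 • A) x = x
    simp
  mul_one x := by
    change x + NormedSpace.exp (ℓ x • A) 0 = x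
    simp
  inv_mul_cancel x := by
    change -NormedSpace.exp ((-ℓ x) • A) x +
      NormedSpace.exp (ℓ (-NormedSpace.exp ((-ℓ x) • A) x) • A) x = 0
    rw [map_neg, apply_exp_smul_apply hA, neg_add_cancel]

theorem lieGroup_expGroup (ℓ : E →L[ℝ] ℝ) (A : E →L[ℝ] E) (hA : ∀ x, ℓ (A x) = 0) :
    letI := expGroup ℓ A hA
    LieGroup 𝓘(ℝ, E) ∞ E := by
  let := expGroup ℓ A hA
  refine { contMDiff_mul := ?_, contMDiff_inv := ?_ }
  · have h : ContDiff ℝ ∞ (fun p : E × E ↦ p.1 + NormedSpace.exp (ℓ p.1 • A) p.2) :=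
      contDiff_fst.add
        (((contDiff_exp_smul A).comp (ℓ.contDiff.comp contDiff_fst)).clm_apply contDiff_snd)
    have h' := h.contMDiff
    rw [← modelWithCornersSelf_prod, chartedSpaceSelf_prod]
    exact h'
  · have h : ContDiff ℝ ∞ (fun x : E ↦ -NormedSpace.exp ((-ℓ x) • A) x) :=
      (((contDiff_exp_smul A).comp ℓ.contDiff.neg).clm_apply contDiff_id).neg
    exact h.contMDiff

theorem mulInvariantVectorField_expGroup (ℓ : E →L[ℝ] ℝ) (A : E →L[ℝ] E) (hA : ∀ x, ℓ (A x) = 0)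
    (v : E) :
    letI := expGroup ℓ A hA
    (mulInvariantVectorField (I := 𝓘(ℝ, E)) (G := E) v : E → E) =
      fun x ↦ NormedSpace.exp (ℓ x • A) v := by
  let := expGroup ℓ A hA
  funext x
  have h : HasFDerivAt (fun y : E ↦ x + NormedSpace.exp (ℓ x • A) y)
      (NormedSpace.exp (ℓ x • A)) (1 : E) := (ContinuousLinearMap.hasFDerivAt _).const_add x
  change mfderiv 𝓘(ℝ, E) 𝓘(ℝ, E) (fun y : E ↦ x + NormedSpace.exp (ℓ x • A) y) (1 : E) v = _
  rw [mfderiv_eq_fderiv, h.fderiv]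
  rfl

theorem hasFDerivAt_exp_smul_apply (ℓ : E →L[ℝ] ℝ) (A : E →L[ℝ] E) (v : E) :
    HasFDerivAt (fun x ↦ NormedSpace.exp (ℓ x • A) v) (ℓ.smulRight (A v)) 0 := by
  have h : HasDerivAt (fun s : ℝ ↦ NormedSpace.exp (s • A) v) (A v) (ℓ 0) := by
    simpa using (hasDerivAt_exp_smul_const' A (ℓ 0)).clm_apply (hasDerivAt_const (ℓ 0) v)
  refine (h.hasFDerivAt.comp (0 : E) ℓ.hasFDerivAt).congr_fderiv ?_
  ext x
  simp

theorem mlieBracket_eq_fderiv_sub (V W : E → E) (x : E) :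
    mlieBracket 𝓘(ℝ, E) (V : Π x : E, TangentSpace 𝓘(ℝ, E) x) W x =
      fderiv ℝ W x (V x) - fderiv ℝ V x (W x) := by
  refine (congrFun (mlieBracketWithin_univ (I := 𝓘(ℝ, E)) (V := V) (W := W)).symm x).trans
    ((congrFun (mlieBracketWithin_eq_lieBracketWithin (𝕜 := ℝ) (V := V) (W := W)) x).trans ?_)
  rw [lieBracketWithin_univ]
  rfl

theorem bracket_expGroup (ℓ : E →L[ℝ] ℝ) (A : E →L[ℝ] E) (hA : ∀ x, ℓ (A x) = 0) :
    letI := expGroup ℓ A hA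
    ∀ v w : GroupLieAlgebra 𝓘(ℝ, E) E, ⁅v, w⁆ = ℓ v • A w - ℓ w • A v := by
  let := expGroup ℓ A hA
  intro v w
  have h : ∀ V W : E → E, V = (fun x ↦ NormedSpace.exp (ℓ x • A) v) →
      W = (fun x ↦ NormedSpace.exp (ℓ x • A) w) →
      mlieBracket 𝓘(ℝ, E) (V : Π x : E, TangentSpace 𝓘(ℝ, E) x) W (0 : E) =
        ℓ v • A w - ℓ w • A v := by
    rintro V W rfl rfl
    rw [mlieBracket_eq_fderiv_sub, (hasFDerivAt_exp_smul_apply ℓ A v).fderiv,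
      (hasFDerivAt_exp_smul_apply ℓ A w).fderiv]
    simp
    rfl
  exact h _ _ (mulInvariantVectorField_expGroup ℓ A hA v)
    (mulInvariantVectorField_expGroup ℓ A hA w)

end ExpGroup

theorem exists_simplyConnected_lieGroup {𝔤 : Type*} [LieRing 𝔤] [LieAlgebra ℝ 𝔤]
    [LieAlgebra.IsSolvable 𝔤] (h3 : Module.finrank ℝ 𝔤 = 3) :
    ∃ (G : Type) (_ : TopologicalSpace G) (_ : ChartedSpace (EuclideanSpace ℝ (Fin 3)) G)
      (_ : Group G) (_ : LieGroup (𝓡 3) ∞ G),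
      SimplyConnectedSpace G ∧ Nonempty (GroupLieAlgebra (𝓡 3) G ≃ₗ⁅ℝ⁆ 𝔤) := by
  obtain ⟨b, α, β, γ, δ, h⟩ := exists_isAdapted h3
  let e : Module.Basis (Fin 3) ℝ (EuclideanSpace ℝ (Fin 3)) :=
    (EuclideanSpace.basisFun (Fin 3) ℝ).toBasis
  let ℓ : EuclideanSpace ℝ (Fin 3) →L[ℝ] ℝ := LinearMap.toContinuousLinearMap (e.coord 0)
  let A : EuclideanSpace ℝ (Fin 3) →L[ℝ] EuclideanSpace ℝ (Fin 3) :=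
    LinearMap.toContinuousLinearMap
      (e.constr ℝ ![0, α • e 1 + γ • e 2, β • e 1 + δ • e 2])
  have hA0 : A (e 0) = 0 := by simp [A]
  have hA1 : A (e 1) = α • e 1 + γ • e 2 := by simp [A]
  have hA2 : A (e 2) = β • e 1 + δ • e 2 := by simp [A]
  have hℓ : ∀ i, ℓ (e i) = if i = 0 then 1 else 0 := fun i ↦ by
    simp [ℓ, Module.Basis.coord_apply, Finsupp.single_apply]
  have hA : ∀ x, ℓ (A x) = 0 := by
    have : ((ℓ ∘L A : EuclideanSpace ℝ (Fin 3) →L[ℝ] ℝ) :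
        EuclideanSpace ℝ (Fin 3) →ₗ[ℝ] ℝ) = 0 := e.ext fun i ↦ by
      fin_cases i <;> simp [hA0, hA1, hA2, hℓ]
    exact fun x ↦ congrArg (fun T ↦ T x) this
  let := expGroup ℓ A hA
  have := lieGroup_expGroup ℓ A hA
  let φ : EuclideanSpace ℝ (Fin 3) ≃ₗ[ℝ] 𝔤 := e.equiv b (Equiv.refl _)
  let φ' : GroupLieAlgebra (𝓡 3) (EuclideanSpace ℝ (Fin 3)) ≃ₗ[ℝ] 𝔤 := φ
  refine ⟨EuclideanSpace ℝ (Fin 3), inferInstance, inferInstance, inferInstance, inferInstance,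
    inferInstance, ⟨{ φ' with map_lie' := ?_ }⟩⟩
  intro x y
  have hexp : ∀ z : EuclideanSpace ℝ (Fin 3), ∃ z₀ z₁ z₂ : ℝ,
      z = z₀ • e 0 + z₁ • e 1 + z₂ • e 2 := fun z ↦
    ⟨e.repr z 0, e.repr z 1, e.repr z 2, by
      conv_lhs => rw [← e.sum_repr z, Fin.sum_univ_three]⟩
  have hφ : ∀ z₀ z₁ z₂ : ℝ, φ (z₀ • e 0 + z₁ • e 1 + z₂ • e 2) =
      z₀ • b 0 + z₁ • b 1 + z₂ • b 2 := fun z₀ z₁ z₂ ↦ by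
    simp only [φ, map_add, map_smul, Module.Basis.equiv_apply, Equiv.refl_apply]
  obtain ⟨x₀, x₁, x₂, hx⟩ := hexp x
  obtain ⟨y₀, y₁, y₂, hy⟩ := hexp y
  have hlin : ∀ z₀ z₁ z₂ : ℝ, ℓ (z₀ • e 0 + z₁ • e 1 + z₂ • e 2) = z₀ ∧
      A (z₀ • e 0 + z₁ • e 1 + z₂ • e 2) =
        (z₁ * α + z₂ * β) • e 1 + (z₁ * γ + z₂ * δ) • e 2 := fun z₀ z₁ z₂ ↦ by
    refine ⟨by simp [hℓ], ?_⟩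
    rw [map_add, map_add, map_smul, map_smul, map_smul, hA0, hA1, hA2]
    module
  have hxy : ∀ x' y' : EuclideanSpace ℝ (Fin 3), x' = x₀ • e 0 + x₁ • e 1 + x₂ • e 2 →
      y' = y₀ • e 0 + y₁ • e 1 + y₂ • e 2 → ℓ x' • A y' - ℓ y' • A x' =
        (0 : ℝ) • e 0 + (x₀ * (y₁ * α + y₂ * β) - y₀ * (x₁ * α + x₂ * β)) • e 1 +
        (x₀ * (y₁ * γ + y₂ * δ) - y₀ * (x₁ * γ + x₂ * δ)) • e 2 := by
    rintro _ _ rfl rfl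
    rw [(hlin _ _ _).1, (hlin _ _ _).1, (hlin _ _ _).2, (hlin _ _ _).2]
    module
  change φ' ⁅x, y⁆ = ⁅φ x, φ y⁆
  refine (congrArg φ ((bracket_expGroup ℓ A hA x y).trans (hxy x y hx hy))).trans ?_
  rw [hφ, hx, hy, hφ, hφ]
  have h10 : ⁅b 1, b 0⁆ = -(α • b 1 + γ • b 2) := by rw [← lie_skew, h.lie01]
  have h20 : ⁅b 2, b 0⁆ = -(β • b 1 + δ • b 2) := by rw [← lie_skew, h.lie02]
  have h21 : ⁅b 2, b 1⁆ = 0 := by rw [← lie_skew, h.lie12, neg_zero]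
  simp only [add_lie, lie_add, smul_lie, lie_smul, lie_self, h.lie01, h.lie02, h.lie12, h10, h20,
    h21]
  module

end IndexOfSymmetry

theorem mainTheorem2 :
    (∀ (𝔤 : Type*) [LieRing 𝔤] [LieAlgebra ℝ 𝔤] [LieAlgebra.IsSolvable 𝔤],
      Module.finrank ℝ 𝔤 = 3 →
      -- the simply connected Lie group with Lie algebra `𝔤` exists
      (∃ (G : Type) (_ : TopologicalSpace G) (_ : ChartedSpace (EuclideanSpace ℝ (Fin 3)) G)
        (_ : Group G) (_ : LieGroup (𝓡 3) ∞ G),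
        SimplyConnectedSpace G ∧ Nonempty (GroupLieAlgebra (𝓡 3) G ≃ₗ⁅ℝ⁆ 𝔤)) ∧
      -- there is an inner product `Q` on `𝔤` whose left-invariant metric has positive index
      ∃ Q : LinearMap.BilinForm ℝ 𝔤, (∀ x y, Q x y = Q y x) ∧ (∀ x, x ≠ 0 → 0 < Q x x) ∧
        ∀ (G : Type*) [TopologicalSpace G] [ChartedSpace (EuclideanSpace ℝ (Fin 3)) G] [Group G]
          [LieGroup (𝓡 3) ∞ G] (φ : GroupLieAlgebra (𝓡 3) G ≃ₗ⁅ℝ⁆ 𝔤),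
          ∃ g : IndexOfSymmetry.RiemMetric (𝓡 3) G,
            IndexOfSymmetry.IsLeftInvariant g ∧
            (∀ u v : GroupLieAlgebra (𝓡 3) G, g.inner 1 u v = Q (φ u) (φ v)) ∧
            0 < IndexOfSymmetry.indexOfSymmetry g) ∧
    (∀ (G : Type*) [TopologicalSpace G] [ChartedSpace (EuclideanSpace ℝ (Fin 3)) G] [Group G]
      [LieGroup (𝓡 3) ∞ G] [LieAlgebra.IsSolvable (GroupLieAlgebra (𝓡 3) G)]
      (g : IndexOfSymmetry.RiemMetric (𝓡 3) G), IndexOfSymmetry.IsLeftInvariant g →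
      IndexOfSymmetry.indexOfSymmetry g ≠ 2) := by
  refine ⟨fun 𝔤 _ _ _ h3 ↦ ⟨IndexOfSymmetry.exists_simplyConnected_lieGroup h3, ?_⟩,
    fun G _ _ _ _ _ g hg ↦ IndexOfSymmetry.indexOfSymmetry_ne_two g hg⟩
  obtain ⟨b, hb⟩ := IndexOfSymmetry.exists_metric_pos_index h3
  refine ⟨LinearMap.mk₂ ℝ (fun x y ↦ ∑ i, b.repr x i * b.repr y i)
    (fun x x' y ↦ by simp [add_mul, Finset.sum_add_distrib])
    (fun c x y ↦ by simp [mul_assoc, Finset.mul_sum])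
    (fun x y y' ↦ by simp [mul_add, Finset.sum_add_distrib])
    (fun c x y ↦ by simp [mul_left_comm, Finset.mul_sum]),
    fun x y ↦ by simp [mul_comm], fun x hx ↦ ?_, fun G _ _ _ _ φ ↦
    ⟨_, IndexOfSymmetry.isLeftInvariant_leftInvariantMetric _, fun u v ↦ ?_, hb G φ⟩⟩
  · rw [LinearMap.mk₂_apply]
    refine lt_of_le_of_ne (Finset.sum_nonneg fun i _ ↦ mul_self_nonneg _) fun h ↦ hx ?_
    rw [eq_comm, Finset.sum_eq_zero_iff_of_nonneg fun i _ ↦ mul_self_nonneg _] at h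
    exact b.ext_elem fun i ↦ by simpa using h i (Finset.mem_univ i)
  · exact IndexOfSymmetry.leftInvariantMetric_inner_one _ u v
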